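/- Let $\Sigma_{g,k}$ ($g,k\ge 0$) be the compact orientable surface obtained from the 2-sphere by deleting $g+k$ open disks with pairwise disjoint closures and gluing a handle (a torus with an open disk deleted) along its boundary circle to each of the first $g$ boundary circles. Let $U_{g,k}$ ($g\ge 1$, $k\ge 0$) be the compact nonorientable surface obtained in the same way with Möbius bands in place of handles. Put $\Sigma_g=\Sigma_{g,0}$ and $U_g=U_{g,0}$, and let $H_1$ denote first singular homology with integer coefficients. 1. For all $g,k\ge 0$, and at every base point, $$\pi_1(\Sigma_{g,k})\cong\langle a_1,b_1,\dots,a_g,b_g,c_1,\dots,c_k \mid a_1b_1a_1^{-1}b_1^{-1}\cdots a_gb_ga_g^{-1}b_g^{-1}\,c_1\cdots c_k\rangle .$$ 2. For all $g\ge 1$, $k\ge 0$, and at every base point, $$\pi_1(U_{g,k})\cong\langle a_1,\dots,a_g,c_1,\dots,c_k \mid a_1^2\cdots a_g^2\,c_1\cdots c_k\rangle .$$ 3. $H_1(\Sigma_g)\cong\mathbb Z^{2g}$ for all $g\ge 0$, and $H_1(U_g)\cong\mathbb Z/2\oplus\mathbb Z^{g-1}$ for all $g\ge 1$. 4. The groups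 in 3 distinguish the closed surfaces: $H_1(\Sigma_g)\cong H_1(\Sigma_h)$ only if $g=h$; for $g,h\ge 1$, $H_1(U_g)\cong H_1(U_h)$ only if $g=h$; and $H_1(\Sigma_g)\not\cong H_1(U_h)$ for all $g\ge 0$, $h\ge 1$. Hence $\Sigma_g$ and $\Sigma_h$ are homeomorphic only if $g=h$, $U_g$ and $U_h$ ($g,h\ge 1$) are homeomorphic only if $g=h$, and no $\Sigma_g$ is homeomorphic to any $U_h$ with $h\ge 1$. -/

import Mathlib

namespace CompactSurface

/-! ### Pieces -/

/-- The 2-sphere `ℂ ∪ {∞}` with the `n` disjoint open round disks of radius `1` centred at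
`0, 3, 6, …, 3 (n - 1)` deleted. -/
def HoledSphere (n : ℕ) : Type :=
  {x : OnePoint ℂ // ∀ i : Fin n,
    x ∉ ((↑) : ℂ → OnePoint ℂ) '' Metric.ball (3 * ((i : ℕ) : ℂ)) 1}

instance (n : ℕ) : TopologicalSpace (HoledSphere n) :=
  inferInstanceAs (TopologicalSpace {x : OnePoint ℂ // ∀ i : Fin n,
    x ∉ ((↑) : ℂ → OnePoint ℂ) '' Metric.ball (3 * ((i : ℕ) : ℂ)) 1})

theorem rim_not_mem (i j : ℕ) (z : Circle) :
    (3 * (j : ℂ) + (z : ℂ)) ∉ Metric.ball (3 * (i : ℂ)) 1 := by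
  rw [Metric.mem_ball, not_lt, dist_eq_norm]
  have hz : ‖(z : ℂ)‖ = 1 := Circle.norm_coe z
  rcases eq_or_ne j i with rfl | h
  · rw [add_sub_cancel_left]
    exact hz.ge
  · have h0 : ((j : ℤ) - (i : ℤ)) ≠ 0 := by omega
    have h1 : (1 : ℝ) ≤ ‖(((j : ℤ) - (i : ℤ) : ℤ) : ℂ)‖ := by
      rw [Complex.norm_intCast]
      exact_mod_cast Int.one_le_abs h0
    have h2 : (3 * (j : ℂ) + (z : ℂ)) - 3 * (i : ℂ)
        = 3 * (((j : ℤ) - (i : ℤ) : ℤ) : ℂ) - (-(z : ℂ)) := by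
      push_cast; ring
    have h3 := norm_sub_norm_le (3 * (((j : ℤ) - (i : ℤ) : ℤ) : ℂ)) (-(z : ℂ))
    rw [h2]
    rw [norm_mul, norm_neg, hz] at h3
    norm_num at h3 h1 ⊢
    linarith

/-- The boundary circle of the `j`-th hole. -/
def HoledSphere.rim {n : ℕ} (j : Fin n) (z : Circle) : HoledSphere n :=
  ⟨((3 * ((j : ℕ) : ℂ) + (z : ℂ) : ℂ) : OnePoint ℂ), by
    rintro i ⟨w, hw, h⟩
    rw [OnePoint.coe_eq_coe] at h
    exact rim_not_mem i j z (h ▸ hw)⟩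

/-- A handle: the torus `ℝ/ℤ × ℝ/ℤ` with the open round disk of radius `1/4` centred at the
origin deleted. (The norm on `ℝ/ℤ` is the distance to `0`.) -/
def Handle : Type :=
  {p : AddCircle (1 : ℝ) × AddCircle (1 : ℝ) // (1 / 4 : ℝ) ^ 2 ≤ ‖p.1‖ ^ 2 + ‖p.2‖ ^ 2}

instance : TopologicalSpace Handle :=
  inferInstanceAs (TopologicalSpace
    {p : AddCircle (1 : ℝ) × AddCircle (1 : ℝ) // (1 / 4 : ℝ) ^ 2 ≤ ‖p.1‖ ^ 2 + ‖p.2‖ ^ 2})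

theorem norm_coe_quarter {x : ℝ} (hx : |x| ≤ 1) :
    ‖((x / 4 : ℝ) : AddCircle (1 : ℝ))‖ = |x| / 4 := by
  have h4 : |x / 4| = |x| / 4 := by rw [abs_div]; norm_num
  rw [(AddCircle.norm_coe_eq_abs_iff (1 : ℝ) one_ne_zero).2 _, h4]
  rw [h4]; norm_num; linarith

/-- The boundary circle of the handle. -/
noncomputable def Handle.rim (z : Circle) : Handle :=
  ⟨((((z : ℂ).re / 4 : ℝ) : AddCircle (1 : ℝ)), (((z : ℂ).im / 4 : ℝ) : AddCircle (1 : ℝ))), by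
    have hz : ‖(z : ℂ)‖ = 1 := Circle.norm_coe z
    have hre : |(z : ℂ).re| ≤ 1 := hz ▸ Complex.abs_re_le_norm (z : ℂ)
    have him : |(z : ℂ).im| ≤ 1 := hz ▸ Complex.abs_im_le_norm (z : ℂ)
    have h : (z : ℂ).re ^ 2 + (z : ℂ).im ^ 2 = 1 := by
      have := Complex.sq_norm (z : ℂ)
      rw [hz, Complex.normSq_apply] at this
      nlinarith
    have h1 : |(z : ℂ).re| ^ 2 = (z : ℂ).re ^ 2 := sq_abs _
    have h2 : |(z : ℂ).im| ^ 2 = (z : ℂ).im ^ 2 := sq_abs _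
    rw [norm_coe_quarter hre, norm_coe_quarter him]
    nlinarith⟩

/-- The identification `(0, t) ∼ (1, 1 - t)` on the unit square. -/
inductive MobiusRel : unitInterval × unitInterval → unitInterval × unitInterval → Prop
  | glue (t : unitInterval) : MobiusRel (0, t) (1, unitInterval.symm t)

/-- The Möbius band, as a quotient space of the unit square. -/
def MobiusBand : Type := Quot MobiusRel

instance : TopologicalSpace MobiusBand := inferInstanceAs (TopologicalSpace (Quot MobiusRel))

/-- The class of a point of the unit square in the Möbius band. -/
def MobiusBand.mk (p : unitInterval × unitInterval) : MobiusBand := Quot.mk MobiusRel p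

/-! ### The surfaces -/

/-- The boundary circle of the `j`-th handle is glued to the `j`-th hole of the sphere. -/
inductive HandleRel (g k : ℕ) :
    HoledSphere (g + k) ⊕ (Fin g × Handle) → HoledSphere (g + k) ⊕ (Fin g × Handle) → Prop
  | glue (j : Fin g) (z : Circle) :
      HandleRel g k (Sum.inl (HoledSphere.rim (Fin.castAdd k j) z)) (Sum.inr (j, Handle.rim z))

/-- The orientable surface of genus `g` with `k` boundary components: the sphere with `g + k`
holes, with handles attached to the first `g` of them. -/
def OrientableSurface (g k : ℕ) : Type := Quot (HandleRel g k)

instance (g k : ℕ) : TopologicalSpace (OrientableSurface g k) :=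
  inferInstanceAs (TopologicalSpace (Quot (HandleRel g k)))

/-- The boundary circle of the `j`-th Möbius band, which consists of the two arcs `[0,1] × {0}`
and `[0,1] × {1}`, is glued to the `j`-th hole of the sphere, the first arc to the upper and the
second one to the lower half circle. -/
inductive CrossCapRel (g k : ℕ) :
    HoledSphere (g + k) ⊕ (Fin g × MobiusBand) →
      HoledSphere (g + k) ⊕ (Fin g × MobiusBand) → Prop
  | upper (j : Fin g) (t : unitInterval) :
      CrossCapRel g k
        (Sum.inl (HoledSphere.rim (Fin.castAdd k j) (Circle.exp (Real.pi * (t : ℝ)))))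
        (Sum.inr (j, MobiusBand.mk (t, 0)))
  | lower (j : Fin g) (t : unitInterval) :
      CrossCapRel g k
        (Sum.inl (HoledSphere.rim (Fin.castAdd k j) (Circle.exp (Real.pi * (1 + (t : ℝ))))))
        (Sum.inr (j, MobiusBand.mk (t, 1)))

/-- The nonorientable surface of genus `g ≥ 1` with `k` boundary components: the sphere with
`g + k` holes, with Möbius bands attached to the first `g` of them. -/
def NonorientableSurface (g k : ℕ) : Type := Quot (CrossCapRel g k)

instance (g k : ℕ) : TopologicalSpace (NonorientableSurface g k) :=
  inferInstanceAs (TopologicalSpace (Quot (CrossCapRel g k)))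

/-! ### The groups -/

/-- Generators `a₁, b₁, …, a_g, b_g, c₁, …, c_k`. -/
inductive OrientableGen (g k : ℕ) : Type
  | a (i : Fin g)
  | b (i : Fin g)
  | c (j : Fin k)

/-- The word `[a₁, b₁] ⋯ [a_g, b_g] c₁ ⋯ c_k`, where `[a, b] = a b a⁻¹ b⁻¹`. -/
def orientableRelator (g k : ℕ) : FreeGroup (OrientableGen g k) :=
  (List.ofFn fun i : Fin g =>
      FreeGroup.of (OrientableGen.a i) * FreeGroup.of (OrientableGen.b i) *
        (FreeGroup.of (OrientableGen.a i))⁻¹ * (FreeGroup.of (OrientableGen.b i))⁻¹).prod *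
    (List.ofFn fun j : Fin k => FreeGroup.of (OrientableGen.c j)).prod

/-- Generators `a₁, …, a_g, c₁, …, c_k`. -/
inductive NonorientableGen (g k : ℕ) : Type
  | a (i : Fin g)
  | c (j : Fin k)

/-- The word `a₁² ⋯ a_g² c₁ ⋯ c_k`. -/
def nonorientableRelator (g k : ℕ) : FreeGroup (NonorientableGen g k) :=
  (List.ofFn fun i : Fin g => FreeGroup.of (NonorientableGen.a i) ^ 2).prod *
    (List.ofFn fun j : Fin k => FreeGroup.of (NonorientableGen.c j)).prod

/-- The first singular homology group with integer coefficients. -/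
noncomputable abbrev H1 (X : Type) [TopologicalSpace X] : Type :=
  ((AlgebraicTopology.singularHomologyFunctor (ModuleCat.{0} ℤ) 1).obj
    (ModuleCat.of ℤ ℤ)).obj (TopCat.of X)

end CompactSurface

/-! ### Paths, and functors on the fundamental groupoid from local data -/

section

open Set unitInterval Topology

set_option linter.unusedSectionVars false

/-! Instead of manipulating words in loops, the proof classifies functors. A `Holonomy X G` is a
functor from the fundamental groupoid of `X` to a group `G`. Suppose that loops `ℓ i` at `x₀` and a
word `r` are such that every functor satisfies `r` on the `ℓ i`, all values satisfying `r` are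
attained by some functor, and two functors with equal values on the `ℓ i` are isomorphic by a
transformation that is trivial at `x₀` (`IsPresentedBy`). A Yoneda argument then gives `π₁ ≅ ⟨ℓ |
r⟩` (`IsPresentedBy.nonempty_mulEquiv`). The group `H₁` carries the universal functor to abelian
groups, up to coboundaries (`SingularChains.exists_hurewicz`), so it is the abelian group with the
same generators and relation (`IsPresentedBy.nonempty_H1_equiv`).

The content of van Kampen's theorem is that functors and natural transformations are local objects:
data that are multiplicative and homotopy invariant on each set of an open cover extend to a functor
(`exists_holonomy_of_local`), and naturality may be tested on small paths
(`Holonomy.natAlong_of_openCover`). With collars this yields gluing along boundary circles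
(`IsGluing.exists_holonomy`, `IsGluing.natAlong`).

It remains to treat the pieces. The sphere with holes in a row along the real axis is the union of
an upper and a lower half, each contracting to infinity. A functor is therefore a coboundary of `u`
on one half and of `v` on the other, and `u * v⁻¹` is constant on each gap between holes. The loop
around a hole measures the jump from one gap to the next; the jumps telescope to `1` around the real
projective line, and this is the only relation (`HoledSphere.prod_holeLoop`,
`HoledSphere.exists_holonomy`, `HoledSphere.exists_natAlong`). On the handle, two values can be
prescribed freely and determine the functor, and unfolding the boundary circle into four quarter
circles at the corners of a square shows that it is a commutator. The Möbius band retracts to its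
core, and its boundary runs twice around it. Replacing the loops around the first `g` holes by these
words in the relation for the sphere gives the two relators.

In an abelian group the orientable relator is trivial and the nonorientable one says that twice the
sum of the generators vanishes. Rank and 2-torsion tell the resulting groups apart, and
homeomorphisms induce isomorphisms on `H₁`. -/

theorem unitInterval.induction_of_local {Q : I → I → Prop}
    (htrans : ∀ s t u, s ≤ t → t ≤ u → Q s t → Q t u → Q s u)
    (hloc : ∀ x, ∃ U ∈ 𝓝 x, ∀ s t, s ≤ t → Icc s t ⊆ U → Q s t) : Q 0 1 := by
  choose U hU hQ using hloc
  -- By compactness there is a subdivision, eventually constant at `1`, each interval of which lies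
  -- in one of the sets `U x`.
  obtain ⟨t, h0, hm, ⟨n, hn⟩, hc⟩ := exists_monotone_Icc_subset_open_cover_unitInterval
    (c := fun x => interior (U x)) (fun _ => isOpen_interior)
    (fun x _ => mem_iUnion.2 ⟨x, mem_interior_iff_mem_nhds.2 (hU x)⟩)
  have key : ∀ m, Q 0 (t m) := by
    intro m
    induction m with
    | zero => rw [h0]; exact hQ 0 0 0 le_rfl (by simpa using mem_of_mem_nhds (hU 0))
    | succ m ih =>
      obtain ⟨i, hi⟩ := hc m
      have hle := hm (Nat.le_succ m)
      exact htrans _ _ _ unitInterval.nonneg' hle ih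
        (hQ i _ _ hle (hi.trans interior_subset))
  have := key n
  rwa [hn n le_rfl] at this

/-- The end points are part of the type of a path. This exchanges paths that agree pointwise but
whose end points are only propositionally equal, and so avoids casts. -/
theorem Path.congr_val {X α : Type*} [TopologicalSpace X] (f : ∀ ⦃x y : X⦄, Path x y → α)
    {x y x' y' : X} (γ : Path x y) (δ : Path x' y') (h : ∀ t, γ t = δ t) : f γ = f δ := by
  have hx : x = x' := by rw [← γ.source, ← δ.source, h]
  have hy : y = y' := by rw [← γ.target, ← δ.target, h]
  subst hx hy
  rw [Path.ext (funext h)]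

/-- The straight-line homotopy. That it stays in `S` is recorded because functions on paths are at
first known to be homotopy invariant only inside small sets. -/
theorem Convex.exists_homotopy {E : Type*} [AddCommGroup E] [Module ℝ E] [TopologicalSpace E]
    [IsTopologicalAddGroup E] [ContinuousSMul ℝ E] {S : Set E} (hS : Convex ℝ S) {x y : E}
    (γ δ : Path x y) (hγ : ∀ t, γ t ∈ S) (hδ : ∀ t, δ t ∈ S) :
    ∃ H : γ.Homotopy δ, ∀ p, H p ∈ S := by
  refine ⟨⟨⟨⟨fun p => (1 - (p.1 : ℝ)) • γ p.2 + (p.1 : ℝ) • δ p.2, by fun_prop⟩,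
    fun t => by simp, fun t => by simp⟩, ?_⟩, fun p => ?_⟩
  · rintro t s (rfl | rfl) <;> simp [← add_smul]
  · exact hS (hγ _) (hδ _) (by linarith [p.1.2.2]) p.1.2.1 (by ring)

section Local

variable {X G : Type*} [TopologicalSpace X] [Group G]

/-- A function on paths which, on the paths inside `U`, is multiplicative and invariant under
homotopies inside `U`. -/
structure IsHolonomyOn (U : Set X) (f : ∀ ⦃x y : X⦄, Path x y → G) : Prop where
  trans : ∀ ⦃x y z : X⦄ (γ : Path x y) (δ : Path y z), (∀ t, γ t ∈ U) → (∀ t, δ t ∈ U) →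
    f (γ.trans δ) = f γ * f δ
  homotopy : ∀ ⦃x y : X⦄ (γ δ : Path x y) (H : γ.Homotopy δ), (∀ p, H p ∈ U) → f γ = f δ

variable {f : ∀ ⦃x y : X⦄, Path x y → G}

theorem Path.subpath_mem_image {x y : X} (γ : Path x y) {s t : I} (hst : s ≤ t) (v : I) :
    γ.subpath s t v ∈ γ '' Icc s t := by
  have : γ.subpath s t v ∈ range (γ.subpath s t) := ⟨v, rfl⟩
  rwa [Path.range_subpath_of_le _ _ _ hst] at this

theorem Path.extend_subpath_id {x y : X} (γ : Path x y) (s t v : I) :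
    γ.extend (Path.id.subpath s t v : I) = γ.subpath s t v :=
  Path.extend_extends' γ _

/-- A subpath and the composite of its two parts differ by a reparametrization, hence by a homotopy
inside the convex interval `[s, u]`; its image under `γ` does not leave `U`. -/
theorem IsHolonomyOn.subpath {U : Set X} (hf : IsHolonomyOn U f) {x y : X} (γ : Path x y)
    {s t u : I} (hst : s ≤ t) (htu : t ≤ u) (hγ : ∀ v ∈ Icc s u, γ v ∈ U) :
    f (γ.subpath s u) = f (γ.subpath s t) * f (γ.subpath t u) := by
  have h1 : ∀ v, Path.id.subpath s t v ∈ Icc s u := fun v => by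
    obtain ⟨w, hw, h⟩ := Path.id.subpath_mem_image hst v
    rw [← h]; exact ⟨hw.1, hw.2.trans htu⟩
  have h2 : ∀ v, Path.id.subpath t u v ∈ Icc s u := fun v => by
    obtain ⟨w, hw, h⟩ := Path.id.subpath_mem_image htu v
    rw [← h]; exact ⟨hst.trans hw.1, hw.2⟩
  have h3 : ∀ v, Path.id.subpath s u v ∈ Icc s u := fun v => by
    obtain ⟨w, hw, h⟩ := Path.id.subpath_mem_image (hst.trans htu) v
    rw [← h]; exact hw
  have h12 : ∀ v, (Path.id.subpath s t).trans (Path.id.subpath t u) v ∈ Icc s u := fun v => by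
    rw [Path.trans_apply]; split_ifs
    exacts [h1 _, h2 _]
  obtain ⟨H, hH⟩ := (convex_Icc (s : ℝ) u).exists_homotopy
    ((Path.id.subpath s u).map continuous_subtype_val)
    (((Path.id.subpath s t).trans (Path.id.subpath t u)).map continuous_subtype_val)
    h3 h12
  have hU : ∀ r ∈ Icc (s : ℝ) u, γ.extend r ∈ U := fun r hr => by
    have hr' : r ∈ I := ⟨s.2.1.trans hr.1, hr.2.trans u.2.2⟩
    rw [Path.extend_apply γ hr']
    exact hγ _ hr
  have e := hf.homotopy _ _ (H.map ⟨γ.extend, γ.continuous_extend⟩) (fun p => hU _ (hH p))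
  rw [Path.congr_val f _ (γ.subpath s u) (fun v => γ.extend_subpath_id s u v)] at e
  have e2 : f ((((Path.id.subpath s t).trans (Path.id.subpath t u)).map
      continuous_subtype_val).map γ.continuous_extend) = f ((γ.subpath s t).trans
        (γ.subpath t u)) := by
    refine Path.congr_val f _ _ fun v => ?_
    simp only [Path.map_coe, Function.comp, Path.trans_apply]
    split_ifs
    exacts [γ.extend_subpath_id s t _, γ.extend_subpath_id t u _]
  have e3 := hf.trans (γ.subpath s t) (γ.subpath t u)
    (fun v => by
      obtain ⟨w, hw, h⟩ := γ.subpath_mem_image hst v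
      rw [← h]; exact hγ _ ⟨hw.1, hw.2.trans htu⟩)
    (fun v => by
      obtain ⟨w, hw, h⟩ := γ.subpath_mem_image htu v
      rw [← h]; exact hγ _ ⟨hst.trans hw.1, hw.2⟩)
  rw [← e3, ← e2]
  exact e

end Local

/-- A `G`-valued functor on the fundamental groupoid of `X`. -/
structure Holonomy (X G : Type*) [TopologicalSpace X] [Group G] where
  val : ∀ ⦃x y : X⦄, Path x y → G
  isHolonomyOn : IsHolonomyOn univ val

section Develop

variable {X G E ι : Type*} [TopologicalSpace X] [Group G] [AddCommGroup E] [Module ℝ E]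
  [TopologicalSpace E] [IsTopologicalAddGroup E] [ContinuousSMul ℝ E]
  {f : ∀ ⦃x y : X⦄, Path x y → G} {c : ι → Set X}

/-- `θ` develops `f` over the part `S` of `E`, for a map `φ : E → X`. -/
def Develops (f : ∀ ⦃x y : X⦄, Path x y → G) (c : ι → Set X) (φ : C(E, X)) (S : Set E)
    (θ : E → G) : Prop :=
  ∀ i, ∀ ⦃x y : E⦄ (γ : Path x y), (∀ t, γ t ∈ S) → (∀ t, φ (γ t) ∈ c i) →
    f (γ.map φ.continuous) = (θ x)⁻¹ * θ y

theorem Develops.mono {φ : C(E, X)} {S T : Set E} {θ : E → G} (h : Develops f c φ S θ)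
    (hT : T ⊆ S) : Develops f c φ T θ :=
  fun i _ _ γ h1 h2 => h i γ (fun t => hT (h1 t)) h2

/-- The primitive at `y` is the value of `f` on the segment from a fixed point to `y`. It works
because triangles in a convex set are contractible. -/
theorem exists_develops_of_convex {φ : C(E, X)} {S : Set E} (hS : Convex ℝ S) {i : ι}
    (hf : IsHolonomyOn (c i) f) (hi : ∀ x ∈ S, φ x ∈ c i) : ∃ θ, Develops f c φ S θ := by
  rcases S.eq_empty_or_nonempty with rfl | ⟨s, hs⟩
  · exact ⟨fun _ => 1, fun _ _ _ γ h => absurd (h 0) (notMem_empty _)⟩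
  have hseg : ∀ y ∈ S, ∀ t, Path.segment s y t ∈ S := fun y hy t =>
    hS.segment_subset hs hy (by rw [← Path.range_segment]; exact ⟨t, rfl⟩)
  refine ⟨fun y => f ((Path.segment s y).map φ.continuous), fun j x y γ hγ _ => ?_⟩
  have hx : x ∈ S := by simpa using hγ 0
  have hy : y ∈ S := by simpa using hγ 1
  have htr : ∀ t, (Path.segment s x).trans γ t ∈ S := fun t => by
    rw [Path.trans_apply]; split_ifs
    exacts [hseg x hx _, hγ _]
  obtain ⟨H, hH⟩ := hS.exists_homotopy ((Path.segment s x).trans γ) (Path.segment s y)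
    htr (hseg y hy)
  have e := hf.homotopy _ _ (H.map φ) (fun p => hi _ (hH p))
  have e' := hf.trans ((Path.segment s x).map φ.continuous) (γ.map φ.continuous)
    (fun t => hi _ (hseg x hx t)) (fun t => hi _ (hγ t))
  rw [← Path.map_trans, e] at e'
  rw [eq_inv_mul_iff_mul_eq]
  exact e'.symm

/-- On a piece so short that its image lies in one `c i`, the increment of either primitive is the
value of `f` on that image. Increments therefore depend only on the path in `X`, and not on the map
or the primitive used to compute them. -/
theorem Develops.eqOn_path {φ ψ : C(E, X)} {S T : Set E} {θ θ' : E → G}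
    (hc : ∀ i, IsOpen (c i)) (hcov : ∀ x, ∃ i, x ∈ c i)
    (h : Develops f c φ S θ) (h' : Develops f c ψ T θ') {x y x' y' : E} (γ : Path x y)
    (δ : Path x' y') (hS : ∀ t, γ t ∈ S) (hT : ∀ t, δ t ∈ T) (hφ : ∀ t, φ (γ t) = ψ (δ t)) :
    (θ x)⁻¹ * θ y = (θ' x')⁻¹ * θ' y' := by
  have := unitInterval.induction_of_local
    (Q := fun s t => (θ (γ s))⁻¹ * θ (γ t) = (θ' (δ s))⁻¹ * θ' (δ t)) ?_ ?_
  · simpa using this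
  · intro s t u _ _ h1 h2
    have := congr_arg₂ (· * ·) h1 h2
    simpa [mul_assoc] using this
  · intro s
    obtain ⟨i, hi⟩ := hcov (φ (γ s))
    refine ⟨_, ((hc i).preimage (φ.continuous.comp γ.continuous)).mem_nhds hi,
      fun a b hab hU => ?_⟩
    have hab' : ∀ t, φ (γ.subpath a b t) ∈ c i := fun t => by
      obtain ⟨w, hw, e⟩ := γ.subpath_mem_image hab t
      rw [← e]
      exact hU hw
    rw [← h i (γ.subpath a b) (fun t => hS _) hab', ← h' i (δ.subpath a b) (fun t => hT _)
      (fun t => by rw [Path.subpath]; exact (hφ _) ▸ hab' t)]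
    exact Path.congr_val f _ _ fun t => hφ _

/-- On the convex overlap the two primitives differ by a constant left factor. Left factors cancel
in the increments, so one primitive can be adjusted to fit the other. -/
theorem Develops.union {φ : C(E, X)} {A B : Set E} (hA : IsOpen A) (hB : IsOpen B)
    (hAB : Convex ℝ (A ∩ B)) (hne : (A ∩ B).Nonempty)
    (hc : ∀ i, IsOpen (c i)) (hcov : ∀ x, ∃ i, x ∈ c i) (hf : ∀ i, IsHolonomyOn (c i) f)
    (h1 : ∃ θ, Develops f c φ A θ) (h2 : ∃ θ, Develops f c φ B θ) :
    ∃ θ, Develops f c φ (A ∪ B) θ := by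
  classical
  obtain ⟨θ, h1⟩ := h1
  obtain ⟨θ', h2⟩ := h2
  obtain ⟨p, hp⟩ := hne
  have hag : ∀ x ∈ A ∩ B, θ x = θ p * (θ' p)⁻¹ * θ' x := fun x hx => by
    have hm : ∀ t, Path.segment p x t ∈ A ∩ B := fun t =>
      hAB.segment_subset hp hx (by rw [← Path.range_segment]; exact ⟨t, rfl⟩)
    have := Develops.eqOn_path hc hcov h1 h2 (Path.segment p x) (Path.segment p x)
      (fun t => (hm t).1) (fun t => (hm t).2) (fun _ => rfl)
    rw [mul_assoc, ← this, mul_inv_cancel_left]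
  let η : E → G := fun x => if x ∈ A then θ x else θ p * (θ' p)⁻¹ * θ' x
  have ηA : ∀ x ∈ A, η x = θ x := fun x hx => if_pos hx
  have ηB : ∀ x ∈ B, η x = θ p * (θ' p)⁻¹ * θ' x := fun x hx => by
    by_cases hxA : x ∈ A
    · rw [ηA x hxA, hag x ⟨hxA, hx⟩]
    · exact if_neg hxA
  refine ⟨η, fun i x y γ hγ hi => ?_⟩
  -- A path in `A ∪ B` need not lie in either set, but openness cuts it into pieces that do, and `f`
  -- is multiplicative over subpaths inside `c i`.
  have := unitInterval.induction_of_local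
    (Q := fun s t => f ((γ.map φ.continuous).subpath s t) = (η (γ s))⁻¹ * η (γ t)) ?_ ?_
  · rw [Path.congr_val f ((γ.map φ.continuous).subpath 0 1) (γ.map φ.continuous)
      (fun t => by simp [Path.subpath])] at this
    simpa using this
  · intro s t u hst htu e1 e2
    rw [(hf i).subpath (γ.map φ.continuous) hst htu (fun v _ => hi v), e1, e2, mul_assoc, mul_inv_cancel_left]
  · intro s
    have key : ∀ C : Set E, IsOpen C → γ s ∈ C →
        (∀ ⦃x y⦄ (δ : Path x y), (∀ t, δ t ∈ C) → (∀ t, φ (δ t) ∈ c i) →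
          f (δ.map φ.continuous) = (η x)⁻¹ * η y) →
        ∃ U ∈ 𝓝 s, ∀ a b, a ≤ b → Icc a b ⊆ U →
          f ((γ.map φ.continuous).subpath a b) = (η (γ a))⁻¹ * η (γ b) := by
      intro C hC hs hCη
      refine ⟨_, (hC.preimage γ.continuous).mem_nhds hs, fun a b hab hU => ?_⟩
      refine hCη (γ.subpath a b) (fun t => ?_) (fun t => hi _)
      obtain ⟨w, hw, e⟩ := γ.subpath_mem_image hab t
      rw [← e]
      exact hU hw
    rcases hγ s with hs | hs
    · refine key A hA hs fun x y δ hδ hδc => ?_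
      rw [h1 i δ hδ hδc, ηA x (by simpa using hδ 0), ηA y (by simpa using hδ 1)]
    · refine key B hB hs fun x y δ hδ hδc => ?_
      rw [h2 i δ hδ hδc, ηB x (by simpa using hδ 0), ηB y (by simpa using hδ 1)]
      group

theorem exists_develops_unitSquare {φ : C(ℝ × ℝ, X)} (hc : ∀ i, IsOpen (c i))
    (hcov : ∀ x, ∃ i, x ∈ c i) (hf : ∀ i, IsHolonomyOn (c i) f) :
    ∃ θ, Develops f c φ (Icc 0 1 ×ˢ Icc 0 1) θ := by
  obtain ⟨δ, hδ, hball⟩ := lebesgue_number_lemma_of_metric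
    ((isCompact_Icc (a := (0 : ℝ)) (b := 1)).prod (isCompact_Icc (a := (0 : ℝ)) (b := 1)))
    (fun i => (hc i).preimage φ.continuous)
    (fun x _ => mem_iUnion.2 (hcov (φ x)))
  obtain ⟨n, hn⟩ := exists_nat_one_div_lt hδ
  have hn0 : (0 : ℝ) < n + 1 := by positivity
  set d : ℝ := 1 / (n + 1) with hd
  have hd0 : 0 < d := by positivity
  have hdn : (n + 1) * d = 1 := by rw [hd]; field_simp
  -- The open squares of half-width `d` around the grid points `(i d, j d)` are balls for the sup
  -- metric of radius below the Lebesgue number. Neighbouring ones overlap in a rectangle, so they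
  -- can be joined to columns and the columns to a neighbourhood of the unit square.
  have hsmall : ∀ i j : ℕ, i ≤ n + 1 → j ≤ n + 1 →
      ∃ θ, Develops f c φ (Ioo (i * d - d) (i * d + d) ×ˢ Ioo (j * d - d) (j * d + d)) θ := by
    intro i j hi hj
    have hmem : ∀ k : ℕ, k ≤ n + 1 → (k : ℝ) * d ∈ Icc (0 : ℝ) 1 := fun k hk =>
      ⟨by positivity, by
        rw [← hdn]; exact mul_le_mul_of_nonneg_right (by exact_mod_cast hk) hd0.le⟩
    obtain ⟨l, hl⟩ := hball (i * d, j * d) ⟨hmem i hi, hmem j hj⟩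
    refine exists_develops_of_convex ((convex_Ioo _ _).prod (convex_Ioo _ _)) (hf l)
      fun x hx => hl ?_
    rw [← ball_prod_same, Real.ball_eq_Ioo, Real.ball_eq_Ioo]
    exact ⟨⟨by linarith [hx.1.1], by linarith [hx.1.2]⟩, ⟨by linarith [hx.2.1], by linarith [hx.2.2]⟩⟩
  have hcol : ∀ i : ℕ, i ≤ n + 1 → ∀ j : ℕ, j ≤ n + 1 →
      ∃ θ, Develops f c φ (Ioo (i * d - d) (i * d + d) ×ˢ Ioo (-d) (j * d + d)) θ := by
    intro i hi j
    induction j with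
    | zero =>
      intro hj
      simpa using hsmall i 0 hi hj
    | succ j ih =>
      intro hj
      have e : Ioo (-d) (j * d + d) ∪ Ioo (((j + 1 : ℕ) : ℝ) * d - d) (((j + 1 : ℕ) : ℝ) * d + d) =
          Ioo (-d) (((j + 1 : ℕ) : ℝ) * d + d) := by
        have : 0 ≤ (j : ℝ) * d := by positivity
        push_cast
        rw [Ioo_union_Ioo' (by linarith) (by linarith), max_eq_right (by linarith),
          min_eq_left (by linarith)]
      rw [← e, Set.prod_union]
      have : 0 ≤ (j : ℝ) * d := by positivity
      refine Develops.union (isOpen_Ioo.prod isOpen_Ioo) (isOpen_Ioo.prod isOpen_Ioo)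
        ?_ ⟨(i * d, j * d + d / 2), ?_⟩ hc hcov hf (ih (by omega)) (hsmall i (j + 1) hi hj)
      · exact ((convex_Ioo _ _).prod (convex_Ioo _ _)).inter ((convex_Ioo _ _).prod (convex_Ioo _ _))
      · push_cast
        refine ⟨⟨⟨?_, ?_⟩, ⟨?_, ?_⟩⟩, ⟨⟨?_, ?_⟩, ⟨?_, ?_⟩⟩⟩ <;> dsimp only <;> linarith
  have hrow : ∀ i : ℕ, i ≤ n + 1 →
      ∃ θ, Develops f c φ (Ioo (-d) (i * d + d) ×ˢ Ioo (-d) (((n + 1 : ℕ) : ℝ) * d + d)) θ := by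
    intro i
    induction i with
    | zero =>
      intro hi
      simpa using hcol 0 hi (n + 1) le_rfl
    | succ i ih =>
      intro hi
      have e : Ioo (-d) (i * d + d) ∪ Ioo (((i + 1 : ℕ) : ℝ) * d - d) (((i + 1 : ℕ) : ℝ) * d + d) =
          Ioo (-d) (((i + 1 : ℕ) : ℝ) * d + d) := by
        have : 0 ≤ (i : ℝ) * d := by positivity
        push_cast
        rw [Ioo_union_Ioo' (by linarith) (by linarith), max_eq_right (by linarith),
          min_eq_left (by linarith)]
      rw [← e, Set.union_prod]
      have : 0 ≤ (i : ℝ) * d := by positivity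
      refine Develops.union (isOpen_Ioo.prod isOpen_Ioo) (isOpen_Ioo.prod isOpen_Ioo)
        ?_ ⟨(i * d + d / 2, 0), ?_⟩ hc hcov hf (ih (by omega)) (hcol (i + 1) hi (n + 1) le_rfl)
      · exact ((convex_Ioo _ _).prod (convex_Ioo _ _)).inter ((convex_Ioo _ _).prod (convex_Ioo _ _))
      · push_cast
        refine ⟨⟨⟨?_, ?_⟩, ⟨?_, ?_⟩⟩, ⟨⟨?_, ?_⟩, ⟨?_, ?_⟩⟩⟩ <;> dsimp only <;> linarith
  obtain ⟨θ, hθ⟩ := hrow (n + 1) le_rfl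
  refine ⟨θ, hθ.mono fun x hx => ?_⟩
  push_cast
  rw [hdn]
  exact ⟨⟨by linarith [hx.1.1], by linarith [hx.1.2]⟩, ⟨by linarith [hx.2.1], by linarith [hx.2.2]⟩⟩

end Develop

/-- A function on paths that is multiplicative and homotopy invariant inside each set of an open
cover extends to a functor on the fundamental groupoid. -/
theorem exists_holonomy_of_local {X G ι : Type*} [TopologicalSpace X] [Group G]
    {f : ∀ ⦃x y : X⦄, Path x y → G} {c : ι → Set X} (hc : ∀ i, IsOpen (c i))
    (hcov : ∀ x, ∃ i, x ∈ c i) (hf : ∀ i, IsHolonomyOn (c i) f) :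
    ∃ F : Holonomy X G, ∀ i, ∀ ⦃x y : X⦄ (γ : Path x y), (∀ t, γ t ∈ c i) → F.val γ = f γ := by
  have hex := fun φ : C(ℝ × ℝ, X) => exists_develops_unitSquare (φ := φ) hc hcov hf
  choose Θ hΘ using hex
  -- A path is viewed as a map of the plane that ignores the second coordinate, so that paths and
  -- homotopies are developed by the same result.
  let ext : ∀ ⦃x y : X⦄, Path x y → C(ℝ × ℝ, X) := fun x y γ => γ.extend.comp ⟨Prod.fst, continuous_fst⟩
  let F : ∀ ⦃x y : X⦄, Path x y → G := fun x y γ => (Θ (ext γ) (0, 0))⁻¹ * Θ (ext γ) (1, 0)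
  have hseg : ∀ t : I, Path.segment ((0 : ℝ), (0 : ℝ)) (1, 0) t = ((t : ℝ), 0) := fun t => by
    simp [AffineMap.lineMap_apply]
  -- The value of `F` can be read off from any development through which the path factors.
  -- Multiplicativity and homotopy invariance both follow from a suitable choice of `φ`.
  have key : ∀ (φ : C(ℝ × ℝ, X)) ⦃p q : ℝ × ℝ⦄ (δ : Path p q) ⦃x y : X⦄ (γ : Path x y),
      (∀ t, δ t ∈ Icc (0 : ℝ) 1 ×ˢ Icc (0 : ℝ) 1) → (∀ t, φ (δ t) = γ t) →
      F γ = (Θ φ p)⁻¹ * Θ φ q := by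
    intro φ p q δ x y γ hδ hγ
    refine Develops.eqOn_path hc hcov (hΘ (ext γ)) (hΘ φ) (Path.segment _ _) δ (fun t => ?_) hδ
      (fun t => ?_)
    · rw [hseg]; exact ⟨t.2, by simp⟩
    · rw [hγ, hseg]
      exact Path.extend_extends' γ t
  have hconst : ∀ x, F (Path.refl x) = 1 := fun x => by
    have h := key (.const _ x) (Path.refl (0, 0)) (Path.refl x) (fun t => by simp) (fun t => rfl)
    rw [h]; simp
  refine ⟨⟨F, ⟨fun x y z γ δ _ _ => ?_, fun x y γ δ H _ => ?_⟩⟩, fun i x y γ hγ => ?_⟩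
  · have hs : ∀ (a b : ℝ) (t : I), Path.segment (a, (0 : ℝ)) (b, 0) t = (a + t * (b - a), 0) :=
      fun a b t => by simp [AffineMap.lineMap_apply, add_comm]
    rw [key (ext (γ.trans δ)) (Path.segment (0, 0) (1 / 2, 0)) γ,
      key (ext (γ.trans δ)) (Path.segment (1 / 2, 0) (1, 0)) δ,
      key (ext (γ.trans δ)) (Path.segment (0, 0) (1, 0)) (γ.trans δ)]
    · group
    · intro t; rw [hs]; exact ⟨by simp, by simp⟩
    · intro t; rw [hs]
      simp [ext]
    · intro t; rw [hs]
      refine ⟨⟨?_, ?_⟩, by simp⟩ <;> dsimp only <;> linarith [t.2.1, t.2.2]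
    · intro t; rw [hs]
      have := Path.extend_trans_of_half_le γ δ (t := 1 / 2 + t * (1 - 1 / 2)) (by linarith [t.2.1])
      simp only [ext, ContinuousMap.comp_apply, ContinuousMap.coe_mk]
      rw [this]
      convert Path.extend_extends' δ t using 2
      ring
    · intro t; rw [hs]
      refine ⟨⟨?_, ?_⟩, by simp⟩ <;> dsimp only <;> linarith [t.2.1, t.2.2]
    · intro t; rw [hs]
      have := Path.extend_trans_of_le_half γ δ (t := 0 + t * (1 / 2 - 0)) (by linarith [t.2.2])
      simp only [ext, ContinuousMap.comp_apply, ContinuousMap.coe_mk]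
      rw [this]
      convert Path.extend_extends' γ t using 2
      ring
  -- The homotopy is developed as a whole. Two opposite sides of the square are the given paths, and
  -- the primitive does not change along the other two because these are mapped to constant paths.
  · let φ : C(ℝ × ℝ, X) := ⟨fun p => H (projIcc 0 1 zero_le_one p.1, projIcc 0 1 zero_le_one p.2),
      by fun_prop⟩
    have hs : ∀ (a b a' b' : ℝ) (t : I), Path.segment (a, b) (a', b') t =
        (a + t * (a' - a), b + t * (b' - b)) :=
      fun a b a' b' t => by simp [AffineMap.lineMap_apply, add_comm]
    have e1 := key φ (Path.segment (0, 0) (0, 1)) γ (fun t => by rw [hs]; simp [t.2.1, t.2.2])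
      (fun t => by rw [hs]; simp [φ])
    have e2 := key φ (Path.segment (1, 0) (1, 1)) δ (fun t => by rw [hs]; simp [t.2.1, t.2.2])
      (fun t => by rw [hs]; simp [φ])
    have e3 := key φ (Path.segment (0, 0) (1, 0)) (Path.refl x)
      (fun t => by rw [hs]; simp [t.2.1, t.2.2]) (fun t => by rw [hs]; simp [φ])
    have e4 := key φ (Path.segment (0, 1) (1, 1)) (Path.refl y)
      (fun t => by rw [hs]; simp [t.2.1, t.2.2]) (fun t => by rw [hs]; simp [φ])
    rw [hconst, eq_comm, inv_mul_eq_one] at e3 e4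
    rw [e1, e2, e3, e4]
  · have h := hΘ (ext γ) i (Path.segment ((0 : ℝ), (0 : ℝ)) (1, 0))
      (fun t => by rw [hseg]; exact ⟨t.2, by simp⟩)
      (fun t => by rw [hseg]; simpa [ext] using (Path.extend_extends' γ t) ▸ hγ t)
    refine h.symm.trans (Path.congr_val f _ _ fun t => ?_)
    rw [Path.map_coe, Function.comp, hseg]
    exact Path.extend_extends' γ t

end

/-! ### Functors on the fundamental groupoid and natural transformations -/

section

open Set unitInterval Topology

set_option linter.unusedSectionVars false

/-- Up to homotopy, every path is a composite of finitely many paths that are small with respect to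
the cover. -/
theorem Path.induction_of_openCover {X ι : Type*} [TopologicalSpace X] {c : ι → Set X}
    (hc : ∀ i, IsOpen (c i)) (hcov : ∀ x, ∃ i, x ∈ c i)
    {P : ∀ ⦃x y : X⦄, Path x y → Prop}
    (hsmall : ∀ i ⦃x y : X⦄ (γ : Path x y), (∀ t, γ t ∈ c i) → P γ)
    (htrans : ∀ ⦃x y z : X⦄ (γ : Path x y) (δ : Path y z), P γ → P δ → P (γ.trans δ))
    (hhom : ∀ ⦃x y : X⦄ (γ δ : Path x y), γ.Homotopic δ → P γ → P δ)
    {x y : X} (γ : Path x y) : P γ := by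
  have := unitInterval.induction_of_local (Q := fun s t => P (γ.subpath s t)) ?_ ?_
  · rwa [Path.congr_val P (γ.subpath 0 1) γ (fun t => by simp)] at this
  · intro s t u _ _ h1 h2
    exact hhom _ _ ⟨Path.Homotopy.subpathTransSubpath _ _ _ _⟩ (htrans _ _ h1 h2)
  · intro s
    obtain ⟨i, hi⟩ := hcov (γ s)
    refine ⟨_, ((hc i).preimage γ.continuous).mem_nhds hi, fun a b hab hU => ?_⟩
    refine hsmall i _ fun t => ?_
    obtain ⟨w, hw, e⟩ := γ.subpath_mem_image hab t
    rw [← e]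
    exact hU hw

namespace Holonomy

variable {X Y G H : Type*} [TopologicalSpace X] [TopologicalSpace Y] [Group G] [Group H]
  (F F' : Holonomy X G)

theorem val_trans {x y z : X} (γ : Path x y) (δ : Path y z) :
    F.val (γ.trans δ) = F.val γ * F.val δ :=
  F.isHolonomyOn.trans γ δ (fun _ => mem_univ _) (fun _ => mem_univ _)

theorem val_homotopic {x y : X} {γ δ : Path x y} (h : γ.Homotopic δ) : F.val γ = F.val δ := by
  obtain ⟨H⟩ := h
  exact F.isHolonomyOn.homotopy γ δ H (fun _ => mem_univ _)

theorem val_congr {x y x' y' : X} (γ : Path x y) (δ : Path x' y') (h : ∀ t, γ t = δ t) :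
    F.val γ = F.val δ :=
  Path.congr_val F.val γ δ h

@[simp]
theorem val_refl (x : X) : F.val (Path.refl x) = 1 := by
  have := F.val_trans (Path.refl x) (Path.refl x)
  rw [Path.refl_trans_refl] at this
  simpa using this

@[simp]
theorem val_symm {x y : X} (γ : Path x y) : F.val γ.symm = (F.val γ)⁻¹ := by
  have h := F.val_homotopic (Path.Homotopic.trans_symm γ)
  rw [val_trans, val_refl] at h
  exact eq_inv_of_mul_eq_one_right h

/-- The functor obtained from a homomorphism of groups. -/
def mapHom (φ : G →* H) : Holonomy X H where
  val _ _ γ := φ (F.val γ)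
  isHolonomyOn :=
    { trans := fun _ _ _ γ δ _ _ => by rw [val_trans, map_mul]
      homotopy := fun _ _ γ δ h _ => by rw [F.val_homotopic ⟨h⟩] }

/-- The pullback along a continuous map. -/
def comap (φ : C(Y, X)) : Holonomy Y G where
  val _ _ γ := F.val (γ.map φ.continuous)
  isHolonomyOn :=
    { trans := fun _ _ _ γ δ _ _ => by rw [Path.map_trans, val_trans]
      homotopy := fun _ _ γ δ h _ => F.val_homotopic ⟨h.map φ⟩ }

/-- The change of `F` by a gauge transformation. -/
def gauge (e : X → G) : Holonomy X G where
  val x y γ := e x * F.val γ * (e y)⁻¹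
  isHolonomyOn :=
    { trans := fun _ _ _ γ δ _ _ => by rw [val_trans]; group
      homotopy := fun _ _ γ δ h _ => by rw [F.val_homotopic ⟨h⟩] }

theorem comap_val (φ : C(Y, X)) {x y : Y} (γ : Path x y) :
    (F.comap φ).val γ = F.val (γ.map φ.continuous) := rfl

theorem gauge_val (e : X → G) {x y : X} (γ : Path x y) :
    (F.gauge e).val γ = e x * F.val γ * (e y)⁻¹ := rfl

/-- `e` is a natural transformation from `F` to `F'` as far as the path `γ` is concerned. -/
def NatAlong (e : X → G) {x y : X} (γ : Path x y) : Prop :=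
  e x * F'.val γ = F.val γ * e y

variable {F F'} {e : X → G}

theorem NatAlong.trans {x y z : X} {γ : Path x y} {δ : Path y z} (h1 : F.NatAlong F' e γ)
    (h2 : F.NatAlong F' e δ) : F.NatAlong F' e (γ.trans δ) := by
  unfold NatAlong at *
  rw [val_trans, val_trans, ← mul_assoc, h1, mul_assoc, h2, mul_assoc]

theorem NatAlong.symm {x y : X} {γ : Path x y} (h : F.NatAlong F' e γ) :
    F.NatAlong F' e γ.symm := by
  unfold NatAlong at *
  rw [val_symm, val_symm, eq_inv_mul_iff_mul_eq, ← mul_assoc, ← h, mul_inv_cancel_right]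

theorem NatAlong.homotopic {x y : X} {γ δ : Path x y} (hγ : γ.Homotopic δ)
    (h : F.NatAlong F' e γ) : F.NatAlong F' e δ := by
  unfold NatAlong at *
  rwa [← F.val_homotopic hγ, ← F'.val_homotopic hγ]

theorem NatAlong.congr {x y x' y' : X} {γ : Path x y} (h : F.NatAlong F' e γ) (δ : Path x' y')
    (hγ : ∀ t, γ t = δ t) : F.NatAlong F' e δ := by
  rwa [← Path.congr_val (fun _ _ γ => F.NatAlong F' e γ) γ δ hγ]

/-- Naturality is a local property. -/
theorem natAlong_of_openCover {ι : Type*} {c : ι → Set X}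
    (hc : ∀ i, IsOpen (c i)) (hcov : ∀ x, ∃ i, x ∈ c i)
    (h : ∀ i ⦃x y : X⦄ (γ : Path x y), (∀ t, γ t ∈ c i) → F.NatAlong F' e γ)
    {x y : X} (γ : Path x y) : F.NatAlong F' e γ :=
  Path.induction_of_openCover hc hcov (P := fun _ _ γ => F.NatAlong F' e γ) h
    (fun _ _ _ _ _ => NatAlong.trans) (fun _ _ _ _ => NatAlong.homotopic) γ

/-- The main tool for computing values: paths that lift to a convex set with equal end points have
equal values. The map `φ` needs to be continuous on `S` only, so it may have default values
elsewhere. -/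
theorem val_eq_of_convex {E : Type*} [AddCommGroup E] [Module ℝ E] [TopologicalSpace E]
    [IsTopologicalAddGroup E] [ContinuousSMul ℝ E] {S : Set E} (hS : Convex ℝ S)
    (F : Holonomy X G) {φ : E → X} (hφ : ContinuousOn φ S) {x y x' y' : E} (γ : Path x y)
    (δ : Path x' y') (hγ : ∀ t, γ t ∈ S) (hδ : ∀ t, δ t ∈ S) {a b a' b' : X} (γ' : Path a b)
    (δ' : Path a' b') (h : ∀ t, φ (γ t) = γ' t) (h' : ∀ t, φ (δ t) = δ' t) (hx : x = x')
    (hy : y = y') : F.val γ' = F.val δ' := by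
  subst hx hy
  obtain ⟨H, hH⟩ := hS.exists_homotopy γ δ hγ hδ
  have ha := h 0; have hb := h 1; have ha' := h' 0; have hb' := h' 1
  simp only [Path.source, Path.target] at ha hb ha' hb'
  subst ha hb ha' hb'
  refine F.val_homotopic ⟨⟨⟨⟨fun p => φ (H p), ?_⟩, fun t => ?_, fun t => ?_⟩, ?_⟩⟩
  · exact hφ.comp_continuous H.continuous hH
  · simpa using h t
  · simpa using h' t
  · rintro t s (rfl | rfl) <;> simp

/-- The two ways along the boundary of a square. -/
theorem val_square (F : Holonomy X G) {K : I × I → X} (hK : Continuous K) {p q r s : X}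
    (b : Path p q) (u : Path r s) (l : Path p r) (d : Path q s) (hb : ∀ t, b t = K (t, 0))
    (hu : ∀ t, u t = K (t, 1)) (hl : ∀ t, l t = K (0, t)) (hd : ∀ t, d t = K (1, t)) :
    F.val b * F.val d = F.val l * F.val u := by
  let i : C(I, ℝ) := ⟨Subtype.val, continuous_subtype_val⟩
  let o : Path (0 : ℝ) 1 := Path.id.map i.continuous
  let P : ℝ → I := projIcc 0 1 zero_le_one
  have hP : ∀ t : I, P t = t := fun t => projIcc_val _ t
  have h0 : P 0 = 0 := hP 0
  have h1 : P 1 = 1 := hP 1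
  have ho : ∀ t, P (o t) = t := hP
  rw [← val_trans, ← val_trans]
  refine F.val_eq_of_convex (E := ℝ × ℝ) convex_univ (φ := fun x => K (P x.1, P x.2))
    (by fun_prop) ((o.prod (Path.refl 0)).trans ((Path.refl 1).prod o))
    (((Path.refl 0).prod o).trans (o.prod (Path.refl 1))) (fun _ => mem_univ _)
    (fun _ => mem_univ _) _ _ (fun t => ?_) (fun t => ?_) rfl rfl
  · rw [Path.trans_apply, Path.trans_apply]
    split_ifs <;> simp [hb, hd, ho, h0, h1]
  · rw [Path.trans_apply, Path.trans_apply]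
    split_ifs <;> simp [hl, hu, ho, h0, h1]

end Holonomy

/-- `C` contracts inside `X` to the point `p`. -/
def ContractsTo {X : Type*} [TopologicalSpace X] (C : Set X) (p : X) : Prop :=
  ∃ H : X → I → X, ContinuousOn (fun q : X × I => H q.1 q.2) (C ×ˢ univ) ∧
    ∀ x ∈ C, H x 0 = p ∧ H x 1 = x

namespace Holonomy

variable {X Y G : Type*} [TopologicalSpace X] [TopologicalSpace Y] [Group G]

/-- Take `u x` to be the value on the track of `x` under the contraction. Contracting a whole path
in `C` fills the square between the path, the tracks of its ends and a constant path. The tracks may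
leave `C`. -/
theorem exists_coboundary {C : Set X} {p : X} (hC : ContractsTo C p) (F : Holonomy X G) :
    ∃ u : X → G, ∀ ⦃x y : X⦄ (γ : Path x y), (∀ t, γ t ∈ C) → F.val γ = (u x)⁻¹ * u y := by
  classical
  obtain ⟨H, hH, hp⟩ := hC
  have hc : ∀ x ∈ C, Continuous (H x) := fun x hx =>
    hH.comp_continuous (f := fun t => (x, t)) (by fun_prop) (fun t => ⟨hx, mem_univ _⟩)
  let τ : ∀ x, x ∈ C → Path p x := fun x hx => ⟨⟨H x, hc x hx⟩, (hp x hx).1, (hp x hx).2⟩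
  refine ⟨fun x => if hx : x ∈ C then F.val (τ x hx) else 1, fun x y γ hγ => ?_⟩
  have hx : x ∈ C := by simpa using hγ 0
  have hy : y ∈ C := by simpa using hγ 1
  simp only [dif_pos hx, dif_pos hy]
  rw [eq_inv_mul_iff_mul_eq]
  have hK : Continuous (fun q : I × I => H (γ q.1) q.2) :=
    hH.comp_continuous (f := fun q : I × I => (γ q.1, q.2)) (by fun_prop) (fun t => ⟨hγ _, mem_univ _⟩)
  have := F.val_square hK (Path.refl p) γ (τ x hx) (τ y hy) (fun t => (hp _ (hγ t)).1.symm)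
    (fun t => (hp _ (hγ t)).2.symm) (fun t => by simp [τ]) (fun t => by simp [τ])
  rw [← this, val_refl, one_mul]

theorem exists_natAlong {C : Set X} {p : X} (hC : ContractsTo C p) (F F' : Holonomy X G) (x₀ : X)
    (g : G) : ∃ e : X → G, e x₀ = g ∧
      ∀ ⦃x y : X⦄ (γ : Path x y), (∀ t, γ t ∈ C) → F.NatAlong F' e γ := by
  obtain ⟨u, hu⟩ := F.exists_coboundary hC
  obtain ⟨v, hv⟩ := F'.exists_coboundary hC
  -- Any constant in the middle gives a natural transformation between the two coboundaries; this
  -- one makes the value at `x₀` equal to `g`.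
  refine ⟨fun x => (u x)⁻¹ * (u x₀ * g * (v x₀)⁻¹) * v x, by group, fun x y γ hγ => ?_⟩
  rw [NatAlong, hu γ hγ, hv γ hγ]
  group

/-- The value of a natural transformation at one end of a path determines its value at the other
end. -/
theorem NatAlong.eq_of_eq {F F' : Holonomy X G} {e e' : X → G} {x y : X} {γ : Path x y}
    (h : F.NatAlong F' e γ) (h' : F.NatAlong F' e' γ) (hx : e x = e' x) : e y = e' y := by
  unfold NatAlong at h h'
  rw [hx, h'] at h
  exact (mul_left_cancel h).symm

theorem NatAlong.eq_of_eq_left {F F' : Holonomy X G} {e e' : X → G} {x y : X} {γ : Path x y}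
    (h : F.NatAlong F' e γ) (h' : F.NatAlong F' e' γ) (hy : e y = e' y) : e x = e' x :=
  h.symm.eq_of_eq h'.symm hy

theorem NatAlong.congr_left {F F' : Holonomy X G} {e e' : X → G} {x y : X} {γ : Path x y}
    (h : F.NatAlong F' e γ) (hx : e x = e' x) (hy : e y = e' y) : F.NatAlong F' e' γ := by
  unfold NatAlong at *
  rw [← hx, ← hy, h]

/-- Two functors that agree on the loops at one point are naturally isomorphic. -/
theorem exists_natAlong_of_loops [PathConnectedSpace X] (F F' : Holonomy X G) (x₀ : X)
    (h : ∀ γ : Path x₀ x₀, F.val γ = F'.val γ) :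
    ∃ e : X → G, e x₀ = 1 ∧ ∀ ⦃x y : X⦄ (γ : Path x y), F.NatAlong F' e γ := by
  let τ : ∀ x, Path x₀ x := fun x => PathConnectedSpace.somePath x₀ x
  refine ⟨fun x => (F.val (τ x))⁻¹ * F'.val (τ x), ?_, fun x y γ => ?_⟩
  · dsimp only
    rw [h, inv_mul_cancel]
  · have := h (((τ x).trans γ).trans (τ y).symm)
    simp only [val_trans, val_symm] at this
    rw [eq_mul_inv_iff_mul_eq] at this
    rw [NatAlong, mul_assoc, ← this]
    group

/-- A functor given by local coboundaries. -/
theorem exists_of_coboundaries {ι : Type*} {c : ι → Set X} (hc : ∀ i, IsOpen (c i))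
    (hcov : ∀ x, ∃ i, x ∈ c i) (u : ι → X → G)
    (hu : ∀ i j, ∀ x ∈ c i ∩ c j, ∀ᶠ y in 𝓝 x, y ∈ c i ∩ c j →
      u j y * (u i y)⁻¹ = u j x * (u i x)⁻¹) :
    ∃ F : Holonomy X G, ∀ i, ∀ ⦃x y : X⦄ (γ : Path x y), (∀ t, γ t ∈ c i) →
      F.val γ = (u i x)⁻¹ * u i y := by
  classical
  have hloc : ∀ i j, ∀ ⦃x y : X⦄ (γ : Path x y), (∀ t, γ t ∈ c i) → (∀ t, γ t ∈ c j) →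
      (u i x)⁻¹ * u i y = (u j x)⁻¹ * u j y := by
    intro i j x y γ hi hj
    -- The transition function `u j * (u i)⁻¹` is locally constant along a path in the overlap,
    -- hence constant because the interval is connected.
    have : u j x * (u i x)⁻¹ = u j y * (u i y)⁻¹ := by
      have hl : IsLocallyConstant (fun t => u j (γ t) * (u i (γ t))⁻¹) := by
        rw [IsLocallyConstant.iff_eventually_eq]
        intro t
        filter_upwards [γ.continuous.continuousAt.eventually (hu i j (γ t) ⟨hi t, hj t⟩)] with s hs
        exact hs ⟨hi s, hj s⟩
      simpa using hl.apply_eq_of_preconnectedSpace 0 1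
    rw [mul_inv_eq_iff_eq_mul] at this
    rw [this]
    group
  let f : ∀ ⦃x y : X⦄, Path x y → G := fun x y γ =>
    if h : ∃ i, ∀ t, γ t ∈ c i then (u h.choose x)⁻¹ * u h.choose y else 1
  have hf : ∀ i, ∀ ⦃x y : X⦄ (γ : Path x y), (∀ t, γ t ∈ c i) → f γ = (u i x)⁻¹ * u i y := by
    intro i x y γ hi
    have hex : ∃ i, ∀ t, γ t ∈ c i := ⟨i, hi⟩
    exact (dif_pos hex).trans (hloc _ _ γ hex.choose_spec hi)
  have hhol : ∀ i, IsHolonomyOn (c i) f := by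
    refine fun i => ⟨?_, ?_⟩
    · intro x y z γ δ hγ hδ
      rw [hf i γ hγ, hf i δ hδ, hf i]
      · group
      · intro t; rw [Path.trans_apply]; split_ifs
        exacts [hγ _, hδ _]
    · intro x y γ δ h hh
      rw [hf i γ (fun t => by simpa using hh (0, t)), hf i δ (fun t => by simpa using hh (1, t))]
  obtain ⟨F, hF⟩ := exists_holonomy_of_local hc hcov hhol
  exact ⟨F, fun i x y γ hγ => (hF i γ hγ).trans (hf i γ hγ)⟩

end Holonomy

end

/-! ### Gluing functors and natural transformations along a collar -/

section

open Set unitInterval Topology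

set_option linter.unusedSectionVars false

namespace Holonomy

variable {X Y G : Type*} [TopologicalSpace X] [TopologicalSpace Y] [Group G]

/-- The fourth side of a square is homotopic to the way around the other three, so naturality passes
to it. -/
theorem NatAlong.square {F F' : Holonomy X G} {e : X → G} {K : I × I → X} (hK : Continuous K)
    {p q r s : X} (b : Path p q) (u : Path r s) (l : Path p r) (d : Path q s)
    (hb : ∀ t, b t = K (t, 0)) (hu : ∀ t, u t = K (t, 1)) (hl : ∀ t, l t = K (0, t))
    (hd : ∀ t, d t = K (1, t)) (nb : F.NatAlong F' e b) (nl : F.NatAlong F' e l)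
    (nd : F.NatAlong F' e d) : F.NatAlong F' e u := by
  have h := (nl.symm.trans nb).trans nd
  have h1 := F.val_square hK b u l d hb hu hl hd
  have h2 := F'.val_square hK b u l d hb hu hl hd
  unfold NatAlong at *
  simp only [val_trans, val_symm, mul_assoc] at h
  rw [h2, inv_mul_cancel_left, ← mul_assoc (F.val b), h1, mul_assoc, inv_mul_cancel_left] at h
  exact h

/-- The pullback along a map that is continuous on `U`. -/
theorem exists_pullbackOn (F : Holonomy Y G) {R : X → Y} {U : Set X} (hR : ContinuousOn R U) :
    ∃ f : ∀ ⦃x y : X⦄, Path x y → G, IsHolonomyOn U f ∧ ∀ ⦃x y : X⦄ (γ : Path x y),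
      (∀ t, γ t ∈ U) → ∀ ⦃x' y' : Y⦄ (δ : Path x' y'), (∀ t, δ t = R (γ t)) →
        f γ = F.val δ := by
  classical
  let f : ∀ ⦃x y : X⦄, Path x y → G := fun x y γ =>
    if h : ContinuousOn R (range γ) then F.val (γ.map' h) else 1
  have hf : ∀ ⦃x y : X⦄ (γ : Path x y),
      (∀ t, γ t ∈ U) → ∀ ⦃x' y' : Y⦄ (δ : Path x' y'), (∀ t, δ t = R (γ t)) →
        f γ = F.val δ := by
    intro x y γ hγ x' y' δ hδ
    have h : ContinuousOn R (range γ) := hR.mono (range_subset_iff.2 hγ)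
    exact (dif_pos h).trans (F.val_congr _ _ fun t => (hδ t).symm)
  have hc : ∀ ⦃x y : X⦄ (γ : Path x y), (∀ t, γ t ∈ U) → ContinuousOn R (range γ) :=
    fun x y γ hγ => hR.mono (range_subset_iff.2 hγ)
  refine ⟨f, ⟨fun x y z γ δ hγ hδ => ?_, fun x y γ δ H hH => ?_⟩, hf⟩
  · rw [hf γ hγ (γ.map' (hc γ hγ)) (fun _ => rfl), hf δ hδ (δ.map' (hc δ hδ)) (fun _ => rfl),
      ← val_trans]
    refine hf _ (fun t => ?_) _ (fun t => ?_)
    · rw [Path.trans_apply]; split_ifs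
      exacts [hγ _, hδ _]
    · rw [Path.trans_apply, Path.trans_apply]; split_ifs <;> rfl
  · have hγ : ∀ t, γ t ∈ U := fun t => by simpa using hH (0, t)
    have hδ : ∀ t, δ t ∈ U := fun t => by simpa using hH (1, t)
    rw [hf γ hγ (γ.map' (hc γ hγ)) (fun _ => rfl), hf δ hδ (δ.map' (hc δ hδ)) (fun _ => rfl)]
    refine F.val_homotopic ⟨⟨⟨⟨fun p => R (H p), hR.comp_continuous H.continuous hH⟩,
      fun t => by simp [Path.map'], fun t => by simp [Path.map']⟩, ?_⟩⟩
    rintro t s (rfl | rfl) <;> simp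

/-- `exists_holonomy_of_local` requires a single function on all paths. The two given ones are
merged by preferring `f`, which is harmless because they agree on the paths inside both sets. -/
theorem exists_of_two_opens {U V : Set X} (hU : IsOpen U) (hV : IsOpen V) (hUV : ∀ x, x ∈ U ∨ x ∈ V)
    {f g : ∀ ⦃x y : X⦄, Path x y → G} (hf : IsHolonomyOn U f) (hg : IsHolonomyOn V g)
    (hfg : ∀ ⦃x y : X⦄ (γ : Path x y), (∀ t, γ t ∈ U) → (∀ t, γ t ∈ V) → f γ = g γ) :
    ∃ F : Holonomy X G, (∀ ⦃x y : X⦄ (γ : Path x y), (∀ t, γ t ∈ U) → F.val γ = f γ) ∧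
      ∀ ⦃x y : X⦄ (γ : Path x y), (∀ t, γ t ∈ V) → F.val γ = g γ := by
  classical
  let h : ∀ ⦃x y : X⦄, Path x y → G := fun x y γ => if ∀ t, γ t ∈ U then f γ else g γ
  have hhU : ∀ ⦃x y : X⦄ (γ : Path x y), (∀ t, γ t ∈ U) → h γ = f γ := fun x y γ hγ => if_pos hγ
  have hhV : ∀ ⦃x y : X⦄ (γ : Path x y), (∀ t, γ t ∈ V) → h γ = g γ := fun x y γ hγ => by
    by_cases hγU : ∀ t, γ t ∈ U
    · exact (if_pos hγU).trans (hfg γ hγU hγ)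
    · exact if_neg hγU
  have tr : ∀ (W : Set X) ⦃x y z : X⦄ (γ : Path x y) (δ : Path y z), (∀ t, γ t ∈ W) →
      (∀ t, δ t ∈ W) → ∀ t, γ.trans δ t ∈ W := fun W x y z γ δ hγ hδ t => by
    rw [Path.trans_apply]; split_ifs
    exacts [hγ _, hδ _]
  obtain ⟨F, hF⟩ := exists_holonomy_of_local (f := h) (c := fun b : Bool => if b then U else V)
    (by rintro (_ | _) <;> simpa) (fun x => (hUV x).elim (fun hx => ⟨true, by simpa⟩)
      (fun hx => ⟨false, by simpa⟩)) (by
    rintro (_ | _)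
    · simp only [Bool.false_eq_true, if_false]
      refine ⟨fun x y z γ δ hγ hδ => ?_, fun x y γ δ H hH => ?_⟩
      · rw [hhV _ hγ, hhV _ hδ, hhV _ (tr V γ δ hγ hδ), hg.trans γ δ hγ hδ]
      · rw [hhV γ (fun t => by simpa using hH (0, t)), hhV δ (fun t => by simpa using hH (1, t)),
          hg.homotopy γ δ H hH]
    · simp only [if_true]
      refine ⟨fun x y z γ δ hγ hδ => ?_, fun x y γ δ H hH => ?_⟩
      · rw [hhU _ hγ, hhU _ hδ, hhU _ (tr U γ δ hγ hδ), hf.trans γ δ hγ hδ]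
      · rw [hhU γ (fun t => by simpa using hH (0, t)), hhU δ (fun t => by simpa using hH (1, t)),
          hf.homotopy γ δ H hH])
  exact ⟨F, fun x y γ hγ => (hF true γ (by simpa using hγ)).trans (hhU γ hγ),
    fun x y γ hγ => (hF false γ (by simpa using hγ)).trans (hhV γ hγ)⟩

end Holonomy

section Glue

variable {X A B S G : Type*} [TopologicalSpace X] [TopologicalSpace A] [TopologicalSpace B]
  [TopologicalSpace S] [Group G]

/-- `X` is obtained from `A` and `B` by gluing along the images of `ρ` and `β`. -/
structure IsGluing (ρ : C(S, A)) (β : C(S, B)) (iA : C(A, X)) (iB : C(B, X)) : Prop where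
  isQuotientMap : IsQuotientMap (Sum.elim iA iB)
  injA : Function.Injective iA
  injB : Function.Injective iB
  eq_iff : ∀ a b, iA a = iB b ↔ ∃ z, a = ρ z ∧ b = β z

/-- A collar of the image of `β`: a neighbourhood that deforms to it. -/
structure Collar (β : C(S, B)) where
  nbhd : Set B
  isOpen_nbhd : IsOpen nbhd
  isClosed_range : IsClosed (range β)
  mem_nbhd : ∀ z, β z ∈ nbhd
  proj : B → S
  continuousOn_proj : ContinuousOn proj nbhd
  proj_apply : ∀ z, proj (β z) = z
  homotopy : B → I → B
  continuousOn_homotopy : ContinuousOn (fun p : B × I => homotopy p.1 p.2) (nbhd ×ˢ univ)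
  homotopy_zero : ∀ b ∈ nbhd, homotopy b 0 = β (proj b)
  homotopy_one : ∀ b ∈ nbhd, homotopy b 1 = b
  homotopy_apply : ∀ z t, homotopy (β z) t = β z

/-- The relation `r` is a matching and not an equivalence relation, so equality in the quotient is
decided by a normal form: a glued point of `A` is replaced by its partner in `B`, and everything
else stays. Injectivity of `ρ` makes the partner unique. -/
theorem isGluing_quot {r : A ⊕ B → A ⊕ B → Prop} {ρ : C(S, A)} {β : C(S, B)}
    (hρ : Function.Injective ρ) (hβ : Function.Injective β)
    (hr : ∀ p q, r p q ↔ ∃ z, p = Sum.inl (ρ z) ∧ q = Sum.inr (β z)) :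
    IsGluing (X := Quot r) ρ β ⟨fun a => Quot.mk r (Sum.inl a), by fun_prop⟩
      ⟨fun b => Quot.mk r (Sum.inr b), by fun_prop⟩ := by
  classical
  let h : A ⊕ B → A ⊕ B :=
    Sum.elim (fun a => if h : ∃ z, a = ρ z then Sum.inr (β h.choose) else Sum.inl a) Sum.inr
  have hl : ∀ z, h (Sum.inl (ρ z)) = Sum.inr (β z) := fun z => by
    have hz : ∃ z', ρ z = ρ z' := ⟨z, rfl⟩
    have : h (Sum.inl (ρ z)) = Sum.inr (β hz.choose) := dif_pos hz
    rw [this, ← hρ hz.choose_spec]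
  have hn : ∀ a, (¬ ∃ z, a = ρ z) → h (Sum.inl a) = Sum.inl a := fun a ha => dif_neg ha
  have key : ∀ p q, Quot.mk r p = Quot.mk r q → h p = h q := fun p q hpq => by
    refine congr_arg (Quot.lift h ?_) hpq
    intro p q hpq
    obtain ⟨z, rfl, rfl⟩ := (hr p q).1 hpq
    exact hl z
  refine ⟨?_, fun a a' haa => ?_, fun b b' hbb => Sum.inr.inj (key _ _ hbb), fun a b => ⟨fun hab => ?_, ?_⟩⟩
  · convert isQuotientMap_quot_mk (r := r) using 1
    funext p
    rcases p with p | p <;> rfl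
  · have := key _ _ haa
    by_cases h1 : ∃ z, a = ρ z
    · obtain ⟨z, rfl⟩ := h1
      by_cases h2 : ∃ z, a' = ρ z
      · obtain ⟨z', rfl⟩ := h2
        rw [hl, hl] at this
        rw [hβ (Sum.inr.inj this)]
      · rw [hl, hn _ h2] at this
        exact absurd this (by simp)
    · by_cases h2 : ∃ z, a' = ρ z
      · obtain ⟨z', rfl⟩ := h2
        rw [hl, hn _ h1] at this
        exact absurd this (by simp)
      · rw [hn _ h1, hn _ h2] at this
        exact Sum.inl.inj this
  · have := key _ _ hab
    by_cases h1 : ∃ z, a = ρ z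
    · obtain ⟨z, rfl⟩ := h1
      rw [hl] at this
      exact ⟨z, rfl, (Sum.inr.inj this).symm⟩
    · rw [hn _ h1] at this
      exact absurd this (by simp [h])
  · rintro ⟨z, rfl, rfl⟩
    exact Quot.sound ((hr _ _).2 ⟨z, rfl, rfl⟩)

namespace IsGluing

variable {ρ : C(S, A)} {β : C(S, B)} {iA : C(A, X)} {iB : C(B, X)} (h : IsGluing ρ β iA iB)
include h

theorem comm (z : S) : iA (ρ z) = iB (β z) := (h.eq_iff _ _).2 ⟨z, rfl, rfl⟩

theorem cases (x : X) : (∃ a, x = iA a) ∨ ∃ b, x = iB b := by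
  obtain ⟨a | b, rfl⟩ := h.isQuotientMap.surjective x
  exacts [Or.inl ⟨a, rfl⟩, Or.inr ⟨b, rfl⟩]

theorem exists_desc {T : Type*} (f : A → T) (g : B → T) (hfg : ∀ z, f (ρ z) = g (β z)) :
    ∃ k : X → T, (∀ a, k (iA a) = f a) ∧ ∀ b, k (iB b) = g b := by
  let s := Function.surjInv h.isQuotientMap.surjective
  have hs : ∀ x, Sum.elim iA iB (s x) = x := Function.surjInv_eq _
  refine ⟨fun x => Sum.elim f g (s x), fun a => ?_, fun b => ?_⟩
  · dsimp only
    have := hs (iA a)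
    rcases hsa : s (iA a) with a' | b'
    · rw [hsa] at this
      simpa using congr_arg f (h.injA this)
    · rw [hsa] at this
      obtain ⟨z, rfl, rfl⟩ := (h.eq_iff a b').1 this.symm
      exact (hfg z).symm
  · dsimp only
    have := hs (iB b)
    rcases hsa : s (iB b) with a' | b'
    · rw [hsa] at this
      obtain ⟨z, rfl, rfl⟩ := (h.eq_iff a' b).1 this
      exact hfg z
    · rw [hsa] at this
      simpa using congr_arg g (h.injB this)

theorem isOpen_iff (U : Set X) : IsOpen U ↔ IsOpen (iA ⁻¹' U) ∧ IsOpen (iB ⁻¹' U) := by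
  rw [← h.isQuotientMap.isOpen_preimage, isOpen_sum_iff]
  rfl

theorem continuousOn_iff {T : Type*} [TopologicalSpace T] {f : X → T} {U : Set X}
    (hU : IsOpen U) : ContinuousOn f U ↔
      ContinuousOn (f ∘ iA) (iA ⁻¹' U) ∧ ContinuousOn (f ∘ iB) (iB ⁻¹' U) := by
  constructor
  · exact fun hf => ⟨hf.comp iA.continuous.continuousOn (fun _ hx => hx),
      hf.comp iB.continuous.continuousOn (fun _ hx => hx)⟩
  · rintro ⟨hA, hB⟩
    obtain ⟨h1, h2⟩ := (h.isOpen_iff U).1 hU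
    rw [h.isQuotientMap.continuousOn_isOpen_iff hU]
    rintro (a | b) hp
    · exact (IsOpenEmbedding.inl.continuousAt_iff.1
        ((hA.continuousAt (h1.mem_nhds hp)))).continuousWithinAt
    · exact (IsOpenEmbedding.inr.continuousAt_iff.1
        ((hB.continuousAt (h2.mem_nhds hp)))).continuousWithinAt

/-- Local compactness of the interval is what matters: multiplying a quotient map by `I` gives a
quotient map again. The restriction to an open set also remains one. -/
theorem continuousOn_prod {T : Type*} [TopologicalSpace T] {f : X × I → T} {U : Set X}
    (hU : IsOpen U) (hA : ContinuousOn (fun p : A × I => f (iA p.1, p.2)) ((iA ⁻¹' U) ×ˢ univ))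
    (hB : ContinuousOn (fun p : B × I => f (iB p.1, p.2)) ((iB ⁻¹' U) ×ˢ univ)) :
    ContinuousOn f (U ×ˢ univ) := by
  obtain ⟨h1, h2⟩ := (h.isOpen_iff U).1 hU
  have hq := h.isQuotientMap.restrictPreimage_isOpen hU
  have key : ContinuousOn (fun p : (A ⊕ B) × I => f (Sum.elim iA iB p.1, p.2))
      ((Sum.elim iA iB ⁻¹' U) ×ˢ univ) := by
    rintro ⟨a | b, t⟩ hp
    · exact (((IsOpenEmbedding.inl (X := A) (Y := B)).prodMap
        (IsOpenEmbedding.id (X := I))).continuousAt_iff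
          (g := fun p : (A ⊕ B) × I => f (Sum.elim iA iB p.1, p.2)) (x := (a, t)).1
        (hA.continuousAt (x := (a, t)) ((h1.prod isOpen_univ).mem_nhds hp))).continuousWithinAt
    · exact (((IsOpenEmbedding.inr (X := A) (Y := B)).prodMap
        (IsOpenEmbedding.id (X := I))).continuousAt_iff
          (g := fun p : (A ⊕ B) × I => f (Sum.elim iA iB p.1, p.2)) (x := (b, t)).1
        (hB.continuousAt (x := (b, t)) ((h2.prod isOpen_univ).mem_nhds hp))).continuousWithinAt
  have := hq.continuous_lift_prod_left (Y := I) (g := fun p => f (p.1.1, p.2))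
    (key.comp_continuous (f := fun p : (Sum.elim iA iB ⁻¹' U) × I => (p.1.1, p.2)) (by fun_prop)
      (fun p => ⟨p.1.2, mem_univ _⟩))
  rw [continuousOn_iff_continuous_domRestrict]
  exact this.comp (f := fun p : (U ×ˢ univ : Set (X × I)) => ((⟨p.1.1, p.2.1⟩ : U), p.1.2))
    (by fun_prop)

variable (κ : Collar β)

/-- The union of `A` and the collar. -/
def thickA (_ : IsGluing ρ β iA iB) (κ : Collar β) : Set X := range iA ∪ iB '' κ.nbhd

theorem preimage_thickA : iA ⁻¹' h.thickA κ = univ ∧ iB ⁻¹' h.thickA κ = κ.nbhd := by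
  refine ⟨eq_univ_of_forall fun a => Or.inl ⟨a, rfl⟩, ?_⟩
  ext b
  constructor
  · rintro (⟨a, ha⟩ | ⟨b', hb', e⟩)
    · obtain ⟨z, rfl, rfl⟩ := (h.eq_iff a b).1 ha
      exact κ.mem_nbhd z
    · exact h.injB e ▸ hb'
  · exact fun hb => Or.inr ⟨b, hb, rfl⟩

theorem isOpen_thickA : IsOpen (h.thickA κ) := by
  rw [h.isOpen_iff, (h.preimage_thickA κ).1, (h.preimage_thickA κ).2]
  exact ⟨isOpen_univ, κ.isOpen_nbhd⟩

/-- The part of `B` outside the gluing locus. -/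
def innerB (_ : IsGluing ρ β iA iB) : Set X := iB '' (range β)ᶜ

theorem preimage_innerB : iA ⁻¹' h.innerB = ∅ ∧ iB ⁻¹' h.innerB = (range β)ᶜ := by
  refine ⟨eq_empty_of_forall_notMem ?_, h.injB.preimage_image _⟩
  rintro a ⟨b, hb, e⟩
  obtain ⟨z, rfl, rfl⟩ := (h.eq_iff a b).1 e.symm
  exact hb ⟨z, rfl⟩

theorem isOpen_innerB (κ : Collar β) : IsOpen h.innerB := by
  rw [h.isOpen_iff, h.preimage_innerB.1, h.preimage_innerB.2]
  exact ⟨isOpen_empty, κ.isClosed_range.isOpen_compl⟩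

theorem mem_or (x : X) : x ∈ h.thickA κ ∨ x ∈ h.innerB := by
  rcases h.cases x with ⟨a, rfl⟩ | ⟨b, rfl⟩
  · exact Or.inl (Or.inl ⟨a, rfl⟩)
  · by_cases hb : b ∈ range β
    · obtain ⟨z, rfl⟩ := hb
      exact Or.inl (Or.inl ⟨ρ z, h.comm z⟩)
    · exact Or.inr ⟨b, hb, rfl⟩

/-- The thickened part of `A` retracts to `A` by projecting the collar. Functors on `A` extend to
the open set `thickA` by pullback along `R`. -/
theorem exists_retraction : ∃ R : X → A, ContinuousOn R (h.thickA κ) ∧ (∀ a, R (iA a) = a) ∧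
    ∀ b, R (iB b) = ρ (κ.proj b) := by
  obtain ⟨R, hA, hB⟩ := h.exists_desc id (ρ ∘ κ.proj) (fun z => by simp [κ.proj_apply])
  refine ⟨R, ?_, hA, hB⟩
  rw [h.continuousOn_iff (h.isOpen_thickA κ), (h.preimage_thickA κ).1, (h.preimage_thickA κ).2]
  refine ⟨continuous_id.continuousOn.congr fun a _ => hA a, ?_⟩
  exact (ρ.continuous.comp_continuousOn κ.continuousOn_proj).congr fun b _ => hB b

/-- An inverse of `iB` away from the gluing locus. The value `b₀` elsewhere only makes the function
total. -/
theorem exists_section (κ : Collar β) [Nonempty B] : ∃ v : X → B, ContinuousOn v h.innerB ∧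
    ∀ b ∉ range β, v (iB b) = b := by
  classical
  obtain ⟨b₀⟩ := ‹Nonempty B›
  obtain ⟨v, hA, hB⟩ := h.exists_desc (fun _ => b₀) (fun b => if b ∈ range β then b₀ else b)
    (fun z => by simp)
  have hv : ∀ b ∉ range β, v (iB b) = b := fun b hb => by rw [hB, if_neg hb]
  refine ⟨v, ?_, hv⟩
  rw [h.continuousOn_iff (h.isOpen_innerB κ), h.preimage_innerB.1, h.preimage_innerB.2]
  exact ⟨continuousOn_empty _, continuous_id.continuousOn.congr fun b hb => hv b hb⟩

open Holonomy

/-- Naturality on both parts implies naturality. -/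
theorem natAlong (κ : Collar β) [Nonempty B] {F F' : Holonomy X G} {e : X → G}
    (hA : ∀ ⦃x y : A⦄ (γ : Path x y), F.NatAlong F' e (γ.map iA.continuous))
    (hB : ∀ ⦃x y : B⦄ (γ : Path x y), F.NatAlong F' e (γ.map iB.continuous))
    {x y : X} (γ : Path x y) : F.NatAlong F' e γ := by
  obtain ⟨R, hR, hRA, hRB⟩ := h.exists_retraction κ
  obtain ⟨v, hv, hvB⟩ := h.exists_section κ
  -- The deformation of the thickened part of `A` to `A`: fixed on `A`, along the collar on `B`.
  obtain ⟨H, hHA, hHB⟩ := h.exists_desc (fun a (_ : I) => iA a) (fun b t => iB (κ.homotopy b t))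
    (fun z => funext fun t => by rw [κ.homotopy_apply, h.comm])
  have hH : ContinuousOn (fun p : X × I => H p.1 p.2) (h.thickA κ ×ˢ univ) := by
    refine h.continuousOn_prod (h.isOpen_thickA κ) ?_ ?_
    · simp only [hHA]; fun_prop
    · simp only [hHB, (h.preimage_thickA κ).2]
      exact iB.continuous.comp_continuousOn κ.continuousOn_homotopy
  refine natAlong_of_openCover (c := fun b : Bool => if b then h.thickA κ else h.innerB) ?_ ?_ ?_ γ
  · rintro (_ | _)
    · simpa using h.isOpen_innerB κ
    · simpa using h.isOpen_thickA κ
  · exact fun x => (h.mem_or κ x).elim (fun hx => ⟨true, by simpa⟩) (fun hx => ⟨false, by simpa⟩)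
  · rintro (_ | _) x y γ hγ
    · simp only [Bool.false_eq_true, if_false] at hγ
      refine (hB (γ.map' (hv.mono (range_subset_iff.2 hγ)))).congr γ fun t => ?_
      obtain ⟨b, hb, e⟩ := hγ t
      simp only [Path.map_coe, Path.map', Function.comp, Path.coe_mk_mk]
      rw [← e, hvB b hb]
    · simp only [if_true] at hγ
      -- The track of a point lies entirely in `A` or entirely in `B`, although the path `γ` may
      -- switch between them. Naturality is thus known on three sides of the square that deforms `γ`
      -- into `A`.
      have end_path : ∀ x ∈ h.thickA κ, ∃ l : Path (iA (R x)) x, (∀ t, l t = H x t) ∧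
          F.NatAlong F' e l := by
        rintro x (⟨a, rfl⟩ | ⟨b, hb, rfl⟩)
        · refine ⟨(Path.refl (iA a)).cast (by rw [hRA]) rfl, fun t => by simp [hHA],
            ((hA (Path.refl a)).congr _ fun t => by simp)⟩
        · let δ : Path (κ.homotopy b 0) b := ⟨⟨κ.homotopy b,
            κ.continuousOn_homotopy.comp_continuous (f := fun t => (b, t)) (by fun_prop)
              (fun t => ⟨hb, mem_univ _⟩)⟩, rfl, κ.homotopy_one b hb⟩
          refine ⟨(δ.map iB.continuous).cast (by
            rw [hRB, h.comm, κ.homotopy_zero b hb]) rfl, fun t => by simp [hHB, δ],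
            (hB δ).congr _ fun t => by simp⟩
      obtain ⟨l, hl, nl⟩ := end_path x (by simpa using hγ 0)
      obtain ⟨d, hd, nd⟩ := end_path y (by simpa using hγ 1)
      have hK : Continuous fun p : I × I => H (γ p.1) p.2 :=
        hH.comp_continuous (f := fun p : I × I => (γ p.1, p.2)) (by fun_prop)
          (fun p => ⟨hγ _, mem_univ _⟩)
      refine NatAlong.square hK ((γ.map' (hR.mono (range_subset_iff.2 hγ))).map iA.continuous) γ l d
        (fun t => ?_) (fun t => ?_) (fun t => by simpa using hl t) (fun t => by simpa using hd t)
        (hA _) nl nd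
      · simp only [Path.map_coe, Path.map', Function.comp, Path.coe_mk_mk]
        rcases hγ t with ⟨a, e⟩ | ⟨b, hb, e⟩
        · rw [← e, hRA, hHA]
        · rw [← e, hRB, hHB, h.comm]
          exact congr_arg iB (κ.homotopy_zero b hb).symm
      · rcases hγ t with ⟨a, e⟩ | ⟨b, hb, e⟩
        · simp only [← e, hHA]
        · simp only [← e, hHB, κ.homotopy_one b hb]

/-- Functors on both parts that agree on the gluing locus come from a functor on `X`. -/
theorem exists_holonomy (κ : Collar β) [Nonempty B] (FA : Holonomy A G) (FB : Holonomy B G)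
    (hF : ∀ ⦃z w : S⦄ (γ : Path z w), FA.val (γ.map ρ.continuous) = FB.val (γ.map β.continuous)) :
    ∃ (F : Holonomy X G) (ε : B → G), (∀ z, ε (β z) = 1) ∧
      (∀ ⦃x y : A⦄ (γ : Path x y), F.val (γ.map iA.continuous) = FA.val γ) ∧
      ∀ ⦃x y : B⦄ (γ : Path x y), (F.comap iB).NatAlong FB ε γ := by
  classical
  obtain ⟨R, hR, hRA, hRB⟩ := h.exists_retraction κ
  obtain ⟨v, hv, hvB⟩ := h.exists_section κ
  have hc : ∀ b ∈ κ.nbhd, Continuous (κ.homotopy b) := fun b hb =>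
    κ.continuousOn_homotopy.comp_continuous (f := fun t => (b, t)) (by fun_prop)
      (fun t => ⟨hb, mem_univ _⟩)
  let δ : ∀ b, b ∈ κ.nbhd → Path (β (κ.proj b)) b := fun b hb => ⟨⟨κ.homotopy b, hc b hb⟩,
    κ.homotopy_zero b hb, κ.homotopy_one b hb⟩
  -- The gauge is the value of `FB` along the collar lines. It makes `FB` equal, and not merely
  -- isomorphic, to the pullback of `FA` on the collar. The jump to `1` outside the collar does no
  -- harm, since a gauge transformation can be an arbitrary function.
  let ε : B → G := fun b => if hb : b ∈ κ.nbhd then FB.val (δ b hb) else 1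
  have hε : ∀ b (hb : b ∈ κ.nbhd), ε b = FB.val (δ b hb) := fun b hb => dif_pos hb
  obtain ⟨f, hf, hfA⟩ := FA.exists_pullbackOn hR
  obtain ⟨g, hg, hgB⟩ := (FB.gauge ε).exists_pullbackOn hv
  have hfB : ∀ ⦃x y : B⦄ (γ : Path x y), (∀ t, γ t ∈ κ.nbhd) →
      f (γ.map iB.continuous) = (FB.gauge ε).val γ := by
    intro x y γ hγ
    have hx : x ∈ κ.nbhd := by simpa using hγ 0
    have hy : y ∈ κ.nbhd := by simpa using hγ 1
    let γ' := γ.map' (κ.continuousOn_proj.mono (range_subset_iff.2 hγ))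
    rw [hfA _ (fun t => Or.inr ⟨_, hγ t, rfl⟩) (γ'.map ρ.continuous) (fun t => by
      simp [hRB, γ', Path.map']), hF, gauge_val, hε x hx, hε y hy, eq_mul_inv_iff_mul_eq]
    -- The collar homotopy applied to `γ` is a square whose sides are the projection of `γ` to the
    -- gluing locus, `γ` itself, and the two collar lines.
    have hK : Continuous fun p : I × I => κ.homotopy (γ p.1) p.2 :=
      κ.continuousOn_homotopy.comp_continuous (f := fun p : I × I => (γ p.1, p.2)) (by fun_prop)
          (fun p => ⟨hγ _, mem_univ _⟩)
    exact FB.val_square hK _ _ _ _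
      (fun t => by simp [γ', Path.map', κ.homotopy_zero _ (hγ t)])
      (fun t => (κ.homotopy_one _ (hγ t)).symm) (fun t => by simp [δ]) (fun t => by simp [δ])
  have lift : ∀ ⦃x y : X⦄ (γ : Path x y), (∀ t, γ t ∈ h.innerB) → ∃ (x' y' : B) (γ' : Path x' y'),
      (∀ t, γ' t ∉ range β) ∧ ∀ t, γ t = iB (γ' t) := by
    intro x y γ hγ
    have key : ∀ t, v (γ t) ∉ range β ∧ γ t = iB (v (γ t)) := fun t => by
      obtain ⟨b, hb, e⟩ := hγ t
      rw [← e, hvB b hb]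
      exact ⟨hb, rfl⟩
    exact ⟨_, _, γ.map' (hv.mono (range_subset_iff.2 hγ)), fun t => (key t).1, fun t => (key t).2⟩
  obtain ⟨F, hFU, hFV⟩ := exists_of_two_opens (h.isOpen_thickA κ) (h.isOpen_innerB κ) (h.mem_or κ)
    hf hg (fun x y γ hU hV => by
      obtain ⟨x', y', γ', hγ', e⟩ := lift γ hV
      rw [hgB γ hV γ' (fun t => by rw [e, hvB _ (hγ' t)]), ← hfB γ' (fun t => ?_)]
      · exact Path.congr_val f _ _ e
      · have := hU t
        rw [e] at this
        exact (h.preimage_thickA κ).2.subset this)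
  refine ⟨F, ε, fun z => ?_, fun x y γ => ?_, fun x y γ => ?_⟩
  · rw [hε _ (κ.mem_nbhd z), FB.val_congr _ (Path.refl (β z)) (fun t => by
      simp [δ, κ.homotopy_apply]), val_refl]
  · have hm : ∀ t, γ.map iA.continuous t ∈ h.thickA κ := fun t => Or.inl ⟨_, rfl⟩
    rw [hFU _ hm]
    exact hfA _ hm γ fun t => (hRA _).symm
  · have nat_of : ∀ ⦃x y : B⦄ (γ : Path x y), F.val (γ.map iB.continuous) = (FB.gauge ε).val γ →
        (F.comap iB).NatAlong FB ε γ := fun x y γ e => by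
      rw [NatAlong, comap_val, e, gauge_val]; group
    refine natAlong_of_openCover (c := fun b : Bool => if b then κ.nbhd else (range β)ᶜ) ?_ ?_ ?_ γ
    · rintro (_ | _)
      · simpa using κ.isClosed_range
      · simpa using κ.isOpen_nbhd
    · intro b
      by_cases hb : b ∈ range β
      · obtain ⟨z, rfl⟩ := hb
        exact ⟨true, by simpa using κ.mem_nbhd z⟩
      · exact ⟨false, by simpa using hb⟩
    · rintro (_ | _) x y γ hγ
      · simp only [Bool.false_eq_true, if_false] at hγ
        refine nat_of γ ?_
        have hm : ∀ t, γ.map iB.continuous t ∈ h.innerB := fun t => ⟨_, hγ t, rfl⟩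
        rw [hFV _ hm]
        exact hgB _ hm γ fun t => (hvB _ (hγ t)).symm
      · simp only [if_true] at hγ
        refine nat_of γ ?_
        rw [hFU _ fun t => Or.inr ⟨_, hγ t, rfl⟩]
        exact hfB γ hγ

end IsGluing

end Glue

end

/-! ### The circle, and naturality across a chart -/

section

open Set Topology
open scoped unitInterval

set_option linter.unusedSectionVars false

namespace Circle

/-- The upper half circle. -/
noncomputable def upperPath : Path (1 : Circle) (Circle.exp Real.pi) where
  toFun t := Circle.exp (Real.pi * t)
  source' := by simp
  target' := by simp

/-- The lower half circle. -/
noncomputable def lowerPath : Path (Circle.exp Real.pi) (1 : Circle) where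
  toFun t := Circle.exp (Real.pi * (1 + t))
  source' := by simp
  target' := by
    rw [show Real.pi * (1 + ((1 : I) : ℝ)) = 2 * Real.pi by simp; ring]
    exact Circle.exp_two_pi

/-- The standard loop. -/
noncomputable def loop : Path (1 : Circle) 1 := upperPath.trans lowerPath

theorem loop_apply (t : I) : loop t = Circle.exp (2 * Real.pi * t) := by
  rw [loop, Path.trans_apply]
  split_ifs
  · simp only [upperPath, Path.coe_mk_mk]
    congr 1; ring
  · simp only [lowerPath, Path.coe_mk_mk]
    congr 1; ring

theorem exists_lift {z w : Circle} (γ : Path z w) (a : ℝ) (ha : Circle.exp a = z) :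
    ∃ (b : ℝ) (δ : Path a b), ∀ t, Circle.exp (δ t) = γ t := by
  have h0 : γ.toContinuousMap 0 = Circle.exp a := by simp [ha]
  refine ⟨_, ⟨Circle.isCoveringMap_exp.liftPath γ a h0, Circle.isCoveringMap_exp.liftPath_zero γ a h0,
    rfl⟩, fun t => ?_⟩
  exact congr_fun (Circle.isCoveringMap_exp.liftPath_lifts γ a h0) t

end Circle

namespace Holonomy

variable {X G : Type*} [TopologicalSpace X] [Group G]

theorem natAlong_of_nhds {F F' : Holonomy X G} {e : X → G}
    (h : ∀ x, ∃ U ∈ 𝓝 x, ∀ ⦃y z : X⦄ (γ : Path y z), (∀ t, γ t ∈ U) → F.NatAlong F' e γ)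
    {x y : X} (γ : Path x y) : F.NatAlong F' e γ := by
  choose U hU hn using h
  exact natAlong_of_openCover (c := fun x => interior (U x)) (fun _ => isOpen_interior)
    (fun x => ⟨x, mem_interior_iff_mem_nhds.2 (hU x)⟩)
    (fun i y z γ hγ => hn i γ fun t => interior_subset (hγ t)) γ

theorem val_exp_segment (F : Holonomy Circle G) (n : ℤ) :
    F.val ((Path.segment 0 (n * (2 * Real.pi))).map Circle.exp.continuous) =
      F.val Circle.loop ^ n := by
  have hseg : ∀ (a b : ℝ) (t : I), Path.segment a b t = a + t * (b - a) := fun a b t => by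
    simp [AffineMap.lineMap_apply, add_comm]
  have step : ∀ n : ℤ,
      F.val ((Path.segment 0 ((n + 1 : ℤ) * (2 * Real.pi))).map Circle.exp.continuous) =
      F.val ((Path.segment 0 (n * (2 * Real.pi))).map Circle.exp.continuous) *
        F.val Circle.loop := by
    intro n
    have e := F.val_eq_of_convex convex_univ (φ := Circle.exp) (by fun_prop)
      (Path.segment 0 (((n + 1 : ℤ) : ℝ) * (2 * Real.pi)))
      ((Path.segment 0 ((n : ℝ) * (2 * Real.pi))).trans (Path.segment _ (((n + 1 : ℤ) : ℝ) * (2 * Real.pi))))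
      (fun _ => mem_univ _) (fun _ => mem_univ _)
      ((Path.segment 0 ((n + 1 : ℤ) * (2 * Real.pi))).map Circle.exp.continuous)
      (((Path.segment 0 (n * (2 * Real.pi))).trans (Path.segment _ (((n + 1 : ℤ) : ℝ) * (2 * Real.pi)))).map Circle.exp.continuous)
      (fun _ => rfl) (fun _ => rfl) rfl rfl
    rw [e, Path.map_trans, val_trans]
    congr 1
    refine F.val_congr _ _ fun t => ?_
    rw [Circle.loop_apply, Path.map_coe, Function.comp, hseg, Circle.exp_eq_exp]
    -- The segment from `2πn` to `2π(n + 1)` covers the standard loop shifted by the period `2πn`.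
    exact ⟨n, by push_cast; ring⟩
  induction n with
  | zero =>
    rw [F.val_congr _ (Path.refl 1) (fun t => by simp)]
    simp
  | succ n ih => rw [step, ih, zpow_add_one]
  | pred n ih =>
    have := step (-n - 1)
    rw [sub_add_cancel, ih] at this
    rw [zpow_sub_one, this, mul_inv_cancel_right]

/-- A loop at `1` lifts to a path in `ℝ` from `0` to some `2πn`, and all such paths are homotopic.
Hence every functor sends the loop to the `n`-th power of its value on the standard loop. -/
theorem exists_natAlong_circle (F F' : Holonomy Circle G)
    (h : F.val Circle.loop = F'.val Circle.loop) :
    ∃ e : Circle → G, e 1 = 1 ∧ ∀ ⦃x y : Circle⦄ (γ : Path x y), F.NatAlong F' e γ := by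
  refine exists_natAlong_of_loops F F' 1 fun γ => ?_
  obtain ⟨b, δ, hδ⟩ := Circle.exists_lift γ 0 Circle.exp_zero
  have hb : Circle.exp b = 1 := by simpa using hδ 1
  obtain ⟨n, rfl⟩ := Circle.exp_eq_one.1 hb
  have key : ∀ F : Holonomy Circle G, F.val γ = F.val Circle.loop ^ n := fun F => by
    rw [← val_exp_segment]
    exact F.val_eq_of_convex convex_univ (φ := Circle.exp) (by fun_prop) δ
      (Path.segment _ _) (fun _ => mem_univ _) (fun _ => mem_univ _) _ _ hδ (fun _ => rfl) rfl rfl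
  rw [key F, key F', h]

/-- Naturality in a chart by a convex subset of the complex plane, the upper and lower halves of
which lie in sets where naturality is known. -/
theorem natAlong_of_chart {F F' : Holonomy X G} {e : X → G} {W P Q : Set X} {K : Set ℂ}
    (hK : Convex ℝ K) {φ : X → ℂ} {ψ : ℂ → X} (hφ : ContinuousOn φ W) (hψ : ContinuousOn ψ K)
    (hWK : ∀ x ∈ W, φ x ∈ K) (hψφ : ∀ x ∈ W, ψ (φ x) = x)
    (hP : ∀ z ∈ K, 0 ≤ z.im → ψ z ∈ P) (hQ : ∀ z ∈ K, z.im ≤ 0 → ψ z ∈ Q)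
    (nP : ∀ ⦃x y : X⦄ (γ : Path x y), (∀ t, γ t ∈ P) → F.NatAlong F' e γ)
    (nQ : ∀ ⦃x y : X⦄ (γ : Path x y), (∀ t, γ t ∈ Q) → F.NatAlong F' e γ)
    {x y : X} (γ : Path x y) (hγ : ∀ t, γ t ∈ W) : F.NatAlong F' e γ := by
  have hx : x ∈ W := by simpa using hγ 0
  have hy : y ∈ W := by simpa using hγ 1
  -- A path may cross the real axis infinitely often. It is replaced by at most two segments that
  -- meet on the axis, each of them in one closed half.
  have main : ∀ z w : ℂ, z ∈ K → w ∈ K → ∃ δ : Path z w, ∃ h : ∀ t, δ t ∈ K,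
      F.NatAlong F' e (δ.map' (hψ.mono (range_subset_iff.2 h))) := by
    have half : ∀ z w : ℂ, z ∈ K → w ∈ K → (0 ≤ z.im ∧ 0 ≤ w.im ∨ z.im ≤ 0 ∧ w.im ≤ 0) →
        ∃ δ : Path z w, ∃ h : ∀ t, δ t ∈ K,
          F.NatAlong F' e (δ.map' (hψ.mono (range_subset_iff.2 h))) := by
      intro z w hz hw him
      have hs : ∀ t, Path.segment z w t ∈ K := fun t =>
        hK.segment_subset hz hw (by rw [← Path.range_segment]; exact ⟨t, rfl⟩)
      have hi : ∀ t : I, (Path.segment z w t).im = (1 - t) * z.im + t * w.im := fun t => by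
        simp [AffineMap.lineMap_apply]; ring
      refine ⟨Path.segment z w, hs, ?_⟩
      rcases him with ⟨h1, h2⟩ | ⟨h1, h2⟩
      · refine nP _ fun t => hP _ (hs t) ?_
        rw [hi]
        have := t.2.1; have := t.2.2
        have : 0 ≤ 1 - (t : ℝ) := by linarith
        positivity
      · refine nQ _ fun t => hQ _ (hs t) ?_
        rw [hi]
        have h3 := t.2.1
        have h4 : 0 ≤ 1 - (t : ℝ) := by linarith [t.2.2]
        nlinarith [mul_nonneg h4 (neg_nonneg.2 h1), mul_nonneg h3 (neg_nonneg.2 h2)]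
    intro z w hz hw
    by_cases him : 0 ≤ z.im ∧ 0 ≤ w.im ∨ z.im ≤ 0 ∧ w.im ≤ 0
    · exact half z w hz hw him
    obtain ⟨m, hm, him0⟩ : ∃ m ∈ K, m.im = 0 := by
      have hcont : ContinuousOn (fun t : ℝ => (AffineMap.lineMap z w t : ℂ).im) (uIcc 0 1) := by
        refine Continuous.continuousOn ?_
        exact Complex.continuous_im.comp AffineMap.lineMap_continuous
      have h0 : (0 : ℝ) ∈ uIcc ((AffineMap.lineMap z w (0 : ℝ) : ℂ).im)
          ((AffineMap.lineMap z w (1 : ℝ) : ℂ).im) := by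
        rw [mem_uIcc]
        simp only [AffineMap.lineMap_apply_zero, AffineMap.lineMap_apply_one]
        push Not at him
        rcases le_total 0 z.im with h | h
        · exact Or.inr ⟨(him.1 h).le, h⟩
        · exact Or.inl ⟨h, (him.2 h).le⟩
      obtain ⟨t, ht, h⟩ := intermediate_value_uIcc hcont h0
      rw [uIcc_of_le zero_le_one] at ht
      exact ⟨_, hK.segment_subset hz hw (by
        rw [segment_eq_image_lineMap]; exact ⟨t, ht, rfl⟩), h⟩
    obtain ⟨δ₁, h₁, n₁⟩ := half z m hz hm (by
      rcases le_total 0 z.im with h | h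
      · exact Or.inl ⟨h, him0.ge⟩
      · exact Or.inr ⟨h, him0.le⟩)
    obtain ⟨δ₂, h₂, n₂⟩ := half m w hm hw (by
      rcases le_total 0 w.im with h | h
      · exact Or.inl ⟨him0.ge, h⟩
      · exact Or.inr ⟨him0.le, h⟩)
    refine ⟨δ₁.trans δ₂, fun t => ?_, (n₁.trans n₂).congr _ fun t => ?_⟩
    · rw [Path.trans_apply]; split_ifs
      exacts [h₁ _, h₂ _]
    · simp only [Path.map', Path.coe_mk_mk, Path.trans_apply, Function.comp]
      split_ifs <;> rfl
  obtain ⟨δ, hδ, nδ⟩ := main _ _ (hWK x hx) (hWK y hy)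
  -- The replacement and the image of `γ` in the chart have the same ends in the convex set `K`.
  have key : ∀ F : Holonomy X G, F.val (δ.map' (hψ.mono (range_subset_iff.2 hδ))) = F.val γ :=
    fun F => F.val_eq_of_convex hK hψ δ (γ.map' (hφ.mono (range_subset_iff.2 hγ))) hδ
      (fun t => hWK _ (hγ t)) _ _ (fun t => rfl) (fun t => hψφ _ (hγ t)) rfl rfl
  unfold NatAlong at *
  rw [key, key, hψφ x hx, hψφ y hy] at nδ
  exact nδ

end Holonomy

end

/-! ### The sphere with holes and its two halves -/

section

open Set Topology Filter
open scoped unitInterval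

set_option linter.unusedSectionVars false

theorem OnePoint.tendsto_infty_of_norm {α : Type*} {l : Filter α} {f : α → OnePoint ℂ}
    (h : ∀ R : ℝ, ∀ᶠ x in l, ∀ z : ℂ, f x = z → R < ‖z‖) : Tendsto f l (𝓝 OnePoint.infty) := by
  rw [OnePoint.hasBasis_nhds_infty.tendsto_right_iff]
  rintro s ⟨hs, hsc⟩
  obtain ⟨R, hR⟩ := hsc.isBounded.subset_closedBall 0
  filter_upwards [h R] with x hx
  induction hfx : f x using OnePoint.rec with
  | infty => exact Or.inr rfl
  | coe z =>
    refine Or.inl ⟨z, fun hz => ?_, rfl⟩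
    have := hR hz
    rw [mem_closedBall_zero_iff] at this
    exact (hx z hfx).not_ge this

theorem OnePoint.eventually_norm (R : ℝ) :
    ∀ᶠ x : OnePoint ℂ in 𝓝 OnePoint.infty, ∀ z : ℂ, x = (z : OnePoint ℂ) → R < ‖z‖ := by
  have h := (OnePoint.hasBasis_nhds_infty (X := ℂ)).mem_of_mem
    (i := Metric.closedBall (0 : ℂ) R) ⟨Metric.isClosed_closedBall, isCompact_closedBall _ _⟩
  refine mem_of_superset h ?_
  rintro x (⟨w, hw, rfl⟩ | rfl) z hz
  · rw [OnePoint.coe_eq_coe] at hz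
    subst hz
    simpa using hw
  · exact absurd hz (OnePoint.infty_ne_coe z)

namespace CompactSurface.HoledSphere

variable {n : ℕ}

/-- The points of the plane outside the holes. -/
def outside (n : ℕ) : Set ℂ := {z | ∀ i : Fin n, 1 ≤ ‖z - 3 * (i : ℕ)‖}

theorem mem_outside_iff {z : ℂ} : z ∈ outside n ↔
    ∀ i : Fin n, (z : OnePoint ℂ) ∉ ((↑) : ℂ → OnePoint ℂ) '' Metric.ball (3 * ((i : ℕ) : ℂ)) 1 := by
  refine forall_congr' fun i => ?_
  rw [(OnePoint.coe_injective).mem_set_image, Metric.mem_ball, not_lt, dist_eq_norm]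

/-- The underlying point of the sphere. -/
def val (x : HoledSphere n) : OnePoint ℂ := x.1

theorem val_injective : Function.Injective (val : HoledSphere n → OnePoint ℂ) :=
  Subtype.val_injective

theorem isInducing_val : IsInducing (val : HoledSphere n → OnePoint ℂ) :=
  IsInducing.subtypeVal

theorem continuous_val : Continuous (val : HoledSphere n → OnePoint ℂ) :=
  isInducing_val.continuous

/-- The point at infinity. -/
def infty : HoledSphere n := ⟨OnePoint.infty, by
  rintro i ⟨w, -, h⟩
  exact OnePoint.coe_ne_infty w h⟩

theorem exists_val_eq {z : ℂ} (h : z ∈ outside n) : ∃ x : HoledSphere n, x.val = z :=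
  ⟨⟨z, mem_outside_iff.1 h⟩, rfl⟩

open Classical in
/-- The inclusion of the plane outside the holes. -/
noncomputable def ofPlane (z : ℂ) : HoledSphere n :=
  if h : z ∈ outside n then (exists_val_eq h).choose else infty

theorem ofPlane_val {z : ℂ} (h : z ∈ outside n) : (ofPlane z : HoledSphere n).val = z := by
  unfold ofPlane
  rw [dif_pos h]
  exact (exists_val_eq h).choose_spec

theorem eq_infty_or (x : HoledSphere n) : x = infty ∨ ∃ z ∈ outside n, x = ofPlane z := by
  obtain ⟨x, hx⟩ := x
  induction x using OnePoint.rec with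
  | infty => exact Or.inl rfl
  | coe z =>
    have hz := mem_outside_iff.2 hx
    exact Or.inr ⟨z, hz, val_injective (ofPlane_val hz).symm⟩

theorem ofPlane_ne_infty {z : ℂ} (h : z ∈ outside n) : (ofPlane z : HoledSphere n) ≠ infty :=
  fun e => OnePoint.coe_ne_infty z ((ofPlane_val h).symm.trans (congr_arg val e))

theorem ofPlane_injOn {z w : ℂ} (hz : z ∈ outside n) (hw : w ∈ outside n)
    (h : (ofPlane z : HoledSphere n) = ofPlane w) : z = w := by
  have := congr_arg val h
  rwa [ofPlane_val hz, ofPlane_val hw, OnePoint.coe_eq_coe] at this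

theorem continuousOn_ofPlane : ContinuousOn (ofPlane : ℂ → HoledSphere n) (outside n) := by
  rw [isInducing_val.continuousOn_iff]
  exact OnePoint.continuous_coe.continuousOn.congr fun z hz => ofPlane_val hz

open Classical in
/-- The affine coordinate; `0` at infinity. -/
noncomputable def toPlane (x : HoledSphere n) : ℂ :=
  if h : ∃ z ∈ outside n, x = ofPlane z then h.choose else 0

theorem toPlane_ofPlane {z : ℂ} (h : z ∈ outside n) : toPlane (ofPlane z : HoledSphere n) = z := by
  have hex : ∃ w ∈ outside n, (ofPlane z : HoledSphere n) = ofPlane w := ⟨z, h, rfl⟩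
  rw [toPlane, dif_pos hex]
  exact (ofPlane_injOn h hex.choose_spec.1 hex.choose_spec.2).symm

theorem toPlane_infty : toPlane (infty : HoledSphere n) = 0 := by
  rw [toPlane, dif_neg]
  rintro ⟨z, hz, e⟩
  exact ofPlane_ne_infty hz e.symm

theorem val_eq_toPlane {x : HoledSphere n} (h : x ≠ infty) : x.val = toPlane x := by
  rcases eq_infty_or x with rfl | ⟨z, hz, rfl⟩
  · exact absurd rfl h
  · rw [toPlane_ofPlane hz, ofPlane_val hz]

theorem ofPlane_toPlane {x : HoledSphere n} (h : x ≠ infty) : ofPlane (toPlane x) = x := by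
  rcases eq_infty_or x with rfl | ⟨z, hz, rfl⟩
  · exact absurd rfl h
  · rw [toPlane_ofPlane hz]

theorem toPlane_mem {x : HoledSphere n} (h : x ≠ infty) : toPlane x ∈ outside n := by
  rcases eq_infty_or x with rfl | ⟨z, hz, rfl⟩
  · exact absurd rfl h
  · rwa [toPlane_ofPlane hz]

theorem isOpen_ne_infty : IsOpen {x : HoledSphere n | x ≠ infty} := by
  have : {x : HoledSphere n | x ≠ infty} = val ⁻¹' ({OnePoint.infty}ᶜ : Set (OnePoint ℂ)) := by
    ext x
    exact not_congr val_injective.eq_iff.symm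
  rw [this]
  exact (isClosed_singleton.isOpen_compl).preimage continuous_val

theorem continuousOn_toPlane : ContinuousOn (toPlane : HoledSphere n → ℂ) {x | x ≠ infty} := by
  intro x hx
  have e : ((↑) : ℂ → OnePoint ℂ) ∘ toPlane =ᶠ[𝓝[{x | x ≠ infty}] x] (val : HoledSphere n → _) := by
    filter_upwards [self_mem_nhdsWithin] with y hy
    exact (val_eq_toPlane hy).symm
  rw [ContinuousWithinAt, OnePoint.isOpenEmbedding_coe.isInducing.tendsto_nhds_iff]
  refine Tendsto.congr' e.symm ?_
  rw [← val_eq_toPlane hx]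
  exact continuous_val.continuousAt.continuousWithinAt

theorem tendsto_infty {α : Type*} {l : Filter α} {f : α → HoledSphere n}
    (h : ∀ R : ℝ, ∀ᶠ x in l, f x ≠ infty → R < ‖toPlane (f x)‖) : Tendsto f l (𝓝 infty) := by
  rw [isInducing_val.tendsto_nhds_iff]
  refine OnePoint.tendsto_infty_of_norm fun R => ?_
  filter_upwards [h R] with x hx z hz
  have hne : f x ≠ infty := fun e => by
    rw [Function.comp, e] at hz
    exact OnePoint.infty_ne_coe z hz
  rw [Function.comp, val_eq_toPlane hne, OnePoint.coe_eq_coe] at hz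
  rw [← hz]
  exact hx hne

theorem eventually_norm (R : ℝ) :
    ∀ᶠ x in 𝓝 (infty : HoledSphere n), x ≠ infty → R < ‖toPlane x‖ := by
  filter_upwards [continuous_val.continuousAt.eventually (OnePoint.eventually_norm R)] with x hx hne
  exact hx _ (val_eq_toPlane hne)

/-- The closed half of the holed sphere where `s * im` is nonnegative. -/
def half (s : ℝ) : Set (HoledSphere n) := {x | 0 ≤ s * (toPlane x).im}

/-- The default value `0` of `toPlane` at infinity puts this point into both halves, where it serves
as the common base point. -/
theorem infty_mem_half (s : ℝ) : (infty : HoledSphere n) ∈ half s := by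
  simp [half, toPlane_infty]

theorem ofPlane_mem_half {s : ℝ} {z : ℂ} (hz : z ∈ outside n) :
    (ofPlane z : HoledSphere n) ∈ half s ↔ 0 ≤ s * z.im := by
  rw [half, mem_ofPred_eq, toPlane_ofPlane hz]

/-- Moving a point away from the real axis. -/
theorem sq_add {s : ℝ} (h1 : s ^ 2 = 1) (z : ℂ) (r : ℝ) (c : ℝ) :
    ‖z + (s * r : ℝ) * Complex.I - c‖ ^ 2 = ‖z - c‖ ^ 2 + 2 * r * (s * z.im) + r ^ 2 := by
  simp only [Complex.sq_norm, Complex.normSq_apply]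
  simp
  linear_combination r ^ 2 * h1

/-- The centres of the holes are real, so moving vertically away from the real axis increases the
distance from each of them. A half can therefore be pushed to infinity without meeting the holes. -/
theorem norm_sub_le_norm_add {s : ℝ} (h1 : s ^ 2 = 1) {z : ℂ} (hs : 0 ≤ s * z.im) {r : ℝ}
    (hr : 0 ≤ r) (c : ℝ) : ‖z - c‖ ≤ ‖z + (s * r : ℝ) * Complex.I - c‖ := by
  have := sq_add h1 z r c
  have := mul_nonneg hr hs
  exact le_of_sq_le_sq (by nlinarith) (norm_nonneg _)

theorem add_mem_outside {s : ℝ} (h1 : s ^ 2 = 1) {z : ℂ} (hz : z ∈ outside n)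
    (hs : 0 ≤ s * z.im) {r : ℝ} (hr : 0 ≤ r) : z + (s * r : ℝ) * Complex.I ∈ outside n := by
  intro i
  have := norm_sub_le_norm_add h1 hs hr (3 * (i : ℕ))
  push_cast at this ⊢
  exact (hz i).trans this

theorem norm_add_ge {s : ℝ} (h1 : s ^ 2 = 1) {z : ℂ} (hs : 0 ≤ s * z.im) {r : ℝ}
    (hr : 0 ≤ r) : ‖z‖ ≤ ‖z + (s * r : ℝ) * Complex.I‖ ∧ r ≤ ‖z + (s * r : ℝ) * Complex.I‖ := by
  have h := norm_sub_le_norm_add h1 hs hr 0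
  have h2 := sq_add h1 z r 0
  simp only [Complex.ofReal_zero, sub_zero] at h h2
  refine ⟨h, le_of_sq_le_sq ?_ (norm_nonneg _)⟩
  have := mul_nonneg hr hs
  nlinarith [sq_nonneg ‖z‖]

open Classical in
/-- The contraction of a half to infinity. -/
noncomputable def push (s : ℝ) (x : HoledSphere n) (t : I) : HoledSphere n :=
  if x = infty ∨ t = 0 then infty else
    ofPlane (toPlane x + (s * ((1 - t) / t) : ℝ) * Complex.I)

theorem ratio_nonneg (t : I) : 0 ≤ (1 - (t : ℝ)) / t :=
  div_nonneg (by linarith [t.2.2]) t.2.1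

theorem push_of_ne {s : ℝ} {x : HoledSphere n} {t : I} (hx : x ≠ infty) (ht : t ≠ 0) :
    push s x t = ofPlane (toPlane x + (s * ((1 - t) / t) : ℝ) * Complex.I) := by
  unfold push
  rw [if_neg (by tauto)]

theorem push_infty (s : ℝ) (t : I) : push s (infty : HoledSphere n) t = infty := if_pos (Or.inl rfl)

theorem push_zero (s : ℝ) (x : HoledSphere n) : push s x 0 = infty := if_pos (Or.inr rfl)

theorem push_one (s : ℝ) (x : HoledSphere n) : push s x 1 = x := by
  by_cases hx : x = infty
  · rw [hx, push_infty]
  · rw [push_of_ne hx one_ne_zero]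
    simp [ofPlane_toPlane hx]

theorem push_mem_half {s : ℝ} (h1 : s ^ 2 = 1) {x : HoledSphere n} (hx : x ∈ half s) (t : I) :
    push s x t ∈ half s := by
  by_cases h : x = infty ∨ t = 0
  · rw [show push s x t = infty from if_pos h]
    exact infty_mem_half s
  · push Not at h
    rw [push_of_ne h.1 h.2, ofPlane_mem_half (add_mem_outside h1 (toPlane_mem h.1) hx (ratio_nonneg t))]
    have hx : 0 ≤ s * (toPlane x).im := hx
    have := ratio_nonneg t
    simp only [Complex.add_im, Complex.mul_im, Complex.ofReal_re,
      Complex.I_im, Complex.ofReal_im, Complex.I_re]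
    nlinarith

/-- The modulus after the push is bounded below both by the original modulus and by the distance
pushed. The first bound gives continuity of `push` as `x` tends to infinity, the second as `t` tends
to `0`. -/
theorem push_norm {s : ℝ} (h1 : s ^ 2 = 1) {x : HoledSphere n} (hx : x ∈ half s) {t : I}
    (h : push s x t ≠ infty) : x ≠ infty ∧ t ≠ 0 ∧ ‖toPlane x‖ ≤ ‖toPlane (push s x t)‖ ∧
      (1 - (t : ℝ)) / t ≤ ‖toPlane (push s x t)‖ := by
  have hx' : x ≠ infty := fun e => h (e ▸ push_infty s t)
  have ht : t ≠ 0 := fun e => h (e ▸ push_zero s x)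
  rw [push_of_ne hx' ht, toPlane_ofPlane (add_mem_outside h1 (toPlane_mem hx') hx (ratio_nonneg t))]
  exact ⟨hx', ht, norm_add_ge h1 hx (ratio_nonneg t)⟩

theorem continuousOn_push {s : ℝ} (h1 : s ^ 2 = 1) :
    ContinuousOn (fun p : HoledSphere n × I => push s p.1 p.2) (half s ×ˢ univ) := by
  rintro ⟨x, t⟩ ⟨hx, -⟩
  by_cases hxi : x = infty
  · subst hxi
    rw [ContinuousWithinAt, push_infty]
    refine tendsto_infty fun R => ?_
    have h := (continuous_fst.tendsto ((infty : HoledSphere n), t)).eventually (eventually_norm R)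
    filter_upwards [nhdsWithin_le_nhds h, self_mem_nhdsWithin] with p hp hps hne
    obtain ⟨h1, h2, h3, h4⟩ := push_norm h1 hps.1 hne
    exact (hp h1).trans_le h3
  by_cases ht : t = 0
  · subst ht
    rw [ContinuousWithinAt, push_zero]
    refine tendsto_infty fun R => ?_
    -- For positive `t`, the inequality `(R + 1) t + t < 1` implies `R < (1 - t) / t`, and it holds
    -- near `t = 0`.
    have hc : ContinuousAt (fun p : HoledSphere n × I => (R + 1) * (p.2 : ℝ) + p.2) (x, 0) := by
      fun_prop
    have h := hc.preimage_mem_nhds (Iio_mem_nhds (show _ < (1 : ℝ) by simp))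
    filter_upwards [nhdsWithin_le_nhds h, self_mem_nhdsWithin] with p hp hps hne
    rw [mem_preimage, mem_Iio] at hp
    obtain ⟨h1, h2, h3, h4⟩ := push_norm h1 hps.1 hne
    refine lt_of_lt_of_le ?_ h4
    have : 0 < (p.2 : ℝ) := unitInterval.pos_iff_ne_zero.2 h2
    rw [lt_div_iff₀ this]
    linarith
  · have hU : {p : HoledSphere n × I | p.1 ≠ infty ∧ p.2 ≠ 0} ∈ 𝓝 (x, t) :=
      ((isOpen_ne_infty.preimage continuous_fst).inter
        (isOpen_ne.preimage continuous_snd)).mem_nhds ⟨hxi, ht⟩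
    refine ContinuousWithinAt.mono_of_mem_nhdsWithin (t := {p : HoledSphere n × I | p.1 ∈ half s} ∩
      {p : HoledSphere n × I | p.1 ≠ infty ∧ p.2 ≠ 0}) ?_
      (Filter.inter_mem (mem_of_superset self_mem_nhdsWithin fun p hp => hp.1)
        (nhdsWithin_le_nhds hU))
    have key : ContinuousOn (fun p : HoledSphere n × I =>
        (ofPlane (toPlane p.1 + (s * ((1 - p.2) / p.2) : ℝ) * Complex.I) : HoledSphere n))
        ({p : HoledSphere n × I | p.1 ∈ half s} ∩ {p : HoledSphere n × I | p.1 ≠ infty ∧ p.2 ≠ 0}) := by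
      refine continuousOn_ofPlane.comp ?_ fun p hp =>
        add_mem_outside h1 (toPlane_mem hp.2.1) hp.1 (ratio_nonneg _)
      refine (continuousOn_toPlane.comp continuous_fst.continuousOn fun p hp => hp.2.1).add
        (ContinuousOn.mul ?_ continuousOn_const)
      refine Complex.continuous_ofReal.comp_continuousOn (continuousOn_const.mul
        (ContinuousOn.div (by fun_prop) (by fun_prop) fun p hp => ?_))
      exact fun e => hp.2.2 (Subtype.ext e)
    exact (key _ ⟨hx, hxi, ht⟩).congr (fun p hp => push_of_ne hp.2.1 hp.2.2) (push_of_ne hxi ht)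

theorem contractsTo_half {s : ℝ} (h1 : s ^ 2 = 1) : ContractsTo (half s : Set (HoledSphere n)) infty :=
  ⟨push s, continuousOn_push h1, fun x _ => ⟨push_zero s x, push_one s x⟩⟩

/-- The path from infinity inside a half. -/
theorem exists_path_half {s : ℝ} (h1 : s ^ 2 = 1) {x : HoledSphere n} (hx : x ∈ half s) :
    ∃ γ : Path infty x, ∀ t, γ t ∈ half s := by
  refine ⟨⟨⟨push s x, ?_⟩, push_zero s x, push_one s x⟩, push_mem_half h1 hx⟩
  exact (continuousOn_push h1).comp_continuous (f := fun t => (x, t)) (by fun_prop)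
    fun t => ⟨hx, mem_univ _⟩

theorem mem_half_or (x : HoledSphere n) : x ∈ half 1 ∨ x ∈ half (-1) := by
  rcases le_total 0 (toPlane x).im with h | h
  · exact Or.inl (by simpa [half] using h)
  · exact Or.inr (by simpa [half] using h)

instance : PathConnectedSpace (HoledSphere n) := by
  refine ⟨⟨infty⟩, fun x y => ?_⟩
  have (x : HoledSphere n) : Joined infty x := by
    rcases mem_half_or x with h | h
    · exact ⟨(exists_path_half (by norm_num) h).choose⟩
    · exact ⟨(exists_path_half (by norm_num) h).choose⟩
  exact (this x).symm.trans (this y)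

end CompactSurface.HoledSphere

end

/-! ### The loops around the holes multiply to one -/

section

open Set Topology Filter
open scoped unitInterval

set_option linter.unusedSectionVars false

theorem List.prod_ofFn_telescope {G : Type*} [Group G] (D : ℕ → G) (n : ℕ) :
    (List.ofFn fun j : Fin n => D j * (D (j + 1))⁻¹).prod = D 0 * (D n)⁻¹ := by
  induction n with
  | zero => simp
  | succ n ih =>
    rw [List.ofFn_succ', List.concat_eq_append, List.prod_append]
    simp only [Fin.val_castSucc, Fin.val_last, List.prod_singleton]
    rw [ih]
    group

theorem List.prod_ofFn_if_lt_succ {M : Type*} [Monoid M] {n : ℕ} (c : Fin n → M) (k : Fin n) :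
    (List.ofFn fun i => if i ≤ k then c i else 1).prod =
      (List.ofFn fun i => if i < k then c i else 1).prod * c k := by
  induction n with
  | zero => exact k.elim0
  | succ n ih =>
    rw [List.ofFn_succ, List.ofFn_succ, List.prod_cons, List.prod_cons]
    induction k using Fin.cases with
    | zero => simp [Fin.succ_ne_zero]
    | succ k =>
      have := ih (fun i => c i.succ) k
      simp only [Fin.succ_le_succ_iff, Fin.succ_lt_succ_iff, Fin.zero_le, Fin.succ_pos, if_true]
      rw [this, mul_assoc]

theorem List.prod_ofFn_one {M : Type*} [Monoid M] {n : ℕ} {c : Fin n → M} (h : ∀ i, c i = 1) :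
    (List.ofFn c).prod = 1 :=
  List.prod_eq_one fun x hx => by
    obtain ⟨i, rfl⟩ := List.mem_ofFn.1 hx
    exact h i

theorem List.prod_ofFn_conj {G : Type*} [Group G] {n : ℕ} (c : Fin n → G) (w : G) :
    (List.ofFn fun i => w⁻¹ * c i * w).prod = w⁻¹ * (List.ofFn c).prod * w := by
  have := map_list_prod (MulAut.conj w⁻¹) (List.ofFn c)
  simp only [MulAut.conj_apply, inv_inv] at this
  rw [this, List.map_ofFn]
  congr 2
  funext i
  simp

namespace CompactSurface.HoledSphere

variable {n : ℕ}

theorem rim_mem_outside (j : Fin n) (z : Circle) : 3 * ((j : ℕ) : ℂ) + z ∈ outside n := fun i => by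
  have := rim_not_mem i j z
  rwa [Metric.mem_ball, not_lt, dist_eq_norm] at this

theorem rim_eq (j : Fin n) (z : Circle) : rim j z = ofPlane (3 * ((j : ℕ) : ℂ) + z) :=
  val_injective (ofPlane_val (rim_mem_outside j z)).symm

/-- The boundary circle of a hole as a continuous map. -/
def rimMap (j : Fin n) : C(Circle, HoledSphere n) where
  toFun := rim j
  continuous_toFun := by
    rw [show rim j = fun z : Circle => ofPlane (3 * ((j : ℕ) : ℂ) + (z : ℂ)) from funext (rim_eq j)]
    exact continuousOn_ofPlane.comp_continuous (by fun_prop) (rim_mem_outside j)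

theorem rimMap_apply (j : Fin n) (z : Circle) : rimMap j z = rim j z := rfl

theorem rim_injective (j : Fin n) : Function.Injective (rim j) := fun z w h => by
  rw [rim_eq, rim_eq] at h
  exact Subtype.ext (add_left_cancel (ofPlane_injOn (rim_mem_outside j z) (rim_mem_outside j w) h))

theorem rim_eq_rim {i j : Fin n} {z w : Circle} (h : rim i z = rim j w) : i = j := by
  by_contra hne
  rw [rim_eq, rim_eq] at h
  have h := ofPlane_injOn (rim_mem_outside i z) (rim_mem_outside j w) h
  have hw : ‖(w : ℂ)‖ = 1 := Circle.norm_coe w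
  have hz : ‖(z : ℂ)‖ = 1 := Circle.norm_coe z
  have h0 : ((i : ℤ) - (j : ℤ)) ≠ 0 := fun e => hne (Fin.ext (by omega))
  have h1 : (1 : ℝ) ≤ ‖(((i : ℤ) - (j : ℤ) : ℤ) : ℂ)‖ := by
    rw [Complex.norm_intCast]
    exact_mod_cast Int.one_le_abs h0
  have h2 : 3 * (((i : ℤ) - (j : ℤ) : ℤ) : ℂ) = w - z := by
    push_cast
    linear_combination h
  have h3 := norm_sub_le (w : ℂ) z
  rw [← h2, norm_mul, hw, hz] at h3
  norm_num at h3 h1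
  linarith

theorem rim_mem_half (j : Fin n) (z : Circle) (s : ℝ) :
    rim j z ∈ half s ↔ 0 ≤ s * (z : ℂ).im := by
  rw [rim_eq, ofPlane_mem_half (rim_mem_outside j z)]
  simp

/-- A path from infinity to the boundary of a hole. -/
noncomputable def tail (j : Fin n) : Path infty (rimMap j 1) :=
  (exists_path_half (s := 1) (by norm_num) ((rim_mem_half j 1 1).2 (by simp))).choose

theorem tail_mem (j : Fin n) (t : I) : tail j t ∈ half 1 :=
  (exists_path_half (s := 1) (by norm_num) ((rim_mem_half j 1 1).2 (by simp))).choose_spec t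

/-- The loop around a hole. -/
noncomputable def holeLoop (j : Fin n) : Path (infty : HoledSphere n) infty :=
  ((tail j).trans (Circle.loop.map (rimMap j).continuous)).trans (tail j).symm

theorem upper_mem (j : Fin n) (t : I) :
    (Circle.upperPath.map (rimMap j).continuous) t ∈ half 1 := by
  change rim j (Circle.upperPath t) ∈ half 1
  rw [rim_mem_half, one_mul]
  change 0 ≤ ((Circle.exp (Real.pi * t) : Circle) : ℂ).im
  rw [Circle.coe_exp, Complex.exp_ofReal_mul_I_im]
  exact Real.sin_nonneg_of_nonneg_of_le_pi (mul_nonneg Real.pi_pos.le t.2.1)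
    (mul_le_of_le_one_right Real.pi_pos.le t.2.2)

theorem lower_mem (j : Fin n) (t : I) :
    (Circle.lowerPath.map (rimMap j).continuous) t ∈ half (-1) := by
  change rim j (Circle.lowerPath t) ∈ half (-1)
  rw [rim_mem_half]
  change 0 ≤ -1 * ((Circle.exp (Real.pi * (1 + t)) : Circle) : ℂ).im
  rw [Circle.coe_exp, Complex.exp_ofReal_mul_I_im, mul_add, mul_one, add_comm, Real.sin_add_pi]
  have := Real.sin_nonneg_of_nonneg_of_le_pi (mul_nonneg Real.pi_pos.le t.2.1)
    (mul_le_of_le_one_right Real.pi_pos.le t.2.2)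
  linarith

theorem rim_one (j : Fin n) : rim j 1 = ofPlane ((3 * (j : ℕ) + 1 : ℝ) : ℂ) := by
  rw [rim_eq]; simp

theorem rim_exp_pi (j : Fin n) : rim j (Circle.exp Real.pi) = ofPlane ((3 * (j : ℕ) - 1 : ℝ) : ℂ) := by
  rw [rim_eq, Circle.coe_exp, Complex.exp_pi_mul_I]
  push_cast
  rw [sub_eq_add_neg]

/-- The `k`-th of the gaps that the holes leave on the real line. -/
def gap (n k : ℕ) : Set ℝ := {x | (k ≠ 0 → 3 * (k : ℝ) - 2 ≤ x) ∧ (k < n → x ≤ 3 * (k : ℝ) - 1)}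

theorem gap_outside {k : ℕ} {x : ℝ} (h : x ∈ gap n k) (hk : k ≤ n) : (x : ℂ) ∈ outside n := by
  intro i
  rw [show (x : ℂ) - 3 * (i : ℕ) = ((x - 3 * (i : ℕ) : ℝ) : ℂ) by push_cast; rfl, Complex.norm_real,
    Real.norm_eq_abs]
  rcases lt_or_ge (i : ℕ) k with hik | hik
  · have h1 := h.1 (by omega)
    have : ((i : ℕ) : ℝ) + 1 ≤ k := by exact_mod_cast hik
    rw [le_abs]
    left; linarith
  · have h1 := h.2 (by omega)
    have : (k : ℝ) ≤ (i : ℕ) := by exact_mod_cast hik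
    rw [le_abs]
    right; linarith

theorem exists_gap {x : ℝ} (hx : (x : ℂ) ∈ outside n) : ∃ k ≤ n, x ∈ gap n k := by
  classical
  -- The gap is indexed by the first hole to the right of `x`, or by `n` if there is none.
  -- Minimality puts `x` to the right of the preceding hole.
  have hex : ∃ k, n ≤ k ∨ x ≤ 3 * (k : ℝ) - 1 := ⟨n, Or.inl le_rfl⟩
  refine ⟨Nat.find hex, Nat.find_min' hex (Or.inl le_rfl), fun h0 => ?_, fun h => ?_⟩
  · obtain ⟨m, hm⟩ := Nat.exists_eq_succ_of_ne_zero h0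
    have hlt := Nat.find_min hex (m := m) (by omega)
    push Not at hlt
    have := hx ⟨m, hlt.1⟩
    rw [show (x : ℂ) - 3 * ((⟨m, hlt.1⟩ : Fin n) : ℕ) = ((x - 3 * m : ℝ) : ℂ) by push_cast; rfl,
      Complex.norm_real, Real.norm_eq_abs, le_abs] at this
    rw [hm]
    push_cast
    rcases this with h | h <;> linarith [hlt.2]
  · exact (Nat.find_spec hex).resolve_left h.not_ge

theorem gap_convex (k : ℕ) : Convex ℝ (gap n k) := by
  have : (gap n k).OrdConnected := ⟨fun x hx y hy z hz =>
    ⟨fun h => (hx.1 h).trans hz.1, fun h => hz.2.trans (hy.2 h)⟩⟩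
  exact this.convex

theorem sub_one_mem_gap (k : ℕ) : (3 * k - 1 : ℝ) ∈ gap n k :=
  ⟨fun _ => by linarith, fun _ => le_rfl⟩

theorem add_one_mem_gap (k : ℕ) : (3 * k + 1 : ℝ) ∈ gap n (k + 1) := by
  constructor <;> intro <;> push_cast <;> linarith

theorem real_mem_half {x : ℝ} (hx : (x : ℂ) ∈ outside n) (s : ℝ) :
    (ofPlane x : HoledSphere n) ∈ half s := by
  rw [ofPlane_mem_half hx]
  simp

theorem exists_path_gap {k : ℕ} (hk : k ≤ n) {x y : ℝ} (hx : x ∈ gap n k) (hy : y ∈ gap n k) :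
    ∃ γ : Path (ofPlane x : HoledSphere n) (ofPlane y), ∀ s t, γ t ∈ half s := by
  have hseg (t : I) : Path.segment x y t ∈ gap n k := by
    have := gap_convex (n := n) k |>.segment_subset hx hy
    apply this
    rw [segment_eq_image_lineMap]
    exact ⟨t, t.2, rfl⟩
  refine ⟨⟨⟨fun t => ofPlane (Path.segment x y t : ℝ), ?_⟩, by simp, by simp⟩, fun s t =>
    real_mem_half (gap_outside (hseg t) hk) s⟩
  exact continuousOn_ofPlane.comp_continuous (by fun_prop) fun t => gap_outside (hseg t) hk

/-- A path along the real axis from infinity. -/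
theorem exists_path_ray {ε : ℝ} (h1 : ε ^ 2 = 1) {x : ℝ}
    (hx : ∀ r : ℝ, 0 ≤ r → ((x + ε * r : ℝ) : ℂ) ∈ outside n) :
    ∃ γ : Path (infty : HoledSphere n) (ofPlane x), ∀ s t, γ t ∈ half s := by
  classical
  let f : I → HoledSphere n := fun t =>
    if t = 0 then infty else ofPlane ((x + ε * ((1 - t) / t) : ℝ) : ℂ)
  have hε : |ε| = 1 := by
    have := sq_abs ε
    rw [h1] at this
    nlinarith [abs_nonneg ε]
  have hf : Continuous f := by
    rw [continuous_iff_continuousAt]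
    intro t
    by_cases ht : t = 0
    · subst ht
      have hf0 : f 0 = infty := if_pos rfl
      rw [ContinuousAt, hf0]
      refine tendsto_infty fun R => ?_
      -- The additional `|x|` compensates for the starting point of the ray: the modulus is at least
      -- `(1 - t) / t - |x|`.
      have hc : ContinuousAt (fun p : I => (R + |x| + 1) * (p : ℝ) + p) 0 := by fun_prop
      have h := hc.preimage_mem_nhds (Iio_mem_nhds (show _ < (1 : ℝ) by simp))
      filter_upwards [h] with t hp hne
      rw [mem_preimage, mem_Iio] at hp
      have ht : t ≠ 0 := fun e => hne (if_pos e)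
      have hpos : 0 < (t : ℝ) := unitInterval.pos_iff_ne_zero.2 ht
      rw [show f t = _ from if_neg ht, toPlane_ofPlane (hx _ (ratio_nonneg t)), Complex.norm_real,
        Real.norm_eq_abs]
      have hr : R + |x| < (1 - t) / t := by
        rw [lt_div_iff₀ hpos]
        linarith
      have h2 := abs_sub_abs_le_abs_sub (ε * ((1 - (t : ℝ)) / t)) (-x)
      rw [abs_mul, hε, one_mul, abs_of_nonneg (ratio_nonneg t), abs_neg, sub_neg_eq_add, add_comm _ x]
        at h2
      linarith
    · have key : ContinuousOn (fun t : I => (ofPlane ((x + ε * ((1 - t) / t) : ℝ) : ℂ) : HoledSphere n))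
          {t | t ≠ 0} := by
        refine continuousOn_ofPlane.comp (Complex.continuous_ofReal.comp_continuousOn
          (continuousOn_const.add (continuousOn_const.mul (ContinuousOn.div (by fun_prop)
            (by fun_prop) fun t ht e => ht (Subtype.ext e))))) fun t _ => hx _ (ratio_nonneg t)
      exact (key.congr fun t ht => if_neg ht).continuousAt (isOpen_ne.mem_nhds ht)
  refine ⟨⟨⟨f, hf⟩, if_pos rfl, ?_⟩, fun s t => ?_⟩
  · change f 1 = _
    rw [show f 1 = _ from if_neg one_ne_zero]
    simp
  · change f t ∈ _
    by_cases ht : t = 0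
    · rw [show f t = _ from if_pos ht]
      exact infty_mem_half s
    · rw [show f t = _ from if_neg ht]
      exact real_mem_half (hx _ (ratio_nonneg t)) s

theorem exists_path_ray_left {x : ℝ} (hx : x ∈ gap n 0) :
    ∃ γ : Path (infty : HoledSphere n) (ofPlane x), ∀ s t, γ t ∈ half s := by
  refine exists_path_ray (ε := -1) (by norm_num) fun r hr => gap_outside (k := 0) ⟨by simp, fun h => ?_⟩
    (Nat.zero_le _)
  have := hx.2 h
  linarith

theorem exists_path_ray_right {x : ℝ} (hx : x ∈ gap n n) :
    ∃ γ : Path (infty : HoledSphere n) (ofPlane x), ∀ s t, γ t ∈ half s := by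
  refine exists_path_ray (ε := 1) (by norm_num) fun r hr => gap_outside (k := n) ⟨fun h => ?_, by simp⟩
    le_rfl
  have := hx.1 h
  linarith

section Relation

variable {G : Type*} [Group G] (F F' : Holonomy (HoledSphere n) G)

theorem val_holeLoop (j : Fin n) : F.val (holeLoop j) =
    F.val (tail j) * (F.val (Circle.upperPath.map (rimMap j).continuous) *
      F.val (Circle.lowerPath.map (rimMap j).continuous)) * (F.val (tail j))⁻¹ := by
  rw [holeLoop, F.val_trans, F.val_trans, F.val_symm, Circle.loop, Path.map_trans, F.val_trans]

/-- The loops around the holes multiply to the trivial element. -/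
theorem prod_holeLoop : (List.ofFn fun j : Fin n => F.val (holeLoop j)).prod = 1 := by
  obtain ⟨u, hu⟩ := F.exists_coboundary (contractsTo_half (n := n) (s := 1) (by norm_num))
  obtain ⟨v, hv⟩ := F.exists_coboundary (contractsTo_half (n := n) (s := -1) (by norm_num))
  -- The ratio of the two primitives is constant along every path that lies in both halves, hence on
  -- each gap.
  let δ : HoledSphere n → G := fun x => u x * (v x)⁻¹
  have hδ {x y : HoledSphere n} (γ : Path x y) (h : ∀ s t, γ t ∈ half s) : δ x = δ y := by
    have := (hu γ (h 1)).symm.trans (hv γ (h (-1)))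
    have hy : u y = u x * (v x)⁻¹ * v y := by rw [mul_assoc, ← this]; group
    simp only [δ]
    rw [hy]; group
  -- The ratio on the `k`-th gap, read at the left end of the `k`-th hole. The last gap has no hole
  -- to its right and is read at infinity, which it reaches.
  let D : ℕ → G := fun k => if k < n then δ (ofPlane ((3 * k - 1 : ℝ) : ℂ)) else δ infty
  have hD : ∀ j : Fin n, δ (rimMap j 1) = D (j + 1) := fun j => by
    rw [rimMap_apply, rim_one]
    simp only [D]
    split_ifs with h
    · obtain ⟨γ, hγ⟩ := exists_path_gap (n := n) h.le (add_one_mem_gap j) (sub_one_mem_gap _)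
      exact hδ γ hγ
    · have hn : (j : ℕ) + 1 = n := by omega
      obtain ⟨γ, hγ⟩ := exists_path_ray_right (n := n) (x := 3 * (j : ℕ) + 1)
        (by simpa only [hn] using add_one_mem_gap (n := n) j)
      exact (hδ γ hγ).symm
  -- The loop runs through the upper half to the left end of the hole and back through the lower
  -- half to its right end. It picks up the change of the ratio from gap `j` to gap `j + 1`.
  have hc : ∀ j : Fin n, F.val (holeLoop j) = (u infty)⁻¹ * (D j * (D (j + 1))⁻¹) * u infty := by
    intro j
    rw [val_holeLoop, hu _ (tail_mem j), hu _ (upper_mem j), hv _ (lower_mem j), ← hD j,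
      show D j = δ (rimMap j (Circle.exp Real.pi)) from by rw [rimMap_apply, rim_exp_pi]; exact if_pos j.2]
    simp only [δ]
    group
  simp_rw [hc]
  rw [List.prod_ofFn_conj (fun j : Fin n => D j * (D (j + 1))⁻¹), List.prod_ofFn_telescope]
  -- The first gap reaches infinity too, which closes the telescope. If there are no holes, the
  -- definition of `D` says so directly.
  have h0 : D 0 = δ infty := by
    simp only [D]
    split_ifs with h
    · obtain ⟨γ, hγ⟩ := exists_path_ray_left (n := n) (sub_one_mem_gap 0)
      exact (hδ γ hγ).symm
    · rfl
  have hn : D n = δ infty := if_neg (lt_irrefl n)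
  rw [h0, hn]
  group

end Relation

end CompactSurface.HoledSphere

end

/-! ### Classification of the functors on the sphere with holes -/

section

open Set Topology Filter
open scoped unitInterval

set_option linter.unusedSectionVars false

namespace CompactSurface.HoledSphere

variable {n : ℕ} {G : Type*} [Group G]

theorem isOpen_finite {U : Set ℂ} (hU : IsOpen U) :
    IsOpen {x : HoledSphere n | x ≠ infty ∧ toPlane x ∈ U} :=
  continuousOn_toPlane.isOpen_inter_preimage isOpen_ne_infty hU

theorem isOpen_norm_gt (R : ℝ) : IsOpen {x : HoledSphere n | x = infty ∨ R < ‖toPlane x‖} := by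
  rw [isOpen_iff_mem_nhds]
  intro x hx
  by_cases hxi : x = infty
  · subst hxi
    filter_upwards [eventually_norm R] with y hy
    exact or_iff_not_imp_left.2 hy
  · refine mem_of_superset ((isOpen_finite (isOpen_lt continuous_const continuous_norm)).mem_nhds
      ⟨hxi, hx.resolve_left hxi⟩) fun y hy => Or.inr hy.2

/-- Any elements with trivial product are the values on the loops around the holes. -/
theorem exists_holonomy (c : Fin n → G) (hc : (List.ofFn c).prod = 1) :
    ∃ F : Holonomy (HoledSphere n) G, ∀ j, F.val (holeLoop j) = c j := by
  classical
  -- The partial product over the holes with centre to the left of `a`. It is `1` to the left of all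
  -- holes, and by `hc` also to the right of them.
  let Γ : ℝ → G := fun a => (List.ofFn fun i : Fin n => if 3 * ((i : ℕ) : ℝ) < a then c i else 1).prod
  have hΓ0 (a : ℝ) (ha : a ≤ 0) : Γ a = 1 := List.prod_ofFn_one fun i => if_neg (by
    have : (0 : ℝ) ≤ (i : ℕ) := Nat.cast_nonneg _
    linarith)
  have hΓn (a : ℝ) (ha : 3 * (n : ℝ) < a) : Γ a = 1 := by
    rw [← hc]
    simp only [Γ]
    congr 2
    funext i
    have : ((i : ℕ) : ℝ) < n := by exact_mod_cast i.2
    rw [if_pos (by linarith)]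
  -- Large enough that a point of the strip `|im| < 1 / 2` beyond this radius lies to the left or to
  -- the right of all holes, where `Γ` is `1` and agrees with the value of `v` near infinity.
  let R : ℝ := 3 * n + 5
  let v : HoledSphere n → G := fun x => if x = infty ∨ R < ‖toPlane x‖ then 1 else Γ (toPlane x).re
  -- The two halves, thickened by `1 / 2` and by a neighbourhood of infinity so as to become open.
  let U : ℝ → Set (HoledSphere n) := fun s =>
    {x | x ≠ infty ∧ toPlane x ∈ {z : ℂ | -(1 / 2) < s * z.im}} ∪ {x | x = infty ∨ R < ‖toPlane x‖}
  have hU : ∀ s, IsOpen (U s) := fun s =>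
    (isOpen_finite (isOpen_lt continuous_const (by fun_prop))).union (isOpen_norm_gt R)
  have hhalf : ∀ s x, x ∈ half s → x ∈ U s := fun s x hx => by
    by_cases h : x = infty
    · exact Or.inr (Or.inl h)
    · refine Or.inl ⟨h, ?_⟩
      have : 0 ≤ s * (toPlane x).im := hx
      rw [mem_ofPred_eq]
      linarith
  have hloc : ∀ x ∈ U 1 ∩ U (-1), ∀ᶠ y in 𝓝 x, v y = v x := by
    rintro x ⟨h1, h2⟩
    by_cases hx : x = infty ∨ R < ‖toPlane x‖
    · filter_upwards [(isOpen_norm_gt R).mem_nhds hx] with y hy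
      simp only [v]
      rw [if_pos hx, if_pos hy]
    · have h1 := (h1.resolve_right hx)
      have h2 := (h2.resolve_right hx)
      have hxi := h1.1
      have h1 : -(1 / 2) < 1 * (toPlane x).im := h1.2
      have h2 : -(1 / 2) < -1 * (toPlane x).im := h2.2
      have hvx : v x = Γ (toPlane x).re := if_neg hx
      push Not at hx
      have hnhds := (isOpen_finite (n := n) ((isOpen_lt (f := fun z : ℂ => |z.im|) (g := fun _ => 1 / 2)
        (by fun_prop) continuous_const).inter (isOpen_lt (f := fun z : ℂ => |z.re - (toPlane x).re|)
        (g := fun _ => 1 / 2) (by fun_prop) continuous_const))).mem_nhds (x := x)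
        ⟨hxi, by rw [mem_ofPred_eq, abs_lt]; constructor <;> linarith, by simp⟩
      filter_upwards [hnhds] with y hy
      have hre : |(toPlane y).re - (toPlane x).re| < 1 / 2 := hy.2.2
      have hre := abs_lt.1 hre
      have him : |(toPlane y).im| < 1 / 2 := hy.2.1
      -- A point of the strip outside a hole has horizontal distance at least `√3 / 2` from its
      -- centre. A horizontal move of less than `1 / 2` therefore does not pass the centre.
      have hΓ : Γ (toPlane y).re = Γ (toPlane x).re := by
        simp only [Γ]
        congr 2
        funext i
        have h := toPlane_mem hxi i
        have h' := toPlane_mem hy.1 i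
        have hsq : (1 : ℝ) ≤ ‖toPlane x - 3 * (i : ℕ)‖ ^ 2 := one_le_pow₀ h
        have hsq' : (1 : ℝ) ≤ ‖toPlane y - 3 * (i : ℕ)‖ ^ 2 := one_le_pow₀ h'
        simp only [Complex.sq_norm, Complex.normSq_apply] at hsq hsq'
        simp at hsq hsq'
        have him' := abs_lt.1 him
        refine if_congr ⟨fun hlt => ?_, fun hlt => ?_⟩ rfl rfl
        · by_contra hge
          rw [not_lt] at hge
          nlinarith
        · by_contra hge
          rw [not_lt] at hge
          nlinarith
      rw [hvx]
      simp only [v]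
      split_ifs with hy'
      · rw [← hΓ]
        have hn := hy'.resolve_left hy.1
        have hle := Complex.norm_le_abs_re_add_abs_im (toPlane y)
        have hn' : 3 * (n : ℝ) + 4 < |(toPlane y).re| := by
          simp only [R] at hn
          linarith
        have : (0 : ℝ) ≤ n := Nat.cast_nonneg _
        rcases lt_abs.1 hn' with h | h
        · exact (hΓn _ (by linarith)).symm
        · exact (hΓ0 _ (by linarith)).symm
      · exact hΓ
  -- The functor is trivial on the upper half and the coboundary of `v` on the lower one. Around a
  -- hole only the lower arc counts, and it contributes the quotient of consecutive partial
  -- products.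
  let w : Bool → HoledSphere n → G := fun b x => bif b then 1 else v x
  obtain ⟨F, hF⟩ := Holonomy.exists_of_coboundaries
    (c := fun b : Bool => bif b then U 1 else U (-1)) (by rintro (_ | _) <;> exact hU _)
    (fun x => (mem_half_or x).elim (fun h => ⟨true, hhalf _ _ h⟩) (fun h => ⟨false, hhalf _ _ h⟩)) w
    (by
      rintro (_ | _) (_ | _) x hx
      · simp
      · filter_upwards [hloc x hx.symm] with y hy _
        simp [w, hy]
      · filter_upwards [hloc x hx] with y hy _
        simp [w, hy]
      · simp)
  refine ⟨F, fun j => ?_⟩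
  have h1 : F.val (tail j) = 1 := by
    rw [hF true _ fun t => hhalf _ _ (tail_mem j t)]
    simp [w]
  have h2 : F.val (Circle.upperPath.map (rimMap j).continuous) = 1 := by
    rw [hF true _ fun t => hhalf _ _ (upper_mem j t)]
    simp [w]
  have hv {a : ℝ} (ha : (a : ℂ) ∈ outside n) (hb : |a| ≤ R) : v (ofPlane a) = Γ a := by
    simp only [v]
    rw [toPlane_ofPlane ha, if_neg, Complex.ofReal_re]
    rw [Complex.norm_real, Real.norm_eq_abs]
    exact fun h => h.elim (ofPlane_ne_infty ha) hb.not_gt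
  have hj0 : (0 : ℝ) ≤ (j : ℕ) := Nat.cast_nonneg _
  have hjn : ((j : ℕ) : ℝ) + 1 ≤ n := by exact_mod_cast j.2
  rw [val_holeLoop, h1, h2, hF false _ fun t => hhalf _ _ (lower_mem j t)]
  simp only [w, cond_false, rimMap_apply]
  rw [rim_one, rim_exp_pi, hv, hv]
  · have e1 : Γ (3 * (j : ℕ) - 1) = (List.ofFn fun i => if i < j then c i else 1).prod := by
      simp only [Γ]
      congr 2
      funext i
      refine if_congr ⟨fun h => ?_, fun h => ?_⟩ rfl rfl
      · have : ((i : ℕ) : ℝ) < (j : ℕ) := by linarith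
        exact_mod_cast this
      · have : ((i : ℕ) : ℝ) + 1 ≤ (j : ℕ) := by exact_mod_cast h
        linarith
    have e2 : Γ (3 * (j : ℕ) + 1) = (List.ofFn fun i => if i ≤ j then c i else 1).prod := by
      simp only [Γ]
      congr 2
      funext i
      refine if_congr ⟨fun h => ?_, fun h => ?_⟩ rfl rfl
      · have : ((i : ℕ) : ℝ) < (j : ℕ) + 1 := by linarith
        exact Fin.le_def.2 (Nat.lt_succ_iff.1 (by exact_mod_cast this))
      · have : ((i : ℕ) : ℝ) ≤ (j : ℕ) := by exact_mod_cast h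
        linarith
    rw [e1, e2, List.prod_ofFn_if_lt_succ]
    group
  · exact gap_outside (add_one_mem_gap j) j.2
  · rw [abs_le]
    constructor <;> simp only [R] <;> linarith
  · exact gap_outside (sub_one_mem_gap j) j.2.le
  · rw [abs_le]
    constructor <;> simp only [R] <;> linarith

theorem eq_infty_or_real {x : HoledSphere n} (h1 : x ∈ half 1) (h2 : x ∈ half (-1)) :
    x = infty ∨ ∃ a : ℝ, (a : ℂ) ∈ outside n ∧ x = ofPlane a := by
  refine or_iff_not_imp_left.2 fun hx => ⟨(toPlane x).re, ?_⟩
  have h1 : 0 ≤ 1 * (toPlane x).im := h1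
  have h2 : 0 ≤ -1 * (toPlane x).im := h2
  have h : (((toPlane x).re : ℝ) : ℂ) = toPlane x := Complex.ext (by simp) (by simp; linarith)
  rw [h]
  exact ⟨toPlane_mem hx, (ofPlane_toPlane hx).symm⟩

variable (F F' : Holonomy (HoledSphere n) G)

/-- Equality on the real line spreads from infinity through the leftmost gap and on from gap to gap.
A hole is passed by going around its boundary: naturality of `e` on the upper arc, of `e'` on the
lower one, and the equality of `F` and `F'` on the loop around it. -/
theorem eq_of_natAlong_halves {e e' : HoledSphere n → G}
    (hF : ∀ j, F.val (holeLoop j) = F'.val (holeLoop j)) (h0 : e infty = 1) (h0' : e' infty = 1)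
    (he : ∀ ⦃x y⦄ (γ : Path x y), (∀ t, γ t ∈ half 1) → F.NatAlong F' e γ)
    (he' : ∀ ⦃x y⦄ (γ : Path x y), (∀ t, γ t ∈ half (-1)) → F.NatAlong F' e' γ)
    {x : HoledSphere n} (h1 : x ∈ half 1) (h2 : x ∈ half (-1)) : e x = e' x := by
  have step {x y : HoledSphere n} (γ : Path x y) (h : ∀ s t, γ t ∈ half s) (hx : e x = e' x) :
      e y = e' y := (he γ (h 1)).eq_of_eq (he' γ (h (-1))) hx
  have hgap : ∀ k ≤ n, ∀ a ∈ gap n k, e (ofPlane a) = e' (ofPlane a) := by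
    intro k
    induction k with
    | zero =>
      intro _ a ha
      obtain ⟨γ, hγ⟩ := exists_path_ray_left ha
      exact step γ hγ (h0.trans h0'.symm)
    | succ k ih =>
      intro hk a ha
      let j : Fin n := ⟨k, hk⟩
      have hj : e (rimMap j (Circle.exp Real.pi)) = e' (rimMap j (Circle.exp Real.pi)) := by
        rw [rimMap_apply, rim_exp_pi]
        exact ih (by omega) _ (sub_one_mem_gap k)
      have hj1 : e (rimMap j 1) = e' (rimMap j 1) := by
        have n1 := he _ (tail_mem j)
        have n2 := he _ (upper_mem j)
        have n3 := he' _ (lower_mem j)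
        have hc := hF j
        rw [val_holeLoop, val_holeLoop] at hc
        unfold Holonomy.NatAlong at n1 n2 n3
        rw [h0, one_mul] at n1
        rw [n1] at hc
        rw [hj] at n2
        have e3 : e' (rimMap j (Circle.exp Real.pi)) =
            F.val (Circle.lowerPath.map (rimMap j).continuous) * e' (rimMap j 1) *
            (F'.val (Circle.lowerPath.map (rimMap j).continuous))⁻¹ := by
          rw [← n3]; group
        rw [e3] at n2
        set A := F.val (Circle.upperPath.map (rimMap j).continuous)
        set B := F.val (Circle.lowerPath.map (rimMap j).continuous)
        set A' := F'.val (Circle.upperPath.map (rimMap j).continuous)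
        set B' := F'.val (Circle.lowerPath.map (rimMap j).continuous)
        set T := F.val (tail j)
        have hA : A * B = e (rimMap j 1) * (A' * B') * (e (rimMap j 1))⁻¹ := by
          have := congr_arg (fun g => T⁻¹ * g * T) hc
          simp only [mul_inv_rev] at this
          calc A * B = T⁻¹ * (T * (A * B) * T⁻¹) * T := by group
            _ = _ := by rw [this]; group
        have h5 : e (rimMap j 1) * (A' * B') = A * B * e' (rimMap j 1) := by
          rw [← mul_assoc, n2]; group
        rw [hA, mul_assoc _ _ (e' _), mul_assoc _ _ (_ * e' _), mul_right_inj] at h5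
        have h6 := mul_left_cancel (h5.symm.trans (mul_one _).symm)
        exact inv_mul_eq_one.1 h6
      obtain ⟨γ, hγ⟩ := exists_path_gap hk (add_one_mem_gap k) ha
      refine step γ hγ ?_
      have h3 := rim_one j
      rw [rimMap_apply, h3] at hj1
      exact hj1
  rcases eq_infty_or_real h1 h2 with rfl | ⟨a, ha, rfl⟩
  · exact h0.trans h0'.symm
  · obtain ⟨k, hk, hak⟩ := exists_gap ha
    exact hgap k hk a hak

theorem outside_of_norm_gt {z : ℂ} (hz : 3 * (n : ℝ) + 1 < ‖z‖) : z ∈ outside n := fun i => by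
  have h := norm_sub_norm_le z (3 * (i : ℕ))
  rw [norm_mul, Complex.norm_natCast, Complex.norm_ofNat] at h
  have : ((i : ℕ) : ℝ) ≤ n := by exact_mod_cast i.2.le
  linarith

section Local

variable {F F'} {e : HoledSphere n → G}
  (he : ∀ s : ℝ, s ^ 2 = 1 → ∀ ⦃x y⦄ (γ : Path x y), (∀ t, γ t ∈ half s) → F.NatAlong F' e γ)
include he

/-- The chart is `1 / z` on a disk. The default value `0` of `toPlane` at infinity fits, since `0⁻¹
= 0` is the centre of the disk. Inversion exchanges the upper and the lower half, so the signs are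
exchanged as well. -/
theorem natAlong_near_infty : ∃ U ∈ 𝓝 (infty : HoledSphere n), ∀ ⦃y z : HoledSphere n⦄ (γ : Path y z),
    (∀ t, γ t ∈ U) → F.NatAlong F' e γ := by
  classical
  have hR : (0 : ℝ) < 3 * n + 1 := by positivity
  refine ⟨_, (isOpen_norm_gt (3 * n + 1)).mem_nhds (Or.inl rfl), fun y z γ hγ => ?_⟩
  have hout : ∀ w ∈ Metric.ball (0 : ℂ) (3 * n + 1 : ℝ)⁻¹, w ≠ 0 → w⁻¹ ∈ outside n := fun w hw h0 => by
    rw [mem_ball_zero_iff] at hw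
    refine outside_of_norm_gt ?_
    rw [norm_inv]
    exact (lt_inv_comm₀ hR (norm_pos_iff.2 h0)).2 hw
  let ψ : ℂ → HoledSphere n := fun w => if w = 0 then infty else ofPlane w⁻¹
  have hψ0 : ψ 0 = infty := if_pos rfl
  refine Holonomy.natAlong_of_chart (convex_ball (0 : ℂ) (3 * n + 1 : ℝ)⁻¹)
    (φ := fun x => (toPlane x)⁻¹) (ψ := ψ) ?_ ?_ ?_ ?_ ?_ ?_ (he (-1) (by norm_num))
    (he 1 (by norm_num)) γ hγ
  · intro x hx
    by_cases hxi : x = infty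
    · subst hxi
      refine ContinuousAt.continuousWithinAt ?_
      rw [Metric.continuousAt_iff']
      intro ε hε
      filter_upwards [eventually_norm ε⁻¹] with x hx
      by_cases hxi : x = infty
      · simpa [hxi] using hε
      · have := hx hxi
        rw [toPlane_infty, inv_zero, dist_zero_right, norm_inv]
        exact (inv_lt_comm₀ hε ((inv_pos.2 hε).trans this)).1 this
    · have h0 : toPlane x ≠ 0 := norm_pos_iff.1 (hR.trans (hx.resolve_left hxi))
      exact ((continuousOn_toPlane.continuousAt (isOpen_ne_infty.mem_nhds hxi)).inv₀
        h0).continuousWithinAt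
  · intro w hw
    refine ContinuousAt.continuousWithinAt ?_
    by_cases h0 : w = 0
    · subst h0
      rw [ContinuousAt, hψ0]
      refine tendsto_infty fun R => ?_
      have hpos : (0 : ℝ) < (|R| + 1)⁻¹ := by positivity
      filter_upwards [Metric.ball_mem_nhds (0 : ℂ) hpos, Metric.isOpen_ball.mem_nhds hw] with w hw1 hw2 hne
      have h0 : w ≠ 0 := fun e => hne (if_pos e)
      rw [show ψ w = _ from if_neg h0, toPlane_ofPlane (hout w hw2 h0), norm_inv]
      rw [mem_ball_zero_iff] at hw1
      have := (lt_inv_comm₀ (by positivity) (norm_pos_iff.2 h0)).2 hw1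
      linarith [le_abs_self R]
    · have hmem : Metric.ball (0 : ℂ) (3 * n + 1 : ℝ)⁻¹ ∩ {w | w ≠ 0} ∈ 𝓝 w :=
        (Metric.isOpen_ball.inter isOpen_ne).mem_nhds ⟨hw, h0⟩
      have key : ContinuousOn (fun w : ℂ => (ofPlane w⁻¹ : HoledSphere n))
          (Metric.ball (0 : ℂ) (3 * n + 1 : ℝ)⁻¹ ∩ {w | w ≠ 0}) :=
        continuousOn_ofPlane.comp (continuousOn_id.inv₀ fun w hw => hw.2)
          fun w hw => hout w hw.1 hw.2
      exact (key.congr fun w hw => if_neg hw.2).continuousAt hmem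
  · intro x hx
    rw [mem_ball_zero_iff, norm_inv]
    by_cases hxi : x = infty
    · simpa [hxi, toPlane_infty] using hR
    · exact inv_strictAnti₀ hR (hx.resolve_left hxi)
  · intro x hx
    by_cases hxi : x = infty
    · simp [hxi, toPlane_infty, ψ]
    · have h0 : toPlane x ≠ 0 := norm_pos_iff.1 (hR.trans (hx.resolve_left hxi))
      rw [show ψ _ = _ from if_neg (inv_ne_zero h0), inv_inv, ofPlane_toPlane hxi]
  · intro w hw him
    by_cases h0 : w = 0
    · rw [h0, hψ0]
      exact infty_mem_half _
    · rw [show ψ w = _ from if_neg h0, ofPlane_mem_half (hout w hw h0), Complex.inv_im]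
      rw [neg_div, neg_mul_neg, one_mul]
      exact div_nonneg him (Complex.normSq_nonneg _)
  · intro w hw him
    by_cases h0 : w = 0
    · rw [h0, hψ0]
      exact infty_mem_half _
    · rw [show ψ w = _ from if_neg h0, ofPlane_mem_half (hout w hw h0), Complex.inv_im, one_mul]
      exact div_nonneg (neg_nonneg.2 him) (Complex.normSq_nonneg _)

theorem natAlong_near_interior {z₀ : ℂ} (hz : ∀ i : Fin n, 1 < ‖z₀ - 3 * (i : ℕ)‖) :
    ∃ U ∈ 𝓝 (ofPlane z₀ : HoledSphere n), ∀ ⦃y z : HoledSphere n⦄ (γ : Path y z),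
    (∀ t, γ t ∈ U) → F.NatAlong F' e γ := by
  have hout : z₀ ∈ outside n := fun i => (hz i).le
  have hopen : IsOpen {z : ℂ | ∀ i : Fin n, 1 < ‖z - 3 * (i : ℕ)‖} := by
    rw [ofPred_forall]
    exact isOpen_iInter_of_finite fun i => isOpen_lt continuous_const (by fun_prop)
  obtain ⟨r, hr, hball⟩ := Metric.isOpen_iff.1 hopen z₀ hz
  have hb : Metric.ball z₀ r ⊆ outside n := fun z hz i => (hball hz i).le
  refine ⟨_, (isOpen_finite (n := n) (Metric.isOpen_ball (x := z₀) (ε := r))).mem_nhds ⟨ofPlane_ne_infty hout, ?_⟩,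
    fun y z γ hγ => ?_⟩
  · rw [toPlane_ofPlane hout]
    exact Metric.mem_ball_self hr
  · exact Holonomy.natAlong_of_chart (convex_ball z₀ r) (continuousOn_toPlane.mono fun x hx => hx.1)
      (continuousOn_ofPlane.mono hb) (fun x hx => hx.2) (fun x hx => ofPlane_toPlane hx.1)
      (fun w hw him => (ofPlane_mem_half (s := 1) (hb hw)).2 (by linarith))
      (fun w hw him => (ofPlane_mem_half (s := -1) (hb hw)).2 (by linarith))
      (he 1 (by norm_num)) (he (-1) (by norm_num)) γ hγ

/-- The exterior of a disk is not convex near its boundary, but the logarithm of `ε (z - 3j)` maps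
it to the half plane `0 ≤ re`, in which there are convex neighbourhoods. For the left end `ε = -1`
the rotation exchanges the halves. -/
theorem natAlong_near_rim (j : Fin n) {ε : ℝ} (hε : ε ^ 2 = 1) :
    ∃ U ∈ 𝓝 (ofPlane (3 * (j : ℕ) + ε : ℂ) : HoledSphere n), ∀ ⦃y z : HoledSphere n⦄ (γ : Path y z),
    (∀ t, γ t ∈ U) → F.NatAlong F' e γ := by
  have hε' : (ε : ℂ) * ε = 1 := by
    rw [← Complex.ofReal_mul, ← sq, hε, Complex.ofReal_one]
  have hεn : ‖(ε : ℂ)‖ = 1 := by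
    have := congr_arg norm hε'
    rw [norm_mul, norm_one] at this
    nlinarith [norm_nonneg (ε : ℂ)]
  have hlog2 : 0 < Real.log 2 := Real.log_pos (by norm_num)
  -- The bound `log 2` keeps `E w` at distance less than `2` from the centre, hence outside the
  -- other holes. The bound `1` on the imaginary part is below `π`, so the sign of the sine is that
  -- of its argument.
  let K : Set ℂ := {w | 0 ≤ w.re ∧ w.re < Real.log 2 ∧ |w.im| < 1}
  have hK : Convex ℝ K := by
    have h1 : Convex ℝ {w : ℂ | 0 ≤ w.re} := convex_halfSpace_re_ge 0
    have h2 : Convex ℝ {w : ℂ | w.re < Real.log 2} := convex_halfSpace_re_lt _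
    have h3 : Convex ℝ {w : ℂ | w.im < 1} := convex_halfSpace_im_lt _
    have h4 : Convex ℝ {w : ℂ | -1 < w.im} := convex_halfSpace_im_gt _
    have : K = {w : ℂ | 0 ≤ w.re} ∩ ({w : ℂ | w.re < Real.log 2} ∩ ({w : ℂ | -1 < w.im} ∩ {w : ℂ | w.im < 1})) := by
      ext w
      simp only [K, mem_inter_iff, mem_ofPred_eq, abs_lt]
    rw [this]
    exact h1.inter (h2.inter (h4.inter h3))
  let L : ℂ → ℂ := fun z => Complex.log (ε * (z - 3 * (j : ℕ)))
  let E : ℂ → ℂ := fun w => 3 * (j : ℕ) + ε * Complex.exp w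
  have hE : ∀ w ∈ K, E w ∈ outside n := by
    rintro w ⟨h0, h2, -⟩ i
    have hn : ‖(ε : ℂ) * Complex.exp w‖ = Real.exp w.re := by rw [norm_mul, hεn, one_mul, Complex.norm_exp]
    have he1 : 1 ≤ Real.exp w.re := Real.one_le_exp h0
    have he2 : Real.exp w.re < 2 := by
      rw [← Real.exp_log (show (0 : ℝ) < 2 by norm_num)]
      exact Real.exp_lt_exp.2 h2
    simp only [E]
    by_cases hij : i = j
    · subst hij
      rw [add_sub_cancel_left, hn]
      exact he1
    · have h0 : ((j : ℤ) - (i : ℤ)) ≠ 0 := fun e => hij (Fin.ext (by omega))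
      have h1 : (1 : ℝ) ≤ ‖(((j : ℤ) - (i : ℤ) : ℤ) : ℂ)‖ := by
        rw [Complex.norm_intCast]
        exact_mod_cast Int.one_le_abs h0
      have h3 := norm_sub_norm_le (3 * (((j : ℤ) - (i : ℤ) : ℤ) : ℂ)) (-(ε * Complex.exp w))
      rw [norm_mul, norm_neg, hn, Complex.norm_ofNat] at h3
      have h4 : 3 * (((j : ℤ) - (i : ℤ) : ℤ) : ℂ) - -(ε * Complex.exp w)
        = 3 * (j : ℕ) + ε * Complex.exp w - 3 * (i : ℕ) := by push_cast; ring
      rw [h4] at h3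
      linarith
  have hEim : ∀ w, (E w).im = ε * (Real.exp w.re * Real.sin w.im) := fun w => by
    simp only [E, Complex.add_im, Complex.mul_im, Complex.exp_im]
    simp
  have hsin : ∀ w ∈ K, 0 ≤ w.im → 0 ≤ Real.sin w.im := fun w hw h =>
    Real.sin_nonneg_of_nonneg_of_le_pi h (by linarith [Real.pi_gt_three, (abs_lt.1 hw.2.2).2])
  have hsin' : ∀ w ∈ K, w.im ≤ 0 → Real.sin w.im ≤ 0 := fun w hw h =>
    Real.sin_nonpos_of_nonpos_of_neg_pi_le h (by linarith [Real.pi_gt_three, (abs_lt.1 hw.2.2).1])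
  let V : Set ℂ := {z | ε * (z - 3 * (j : ℕ)) ∈ Complex.slitPlane} ∩ L ⁻¹' {w | w.re < Real.log 2 ∧ |w.im| < 1}
  have hVopen : IsOpen V := by
    refine ContinuousOn.isOpen_inter_preimage (ContinuousOn.clog (by fun_prop) fun z hz => hz)
      (Complex.isOpen_slitPlane.preimage (by fun_prop)) ?_
    exact (isOpen_lt (f := fun w : ℂ => w.re) (by fun_prop) continuous_const).inter
      (isOpen_lt (f := fun w : ℂ => |w.im|) (by fun_prop) continuous_const)
  have hz0 : (ε : ℂ) * ((3 * (j : ℕ) + ε : ℂ) - 3 * (j : ℕ)) = 1 := by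
    rw [add_sub_cancel_left, hε']
  have hout : (3 * (j : ℕ) + ε : ℂ) ∈ outside n := by
    have := hE 0 ⟨le_rfl, hlog2, by simp⟩
    simpa [E] using this
  have hW : {x : HoledSphere n | x ≠ infty ∧ toPlane x ∈ V} ∈ 𝓝 (ofPlane (3 * (j : ℕ) + ε : ℂ)) := by
    refine (isOpen_finite hVopen).mem_nhds ⟨ofPlane_ne_infty hout, ?_⟩
    rw [toPlane_ofPlane hout]
    refine ⟨?_, ?_⟩
    · rw [mem_ofPred_eq, hz0]
      simp
    · simp only [L, mem_preimage, hz0, mem_ofPred_eq]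
      simpa using hlog2
  refine ⟨_, hW, fun y z γ hγ => ?_⟩
  refine Holonomy.natAlong_of_chart (P := half ε) (Q := half (-ε)) hK (φ := fun x => L (toPlane x))
    (ψ := fun w => ofPlane (E w)) ?_ ?_ ?_ ?_ ?_ ?_ (he ε hε) (he (-ε) (by rw [neg_sq, hε])) γ hγ
  · exact ContinuousOn.clog (continuousOn_const.mul ((continuousOn_toPlane.mono fun x hx => hx.1).sub
      continuousOn_const)) fun x hx => hx.2.1
  · exact continuousOn_ofPlane.comp (by fun_prop) hE
  · rintro x ⟨hx, h1, h2, h3⟩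
    refine ⟨?_, h2, h3⟩
    simp only [L]
    rw [Complex.log_re, norm_mul, hεn, one_mul]
    exact Real.log_nonneg (toPlane_mem hx j)
  · rintro x ⟨hx, h1, h2, h3⟩
    simp only [E, L]
    rw [Complex.exp_log (Complex.slitPlane_ne_zero h1), ← mul_assoc, hε', one_mul, add_sub_cancel,
      ofPlane_toPlane hx]
  · intro w hw him
    rw [ofPlane_mem_half (hE w hw), hEim, ← mul_assoc, ← sq, hε, one_mul]
    exact mul_nonneg (Real.exp_pos _).le (hsin w hw him)
  · intro w hw him
    rw [ofPlane_mem_half (hE w hw), hEim, neg_mul, ← mul_assoc, ← sq, hε, one_mul]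
    exact neg_nonneg.2 (mul_nonpos_of_nonneg_of_nonpos (Real.exp_pos _).le (hsin' w hw him))

/-- The two halves are closed, so locality does not apply to them directly. Points off the real axis
are interior to one half; at infinity, at interior points of the surface, and at the two real points
of each boundary circle a convex chart joins the halves. -/
theorem natAlong_of_halves {x y : HoledSphere n} (γ : Path x y) : F.NatAlong F' e γ := by
  refine Holonomy.natAlong_of_nhds (fun x => ?_) γ
  rcases eq_infty_or x with rfl | ⟨z, hz, rfl⟩
  · exact natAlong_near_infty he
  by_cases hint : ∀ i : Fin n, 1 < ‖z - 3 * (i : ℕ)‖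
  · exact natAlong_near_interior he hint
  push Not at hint
  obtain ⟨j, hj⟩ := hint
  have hj : ‖z - 3 * (j : ℕ)‖ = 1 := le_antisymm hj (hz j)
  have hside {s : ℝ} (hs : s ^ 2 = 1) (h : 0 < s * z.im) : ∃ U ∈ 𝓝 (ofPlane z : HoledSphere n),
      ∀ ⦃y z : HoledSphere n⦄ (γ : Path y z), (∀ t, γ t ∈ U) → F.NatAlong F' e γ := by
    refine ⟨_, (isOpen_finite (n := n) (U := {z | 0 < s * z.im}) (isOpen_lt continuous_const
      (by fun_prop))).mem_nhds ⟨ofPlane_ne_infty hz, ?_⟩, fun y z γ hγ => he s hs γ fun t => le_of_lt (show 0 < s * (toPlane (γ t)).im from (hγ t).2)⟩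
    rwa [toPlane_ofPlane hz]
  rcases lt_trichotomy z.im 0 with h | h | h
  · exact hside (s := -1) (by norm_num) (by linarith)
  · have him : (z - 3 * (j : ℕ)).im = 0 := by simp [h]
    have hre : z = 3 * (j : ℕ) + ((z - 3 * (j : ℕ)).re : ℝ) := by
      rw [show (((z - 3 * (j : ℕ)).re : ℝ) : ℂ) = z - 3 * (j : ℕ) from
        Complex.ext (by simp) (by rw [him]; simp)]
      ring
    have hsq : (z - 3 * (j : ℕ)).re ^ 2 = 1 := by
      have := Complex.sq_norm (z - 3 * (j : ℕ))
      rw [hj, Complex.normSq_apply, him] at this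
      linarith
    rw [hre]
    exact natAlong_near_rim he j hsq
  · exact hside (s := 1) (by norm_num) (by linarith)

end Local

/-- Functors that agree on the loops around the holes are naturally isomorphic. -/
theorem exists_natAlong (hF : ∀ j, F.val (holeLoop j) = F'.val (holeLoop j)) :
    ∃ e : HoledSphere n → G, e infty = 1 ∧ ∀ ⦃x y⦄ (γ : Path x y), F.NatAlong F' e γ := by
  classical
  obtain ⟨e₁, h1, hn1⟩ := Holonomy.exists_natAlong (contractsTo_half (n := n) (s := 1) (by norm_num))
    F F' infty 1
  obtain ⟨e₂, h2, hn2⟩ := Holonomy.exists_natAlong (contractsTo_half (n := n) (s := -1) (by norm_num))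
    F F' infty 1
  let e : HoledSphere n → G := fun x => if x ∈ half 1 then e₁ x else e₂ x
  have he2 : ∀ x ∈ half (-1), e₂ x = e x := fun x hx => by
    simp only [e]
    split_ifs with h
    · exact (eq_of_natAlong_halves F F' hF h1 h2 hn1 hn2 h hx).symm
    · rfl
  have he1 : ∀ x ∈ half 1, e₁ x = e x := fun x hx => (if_pos hx).symm
  refine ⟨e, (he1 _ (infty_mem_half 1)).symm.trans h1, fun x y γ => natAlong_of_halves ?_ γ⟩
  intro s hs x y γ hγ
  have hs' : s = 1 ∨ s = -1 := by
    have : (s - 1) * (s + 1) = 0 := by linear_combination hs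
    rcases mul_eq_zero.1 this with h | h
    · exact Or.inl (by linarith)
    · exact Or.inr (by linarith)
  rcases hs' with rfl | rfl
  · exact (hn1 γ hγ).congr_left (he1 _ (by simpa using hγ 0)) (he1 _ (by simpa using hγ 1))
  · exact (hn2 γ hγ).congr_left (he2 _ (by simpa using hγ 0)) (he2 _ (by simpa using hγ 1))

end CompactSurface.HoledSphere

end

/-! ### The handle: plane coordinates and contractible charts -/

section

open Set Topology Filter
open scoped unitInterval

set_option linter.unusedSectionVars false

namespace AddCircle

/-- The representative in `[a, a + 1)`. -/
noncomputable def rep (a : ℝ) (p : AddCircle (1 : ℝ)) : ℝ := equivIco 1 a p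

theorem coe_rep (a : ℝ) (p : AddCircle (1 : ℝ)) : ((rep a p : ℝ) : AddCircle (1 : ℝ)) = p :=
  (equivIco 1 a).symm_apply_apply p

theorem rep_mem (a : ℝ) (p : AddCircle (1 : ℝ)) : rep a p ∈ Ico a (a + 1) := (equivIco 1 a p).2

theorem rep_coe {a x : ℝ} (hx : x ∈ Ico a (a + 1)) : rep a (x : AddCircle (1 : ℝ)) = x := by
  rw [rep, equivIco_coe_eq hx]

theorem lt_rep {a : ℝ} {p : AddCircle (1 : ℝ)} (hp : p ≠ a) : a < rep a p :=
  (rep_mem a p).1.lt_of_ne fun e => hp (by rw [← coe_rep a p, ← e])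

theorem continuousAt_rep {a : ℝ} {p : AddCircle (1 : ℝ)} (hp : p ≠ a) : ContinuousAt (rep a) p :=
  continuous_subtype_val.continuousAt.comp (continuousAt_equivIco 1 a hp)

theorem norm_coe_of_abs_le {x : ℝ} (hx : |x| ≤ 1 / 2) : ‖(x : AddCircle (1 : ℝ))‖ = |x| :=
  (norm_coe_eq_abs_iff (1 : ℝ) one_ne_zero).2 (by simpa using hx)

theorem norm_coe_of_mem {x : ℝ} (hx : x ∈ Icc (0 : ℝ) 1) :
    ‖(x : AddCircle (1 : ℝ))‖ = 1 / 2 - |x - 1 / 2| := by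
  rcases le_total x (1 / 2) with h | h
  · rw [norm_coe_of_abs_le (by rw [abs_of_nonneg hx.1]; exact h), abs_of_nonneg hx.1,
      abs_of_nonpos (by linarith)]
    ring
  · have e : (x : AddCircle (1 : ℝ)) = ((x - 1 : ℝ) : AddCircle (1 : ℝ)) := by
      rw [AddCircle.coe_sub, AddCircle.coe_period, sub_zero]
    rw [e, norm_coe_of_abs_le (by rw [abs_le]; constructor <;> linarith [hx.2]),
      abs_of_nonpos (by linarith [hx.2]), abs_of_nonneg (by linarith)]
    ring

theorem coe_eq_coe_of_mem {a x y : ℝ} (hx : x ∈ Ico a (a + 1)) (hy : y ∈ Ico a (a + 1))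
    (h : (x : AddCircle (1 : ℝ)) = y) : x = y := by
  rw [← rep_coe hx, h, rep_coe hy]

/-- The norm does not decrease when the representative is scaled towards `1 / 2`. -/
theorem norm_le_norm_scale {x s : ℝ} (hx : x ∈ Icc (0 : ℝ) 1) (hs : s ∈ Icc (0 : ℝ) 1) :
    1 / 2 + s * (x - 1 / 2) ∈ Icc (0 : ℝ) 1 ∧
    ‖(x : AddCircle (1 : ℝ))‖ ≤ ‖((1 / 2 + s * (x - 1 / 2) : ℝ) : AddCircle (1 : ℝ))‖ := by
  have hm : 1 / 2 + s * (x - 1 / 2) ∈ Icc (0 : ℝ) 1 := by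
    constructor <;> nlinarith [hx.1, hx.2, hs.1, hs.2]
  refine ⟨hm, ?_⟩
  rw [norm_coe_of_mem hx, norm_coe_of_mem hm, add_sub_cancel_left, abs_mul, abs_of_nonneg hs.1]
  nlinarith [abs_nonneg (x - 1 / 2), hs.2]

end AddCircle

namespace CompactSurface.Handle

open AddCircle

/-- The inclusion in the torus. -/
def val (p : Handle) : AddCircle (1 : ℝ) × AddCircle (1 : ℝ) := p.1

theorem val_injective : Function.Injective val := Subtype.val_injective

theorem isInducing_val : IsInducing val := IsInducing.subtypeVal

theorem continuous_val : Continuous val := isInducing_val.continuous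

/-- The preimage of the handle in the plane. -/
def domain : Set (ℝ × ℝ) :=
  {v | (1 / 4 : ℝ) ^ 2 ≤ ‖(v.1 : AddCircle (1 : ℝ))‖ ^ 2 + ‖(v.2 : AddCircle (1 : ℝ))‖ ^ 2}

/-- A deformation stays in the handle as soon as it does not bring either coordinate closer to `ℤ`;
all contractions below are of this kind or stay in a strip where one coordinate is far from `ℤ`. -/
theorem mem_domain_of_le {v w : ℝ × ℝ} (hv : v ∈ domain)
    (h1 : ‖(v.1 : AddCircle (1 : ℝ))‖ ≤ ‖(w.1 : AddCircle (1 : ℝ))‖)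
    (h2 : ‖(v.2 : AddCircle (1 : ℝ))‖ ≤ ‖(w.2 : AddCircle (1 : ℝ))‖) : w ∈ domain :=
  (show (1 / 4 : ℝ) ^ 2 ≤ _ from hv).trans (add_le_add (pow_le_pow_left₀ (norm_nonneg _) h1 2)
    (pow_le_pow_left₀ (norm_nonneg _) h2 2))

theorem mem_domain_left {v : ℝ × ℝ} (h : 1 / 4 ≤ ‖(v.1 : AddCircle (1 : ℝ))‖) : v ∈ domain := by
  have := pow_le_pow_left₀ (by norm_num) h 2
  exact this.trans (le_add_of_nonneg_right (sq_nonneg _))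

theorem mem_domain_right {v : ℝ × ℝ} (h : 1 / 4 ≤ ‖(v.2 : AddCircle (1 : ℝ))‖) : v ∈ domain := by
  have := pow_le_pow_left₀ (by norm_num) h 2
  exact this.trans (le_add_of_nonneg_left (sq_nonneg _))

theorem exists_val_eq {v : ℝ × ℝ} (h : v ∈ domain) : ∃ p : Handle, p.val = (↑v.1, ↑v.2) :=
  ⟨⟨(↑v.1, ↑v.2), h⟩, rfl⟩

open Classical in
/-- The projection from the plane. -/
noncomputable def plane (v : ℝ × ℝ) : Handle :=
  if h : v ∈ domain then (exists_val_eq h).choose else rim 1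

theorem val_plane {v : ℝ × ℝ} (h : v ∈ domain) : (plane v).val = (↑v.1, ↑v.2) := by
  unfold plane
  rw [dif_pos h]
  exact (exists_val_eq h).choose_spec

theorem plane_eq {v w : ℝ × ℝ} (hv : v ∈ domain) (hw : w ∈ domain)
    (h1 : (v.1 : AddCircle (1 : ℝ)) = w.1) (h2 : (v.2 : AddCircle (1 : ℝ)) = w.2) :
    plane v = plane w :=
  val_injective (by rw [val_plane hv, val_plane hw, h1, h2])

theorem continuousOn_plane : ContinuousOn plane domain := by
  refine isInducing_val.continuousOn_iff.2 ?_
  have : Continuous fun v : ℝ × ℝ => ((v.1 : AddCircle (1 : ℝ)), (v.2 : AddCircle (1 : ℝ))) :=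
    ((AddCircle.continuous_mk' (1 : ℝ)).comp continuous_fst).prodMk
      ((AddCircle.continuous_mk' (1 : ℝ)).comp continuous_snd)
  exact this.continuousOn.congr fun v hv => val_plane hv

/-- The representative of a point in the square with lower left corner `(a, b)`. -/
noncomputable def pull (a b : ℝ) (p : Handle) : ℝ × ℝ := (rep a p.val.1, rep b p.val.2)

theorem pull_mem (a b : ℝ) (p : Handle) : pull a b p ∈ domain := by
  have : (1 / 4 : ℝ) ^ 2 ≤ ‖p.val.1‖ ^ 2 + ‖p.val.2‖ ^ 2 := p.2
  rw [domain, mem_ofPred_eq, pull, coe_rep, coe_rep]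
  exact this

theorem plane_pull (a b : ℝ) (p : Handle) : plane (pull a b p) = p := by
  apply val_injective
  rw [val_plane (pull_mem a b p), pull, coe_rep, coe_rep]

theorem continuousOn_pull {a b : ℝ} {U : Set Handle} (hU : ∀ p ∈ U, p.val.1 ≠ a ∧ p.val.2 ≠ b) :
    ContinuousOn (pull a b) U := fun p hp =>
  (ContinuousAt.prodMk
    (ContinuousAt.comp (f := fun p : Handle => p.val.1) (continuousAt_rep (hU p hp).1)
      continuous_val.fst.continuousAt)
    (ContinuousAt.comp (f := fun p : Handle => p.val.2) (continuousAt_rep (hU p hp).2)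
      continuous_val.snd.continuousAt)).continuousWithinAt

/-- The exchange of the two coordinates. -/
def swap : C(Handle, Handle) where
  toFun p := ⟨(p.1.2, p.1.1), by
    have := p.2
    rwa [add_comm] at this⟩
  continuous_toFun := by
    refine isInducing_val.continuous_iff.2 ?_
    exact continuous_val.snd.prodMk continuous_val.fst

theorem val_swap (p : Handle) : (swap p).val = p.val.swap := rfl

theorem swap_mem_domain {v : ℝ × ℝ} (hv : v ∈ domain) : v.swap ∈ domain := by
  have : (1 / 4 : ℝ) ^ 2 ≤ _ := hv
  rwa [add_comm] at this

theorem swap_plane {v : ℝ × ℝ} (hv : v ∈ domain) : swap (plane v) = plane v.swap := by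
  apply val_injective
  rw [val_swap, val_plane hv, val_plane (swap_mem_domain hv)]
  rfl

/-- The interior of the square, the first chart. -/
def core : Set Handle := {p | p.val.1 ≠ (0 : ℝ) ∧ p.val.2 ≠ (0 : ℝ)}

/-- The second chart. -/
def band : Set Handle := {p | p.val.1 ≠ ((-(1 / 2) : ℝ) : AddCircle (1 : ℝ)) ∧ p.val.2 ≠ (0 : ℝ)}

theorem isOpen_core : IsOpen core :=
  (isOpen_ne.preimage continuous_val.fst).inter (isOpen_ne.preimage continuous_val.snd)

theorem isOpen_band : IsOpen band :=
  (isOpen_ne.preimage continuous_val.fst).inter (isOpen_ne.preimage continuous_val.snd)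

/-- The two coordinate circles through the origin meet only there, and the origin has been removed
with the disk. So three charts suffice: the open square, a band across the vertical circle, and its
mirror image. -/
theorem mem_cover (p : Handle) : p ∈ core ∨ p ∈ band ∨ swap p ∈ band := by
  have hne : (((0 : ℝ) : ℝ) : AddCircle (1 : ℝ)) ≠ ((-(1 / 2) : ℝ) : AddCircle (1 : ℝ)) := fun e => by
    have := coe_eq_coe_of_mem (a := -(1 / 2)) (x := 0) (y := -(1 / 2)) (by constructor <;> norm_num)
      (by constructor <;> norm_num) e
    norm_num at this
  by_cases h1 : p.val.1 = (0 : ℝ)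
  · by_cases h2 : p.val.2 = (0 : ℝ)
    · have : (1 / 4 : ℝ) ^ 2 ≤ ‖p.val.1‖ ^ 2 + ‖p.val.2‖ ^ 2 := p.2
      rw [h1, h2, AddCircle.coe_zero, norm_zero] at this
      norm_num at this
    · exact Or.inr (Or.inl ⟨h1 ▸ hne, h2⟩)
  · by_cases h2 : p.val.2 = (0 : ℝ)
    · exact Or.inr (Or.inr ⟨by rw [val_swap, Prod.fst_swap, h2]; exact hne, h1⟩)
    · exact Or.inl ⟨h1, h2⟩

theorem scale_mem_domain {v : ℝ × ℝ} (hv : v ∈ domain) (h1 : v.1 ∈ Icc (0 : ℝ) 1)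
    (h2 : v.2 ∈ Icc (0 : ℝ) 1) {s : ℝ} (hs : s ∈ Icc (0 : ℝ) 1) :
    (1 / 2 + s * (v.1 - 1 / 2), 1 / 2 + s * (v.2 - 1 / 2)) ∈ domain :=
  mem_domain_of_le hv (norm_le_norm_scale h1 hs).2 (norm_le_norm_scale h2 hs).2

theorem rep_zero_mem (p : AddCircle (1 : ℝ)) : rep 0 p ∈ Icc (0 : ℝ) 1 := by
  have := rep_mem 0 p
  rw [zero_add] at this
  exact ⟨this.1, this.2.le⟩

/-- The centre of the square. -/
noncomputable def centre : Handle := plane (1 / 2, 1 / 2)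

theorem contractsTo_core : ContractsTo core centre := by
  refine ⟨fun p t => plane (1 / 2 + t * ((pull 0 0 p).1 - 1 / 2), 1 / 2 + t * ((pull 0 0 p).2 - 1 / 2)),
    ?_, fun p _ => ⟨by simp [centre], by simp [plane_pull]⟩⟩
  refine continuousOn_plane.comp ?_ fun q _ => scale_mem_domain (pull_mem 0 0 q.1) (rep_zero_mem _)
    (rep_zero_mem _) q.2.2
  have h : ContinuousOn (fun q : Handle × I => pull 0 0 q.1) (core ×ˢ univ) :=
    (continuousOn_pull fun p hp => hp).comp continuous_fst.continuousOn fun q hq => hq.1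
  have h1 := continuous_fst.comp_continuousOn h
  have h2 := continuous_snd.comp_continuousOn h
  have ht : ContinuousOn (fun q : Handle × I => (q.2 : ℝ)) (core ×ˢ univ) := by fun_prop
  exact (continuousOn_const.add (ht.mul (h1.sub continuousOn_const))).prodMk
    (continuousOn_const.add (ht.mul (h2.sub continuousOn_const)))

theorem norm_coe_half : ‖((1 / 2 : ℝ) : AddCircle (1 : ℝ))‖ = 1 / 2 := by
  rw [norm_coe_of_abs_le] <;> rw [abs_of_nonneg] <;> norm_num

/-- The contraction of the band has two stages, because the first coordinate has to cross `0`. As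
`t` decreases from `1` to `1 / 2` the second coordinate moves to `1 / 2`, away from the disk; only
then does the first one shrink to `0`. -/
theorem stretch_mem_domain {v : ℝ × ℝ} (hv : v ∈ domain) (h2 : v.2 ∈ Icc (0 : ℝ) 1) {t : ℝ}
    (ht : t ∈ Icc (0 : ℝ) 1) :
    (min 1 (2 * t) * v.1, 1 / 2 + max 0 (2 * t - 1) * (v.2 - 1 / 2)) ∈ domain := by
  rcases le_total (2 * t) 1 with h | h
  · refine mem_domain_right ?_
    rw [max_eq_left (by linarith)]
    simp only [zero_mul, add_zero]
    rw [norm_coe_half]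
    norm_num
  · rw [min_eq_left h, max_eq_right (by linarith), one_mul]
    exact mem_domain_of_le hv le_rfl (norm_le_norm_scale h2 ⟨by linarith, by linarith [ht.2]⟩).2

theorem contractsTo_band : ContractsTo band (plane (0, 1 / 2)) := by
  refine ⟨fun p t => plane (min 1 (2 * (t : ℝ)) * (pull (-(1 / 2)) 0 p).1,
    1 / 2 + max 0 (2 * (t : ℝ) - 1) * ((pull (-(1 / 2)) 0 p).2 - 1 / 2)),
    ?_, fun p _ => ⟨by norm_num, ?_⟩⟩
  · refine continuousOn_plane.comp ?_ fun q _ => stretch_mem_domain (pull_mem _ 0 q.1) (rep_zero_mem _)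
      q.2.2
    have h : ContinuousOn (fun q : Handle × I => pull (-(1 / 2)) 0 q.1) (band ×ˢ univ) :=
      (continuousOn_pull fun p hp => hp).comp continuous_fst.continuousOn fun q hq => hq.1
    have h1 := continuous_fst.comp_continuousOn h
    have h2 := continuous_snd.comp_continuousOn h
    have ht : ContinuousOn (fun q : Handle × I => min 1 (2 * (q.2 : ℝ))) (band ×ˢ univ) := by fun_prop
    have ht' : ContinuousOn (fun q : Handle × I => max 0 (2 * (q.2 : ℝ) - 1)) (band ×ˢ univ) := by
      fun_prop
    exact (ht.mul h1).prodMk (continuousOn_const.add (ht'.mul (h2.sub continuousOn_const)))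
  · have e1 : min (1 : ℝ) (2 * ((1 : I) : ℝ)) = 1 := by norm_num
    have e2 : max (0 : ℝ) (2 * ((1 : I) : ℝ) - 1) = 1 := by norm_num
    dsimp only
    rw [e1, e2]
    simp [plane_pull]

/-- The image of a segment in the plane. -/
noncomputable def seg {v w : ℝ × ℝ} (h : segment ℝ v w ⊆ domain) : Path (plane v) (plane w) where
  toFun t := plane (AffineMap.lineMap v w (t : ℝ))
  continuous_toFun := continuousOn_plane.comp_continuous
    (AffineMap.lineMap_continuous.comp continuous_subtype_val) fun t =>
      h (by rw [segment_eq_image_lineMap]; exact ⟨t, t.2, rfl⟩)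
  source' := by simp
  target' := by simp

theorem seg_apply {v w : ℝ × ℝ} (h : segment ℝ v w ⊆ domain) (t : I) :
    seg h t = plane (AffineMap.lineMap v w (t : ℝ)) := rfl

theorem lineMap_mem_segment (v w : ℝ × ℝ) (t : I) : AffineMap.lineMap v w (t : ℝ) ∈ segment ℝ v w := by
  rw [segment_eq_image_lineMap]
  exact ⟨t, t.2, rfl⟩

section

variable {G : Type*} [Group G] (F F' : Holonomy Handle G)

theorem val_seg_eq {S : Set (ℝ × ℝ)} (hS : Convex ℝ S) (hSD : S ⊆ domain) {u v w : ℝ × ℝ}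
    (hu : u ∈ S) (hv : v ∈ S) (hw : w ∈ S) :
    F.val (seg ((hS.segment_subset hu hw).trans hSD)) =
      F.val (seg ((hS.segment_subset hu hv).trans hSD)) *
        F.val (seg ((hS.segment_subset hv hw).trans hSD)) := by
  rw [← F.val_trans]
  refine Holonomy.val_eq_of_convex hS F (continuousOn_plane.mono hSD) (Path.segment u w)
    ((Path.segment u v).trans (Path.segment v w))
    (fun t => hS.segment_subset hu hw (lineMap_mem_segment u w t)) (fun t => ?_) _ _
    (fun t => rfl) (fun t => ?_) rfl rfl
  · rw [Path.trans_apply]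
    split_ifs
    · exact hS.segment_subset hu hv (lineMap_mem_segment u v _)
    · exact hS.segment_subset hv hw (lineMap_mem_segment v w _)
  · rw [Path.trans_apply, Path.trans_apply]
    split_ifs <;> rfl

end

end CompactSurface.Handle

end

/-! ### The boundary of the handle is a commutator -/

section

open Set Topology Filter
open scoped unitInterval

set_option linter.unusedSectionVars false

namespace Circle

/-- The arc between two angles. -/
noncomputable def arc (a b : ℝ) : Path (Circle.exp a) (Circle.exp b) :=
  (Path.segment a b).map Circle.exp.continuous

theorem arc_apply (a b : ℝ) (t : I) : arc a b t = Circle.exp (a + t * (b - a)) := by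
  simp only [arc, Path.map_coe, Function.comp_apply, Path.segment_apply, AffineMap.lineMap_apply,
    vsub_eq_sub, vadd_eq_add, smul_eq_mul]
  rw [add_comm]

end Circle

theorem Holonomy.val_arc {X G : Type*} [TopologicalSpace X] [Group G] (F : Holonomy X G)
    (φ : C(Circle, X)) (a b c : ℝ) :
    F.val ((Circle.arc a c).map φ.continuous) =
      F.val ((Circle.arc a b).map φ.continuous) * F.val ((Circle.arc b c).map φ.continuous) := by
  rw [← F.val_trans]
  refine F.val_eq_of_convex (E := ℝ) convex_univ (φ := φ ∘ Circle.exp)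
    (φ.continuous.comp Circle.exp.continuous).continuousOn (Path.segment a c)
    ((Path.segment a b).trans (Path.segment b c)) (fun _ => mem_univ _) (fun _ => mem_univ _) _ _
    (fun t => rfl) (fun t => ?_) rfl rfl
  rw [Path.trans_apply, Path.trans_apply]
  split_ifs <;> rfl

namespace CompactSurface.Handle

open AddCircle

/-- The boundary circle as a continuous map. -/
noncomputable def rimMap : C(Circle, Handle) where
  toFun := rim
  continuous_toFun := by
    refine isInducing_val.continuous_iff.2 ?_
    have h1 : Continuous fun z : Circle => (z : ℂ).re / 4 := by fun_prop
    have h2 : Continuous fun z : Circle => (z : ℂ).im / 4 := by fun_prop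
    exact ((AddCircle.continuous_mk' (1 : ℝ)).comp h1).prodMk ((AddCircle.continuous_mk' (1 : ℝ)).comp h2)

theorem rimMap_apply (z : Circle) : rimMap z = rim z := rfl

theorem rim_mem_domain (z : Circle) : ((z : ℂ).re / 4, (z : ℂ).im / 4) ∈ domain := (rim z).2

theorem rim_eq (z : Circle) : rim z = plane ((z : ℂ).re / 4, (z : ℂ).im / 4) :=
  val_injective (val_plane (rim_mem_domain z)).symm

theorem abs_re_div_le (z : Circle) : |(z : ℂ).re / 4| ≤ 1 / 4 ∧ |(z : ℂ).im / 4| ≤ 1 / 4 := by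
  have h1 := Complex.abs_re_le_norm (z : ℂ)
  have h2 := Complex.abs_im_le_norm (z : ℂ)
  rw [Circle.norm_coe] at h1 h2
  rw [abs_div, abs_div, show |(4 : ℝ)| = 4 by norm_num]
  constructor <;> linarith

theorem row_subset : {v : ℝ × ℝ | v.2 = 1 / 2} ⊆ domain := fun v hv => mem_domain_right (by
  rw [show v.2 = 1 / 2 from hv, norm_coe_half]; norm_num)

theorem convex_row : Convex ℝ {v : ℝ × ℝ | v.2 = 1 / 2} := fun v hv w hw a b _ _ hab => by
  have hv : v.2 = 1 / 2 := hv
  have hw : w.2 = 1 / 2 := hw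
  simp only [mem_ofPred_eq, Prod.snd_add, Prod.smul_snd, hv, hw, smul_eq_mul]
  linear_combination (1 / 2) * hab

theorem seg_row_subset (x y : ℝ) : segment ℝ (x, (1 / 2 : ℝ)) (y, 1 / 2) ⊆ domain :=
  (convex_row.segment_subset rfl rfl).trans row_subset

theorem seg_col_subset (x y : ℝ) : segment ℝ ((1 / 2 : ℝ), x) (1 / 2, y) ⊆ domain := by
  intro v hv
  have hv' : v.1 = 1 / 2 := by
    obtain ⟨a, b, -, -, hab, rfl⟩ := hv
    simp only [Prod.fst_add, Prod.smul_fst, smul_eq_mul]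
    linear_combination (1 / 2) * hab
  exact mem_domain_left (by rw [hv', norm_coe_half]; norm_num)

theorem coe_neg_half : ((-(1 / 2) : ℝ) : AddCircle (1 : ℝ)) = ((1 / 2 : ℝ) : AddCircle (1 : ℝ)) := by
  have : ((1 / 2 : ℝ) : AddCircle (1 : ℝ)) = ((-(1 / 2) + 1 : ℝ) : AddCircle (1 : ℝ)) := by norm_num
  rw [this, AddCircle.coe_add, AddCircle.coe_period, add_zero]

theorem plane_left : plane (-(1 / 2), 1 / 2) = centre :=
  plane_eq (row_subset rfl) (row_subset rfl) coe_neg_half rfl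

theorem plane_bottom : plane (1 / 2, -(1 / 2)) = centre := by
  have h := swap_plane (v := (-(1 / 2), 1 / 2)) (row_subset rfl)
  rw [plane_left, centre, swap_plane (row_subset rfl)] at h
  exact h.symm

/-- The horizontal loop at the centre. -/
noncomputable def rowLoop : Path centre centre :=
  (seg (seg_row_subset (1 / 2) (-(1 / 2)))).cast rfl plane_left.symm

/-- The vertical loop at the centre. -/
noncomputable def colLoop : Path centre centre :=
  (seg (seg_col_subset (1 / 2) (-(1 / 2)))).cast rfl plane_bottom.symm

theorem middle_subset : {v : ℝ × ℝ | v.1 ∈ Icc (1 / 4 : ℝ) (3 / 4)} ⊆ domain := fun v hv =>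
  mem_domain_left (by
    have hv : v.1 ∈ Icc (1 / 4 : ℝ) (3 / 4) := hv
    rw [norm_coe_of_mem ⟨by linarith [hv.1], by linarith [hv.2]⟩, le_sub_comm, abs_le]
    constructor <;> linarith [hv.1, hv.2])

theorem convex_middle : Convex ℝ {v : ℝ × ℝ | v.1 ∈ Icc (1 / 4 : ℝ) (3 / 4)} :=
  (convex_Icc (1 / 4 : ℝ) (3 / 4)).linear_preimage (LinearMap.fst ℝ ℝ ℝ)

theorem seg_tail_subset : segment ℝ ((1 / 4 : ℝ), (0 : ℝ)) (1 / 2, 1 / 2) ⊆ domain :=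
  (convex_middle.segment_subset ⟨le_rfl, by norm_num⟩ ⟨by norm_num, by norm_num⟩).trans middle_subset

theorem rimMap_one : rimMap 1 = plane (1 / 4, 0) := by
  rw [rimMap_apply, rim_eq]; simp

/-- A path from the boundary to the centre. -/
noncomputable def tail : Path (rimMap 1) centre := (seg seg_tail_subset).cast rimMap_one rfl

/-- The first generator. -/
noncomputable def loopA : Path (rimMap 1) (rimMap 1) := (tail.trans rowLoop).trans tail.symm

/-- The second generator. -/
noncomputable def loopB : Path (rimMap 1) (rimMap 1) := (tail.trans colLoop).trans tail.symm

variable {G : Type*} [Group G] (F F' : Holonomy Handle G)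

theorem val_loopA : F.val loopA = F.val tail * F.val rowLoop * (F.val tail)⁻¹ := by
  rw [loopA, F.val_trans, F.val_trans, F.val_symm]

theorem val_loopB : F.val loopB = F.val tail * F.val colLoop * (F.val tail)⁻¹ := by
  rw [loopB, F.val_trans, F.val_trans, F.val_symm]

theorem val_colLoop : (F.comap swap).val rowLoop = F.val colLoop := by
  refine F.val_congr _ _ fun t => ?_
  change swap (seg (seg_row_subset (1 / 2) (-(1 / 2))) t) = seg (seg_col_subset (1 / 2) (-(1 / 2))) t
  rw [seg_apply, seg_apply, swap_plane (seg_row_subset _ _ (lineMap_mem_segment _ _ t))]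
  simp [AffineMap.lineMap_apply]

/-- The loop is cut in two ways: at the seam (`a = b = 0`) to read it in the closed square, and at
`±1 / 4` to read it in the charts. -/
theorem val_rowLoop_eq (a b : ℝ) : F.val rowLoop = F.val (seg (seg_row_subset (1 / 2) a)) *
    F.val (seg (seg_row_subset a b)) * F.val (seg (seg_row_subset b (-(1 / 2)))) := by
  have h := fun x y z : ℝ => val_seg_eq F convex_row row_subset (u := (x, 1 / 2)) (v := (y, 1 / 2))
    (w := (z, 1 / 2)) rfl rfl rfl
  exact (F.val_congr rowLoop (seg (seg_row_subset (1 / 2) (-(1 / 2)))) fun _ => rfl).trans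
    ((h (1 / 2) b (-(1 / 2))).trans (congr_arg (· * _) (h (1 / 2) a b)))

/-- The part of the closed unit square that is mapped to the handle. -/
def square : Set (ℝ × ℝ) := {v | v ∈ domain ∧ v.1 ∈ Icc (0 : ℝ) 1 ∧ v.2 ∈ Icc (0 : ℝ) 1}

/-- The function `u` trivializes the functor on the closed square. -/
def IsCoboundary (u : ℝ × ℝ → G) : Prop := ∀ ⦃v w : ℝ × ℝ⦄ (γ : Path v w),
    (∀ t, γ t ∈ square) → ∀ ⦃x y : Handle⦄ (δ : Path x y), (∀ t, δ t = plane (γ t)) →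
    F.val δ = (u v)⁻¹ * u w

/-- Cut open, the handle is a square without its four corners, which is star-shaped around its
centre. Opposite sides are distinct in the square, and the jump of `u` between them carries the
information about `F`. -/
theorem exists_coboundary_square : ∃ u : ℝ × ℝ → G, IsCoboundary F u := by
  classical
  let φ : C(square, Handle) := ⟨fun v => plane v, continuousOn_plane.comp_continuous
    continuous_subtype_val fun v => v.2.1⟩
  have hc : ((1 / 2 : ℝ), (1 / 2 : ℝ)) ∈ square := ⟨row_subset rfl, by norm_num, by norm_num⟩
  have hS : ContractsTo (univ : Set square) ⟨_, hc⟩ := by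
    refine ⟨fun v t => ⟨(1 / 2 + t * (v.1.1 - 1 / 2), 1 / 2 + t * (v.1.2 - 1 / 2)),
      scale_mem_domain v.2.1 v.2.2.1 v.2.2.2 t.2, (norm_le_norm_scale v.2.2.1 t.2).1,
      (norm_le_norm_scale v.2.2.2 t.2).1⟩, ?_, fun v _ => ⟨?_, ?_⟩⟩
    · exact (Continuous.subtype_mk (by fun_prop) _).continuousOn
    · exact Subtype.ext (by simp)
    · exact Subtype.ext (by simp)
  obtain ⟨u, hu⟩ := (F.comap φ).exists_coboundary hS
  refine ⟨fun v => if h : v ∈ square then u ⟨v, h⟩ else 1, fun v w γ hγ x y δ hδ => ?_⟩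
  have hv : v ∈ square := by simpa using hγ 0
  have hw : w ∈ square := by simpa using hγ 1
  let γ' : Path (⟨v, hv⟩ : square) ⟨w, hw⟩ :=
    ⟨⟨fun t => ⟨γ t, hγ t⟩, by fun_prop⟩, Subtype.ext γ.source, Subtype.ext γ.target⟩
  simp only [dif_pos hv, dif_pos hw]
  rw [← hu γ' fun _ => mem_univ _]
  exact F.val_congr _ _ hδ

theorem coe_add_int (x : ℝ) (a : ℤ) : ((x + a : ℝ) : AddCircle (1 : ℝ)) = x := by
  rw [AddCircle.coe_add, (AddCircle.coe_eq_zero_iff (1 : ℝ) (x := (a : ℝ))).2 ⟨a, by simp⟩, add_zero]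

/-- An integral translation does not change the image in the torus, so a segment outside the unit
square can be evaluated after it has been moved inside. -/
theorem IsCoboundary.val_seg {u : ℝ × ℝ → G} (hu : IsCoboundary F u) {v w v' w' : ℝ × ℝ} (h : segment ℝ v w ⊆ domain) (a b : ℤ)
    (hv : v' = v + ((a : ℝ), (b : ℝ))) (hw : w' = w + ((a : ℝ), (b : ℝ)))
    (hv' : v' ∈ Icc (0 : ℝ) 1 ×ˢ Icc (0 : ℝ) 1) (hw' : w' ∈ Icc (0 : ℝ) 1 ×ˢ Icc (0 : ℝ) 1) :
    F.val (seg h) = (u v')⁻¹ * u w' := by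
  have hsq := ((convex_Icc (0 : ℝ) 1).prod (convex_Icc (0 : ℝ) 1) : Convex ℝ (Icc (0 : ℝ) 1 ×ˢ Icc (0 : ℝ) 1)).segment_subset hv' hw'
  have e (t : I) : AffineMap.lineMap v' w' (t : ℝ) =
      AffineMap.lineMap v w (t : ℝ) + ((a : ℝ), (b : ℝ)) := by
    rw [hv, hw]
    simp only [AffineMap.lineMap_apply, vsub_eq_sub, vadd_eq_add, add_sub_add_right_eq_sub]
    abel
  have hdom (t : I) : AffineMap.lineMap v' w' (t : ℝ) ∈ domain := by
    have := h (lineMap_mem_segment v w t)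
    refine mem_domain_of_le this (le_of_eq ?_) (le_of_eq ?_) <;> rw [e]
    · rw [Prod.fst_add, coe_add_int]
    · rw [Prod.snd_add, coe_add_int]
  refine hu (Path.segment v' w') (fun t => ⟨hdom t, (hsq (lineMap_mem_segment v' w' t)).1,
    (hsq (lineMap_mem_segment v' w' t)).2⟩) _ fun t => ?_
  rw [seg_apply]
  refine plane_eq (h (lineMap_mem_segment v w t)) (hdom t) ?_ ?_ <;>
    rw [Path.segment_apply, e]
  · rw [Prod.fst_add, coe_add_int]
  · rw [Prod.snd_add, coe_add_int]

theorem IsCoboundary.val_arc {u : ℝ × ℝ → G} (hu : IsCoboundary F u) (a b : ℝ) (hab : a ≤ b) (i j : ℤ)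
    (h1 : ∀ θ ∈ Icc a b, Real.cos θ / 4 + i ∈ Icc (0 : ℝ) 1)
    (h2 : ∀ θ ∈ Icc a b, Real.sin θ / 4 + j ∈ Icc (0 : ℝ) 1) :
    F.val ((Circle.arc a b).map rimMap.continuous) =
      (u (Real.cos a / 4 + i, Real.sin a / 4 + j))⁻¹ *
        u (Real.cos b / 4 + i, Real.sin b / 4 + j) := by
  let ψ : ℝ → ℝ × ℝ := fun θ => (Real.cos θ / 4 + i, Real.sin θ / 4 + j)
  have hψ : Continuous ψ := by fun_prop
  have hdom (θ : ℝ) : ψ θ ∈ domain := by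
    have := rim_mem_domain (Circle.exp θ)
    rw [Circle.coe_exp, Complex.exp_ofReal_mul_I_re, Complex.exp_ofReal_mul_I_im] at this
    refine mem_domain_of_le this (le_of_eq ?_) (le_of_eq ?_) <;> rw [coe_add_int]
  have hmem (t : I) : Path.segment a b t ∈ Icc a b := by
    rw [← segment_eq_Icc hab, segment_eq_image_lineMap]
    exact ⟨t, t.2, rfl⟩
  refine hu ((Path.segment a b).map hψ) (fun t => ⟨hdom _, h1 _ (hmem t), h2 _ (hmem t)⟩) _ fun t => ?_
  change rim (Circle.exp (Path.segment a b t)) = plane (ψ (Path.segment a b t))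
  rw [rim_eq]
  refine plane_eq (rim_mem_domain _) (hdom _) ?_ ?_
  · rw [coe_add_int, Circle.coe_exp, Complex.exp_ofReal_mul_I_re]
  · rw [coe_add_int, Circle.coe_exp, Complex.exp_ofReal_mul_I_im]

/-- The circle around the origin is cut into quarters, and each quarter is translated to the corner
of the unit square at which it appears. -/
theorem IsCoboundary.val_rim {u : ℝ × ℝ → G} (hu : IsCoboundary F u) :
    F.val (Circle.loop.map rimMap.continuous) =
      (u (1 / 4, 0))⁻¹ * u (0, 1 / 4) * ((u (1, 1 / 4))⁻¹ * u (3 / 4, 0)) *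
        ((u (3 / 4, 1))⁻¹ * u (1, 3 / 4)) * ((u (0, 3 / 4))⁻¹ * u (1 / 4, 1)) := by
  have harc := hu.val_arc F
  have hpi := Real.pi_pos
  have c1 := harc 0 (Real.pi / 2) (by linarith) 0 0
    (fun θ hθ => by
      have := Real.cos_nonneg_of_neg_pi_div_two_le_of_le (by linarith [hθ.1]) hθ.2
      have := Real.cos_le_one θ
      push_cast; constructor <;> linarith)
    (fun θ hθ => by
      have := Real.sin_nonneg_of_nonneg_of_le_pi hθ.1 (by linarith [hθ.2])
      have := Real.sin_le_one θ
      push_cast; constructor <;> linarith)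
  have c2 := harc (Real.pi / 2) Real.pi (by linarith) 1 0
    (fun θ hθ => by
      have := Real.cos_nonpos_of_pi_div_two_le_of_le hθ.1 (by linarith [hθ.2])
      have := Real.neg_one_le_cos θ
      push_cast; constructor <;> linarith)
    (fun θ hθ => by
      have := Real.sin_nonneg_of_nonneg_of_le_pi (by linarith [hθ.1]) hθ.2
      have := Real.sin_le_one θ
      push_cast; constructor <;> linarith)
  have c3 := harc Real.pi (3 * Real.pi / 2) (by linarith) 1 1
    (fun θ hθ => by
      have := Real.cos_nonpos_of_pi_div_two_le_of_le (x := θ) (by linarith [hθ.1]) (by linarith [hθ.2])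
      have := Real.neg_one_le_cos θ
      push_cast; constructor <;> linarith)
    (fun θ hθ => by
      have := Real.sin_nonneg_of_nonneg_of_le_pi (x := θ - Real.pi) (by linarith [hθ.1])
        (by linarith [hθ.2])
      rw [Real.sin_sub_pi] at this
      have := Real.neg_one_le_sin θ
      push_cast; constructor <;> linarith)
  have c4 := harc (3 * Real.pi / 2) (2 * Real.pi) (by linarith) 0 1
    (fun θ hθ => by
      have := Real.cos_nonneg_of_neg_pi_div_two_le_of_le (x := θ - 2 * Real.pi)
        (by linarith [hθ.1]) (by linarith [hθ.2])
      rw [Real.cos_sub_two_pi] at this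
      have := Real.cos_le_one θ
      push_cast; constructor <;> linarith)
    (fun θ hθ => by
      have := Real.sin_nonneg_of_nonneg_of_le_pi (x := θ - Real.pi) (by linarith [hθ.1])
        (by linarith [hθ.2])
      rw [Real.sin_sub_pi] at this
      have := Real.neg_one_le_sin θ
      push_cast; constructor <;> linarith)
  have hloop : F.val (Circle.loop.map rimMap.continuous) =
      F.val ((Circle.arc 0 (2 * Real.pi)).map rimMap.continuous) := by
    refine F.val_congr _ _ fun t => ?_
    change rimMap (Circle.loop t) = rimMap (Circle.arc 0 (2 * Real.pi) t)
    rw [Circle.loop_apply, Circle.arc_apply]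
    congr 2
    ring
  have e3c : Real.cos (3 * Real.pi / 2) = 0 := by
    rw [show 3 * Real.pi / 2 = Real.pi / 2 + Real.pi by ring, Real.cos_add_pi, Real.cos_pi_div_two,
      neg_zero]
  have e3s : Real.sin (3 * Real.pi / 2) = -1 := by
    rw [show 3 * Real.pi / 2 = Real.pi / 2 + Real.pi by ring, Real.sin_add_pi, Real.sin_pi_div_two]
  rw [hloop, F.val_arc rimMap 0 (3 * Real.pi / 2) (2 * Real.pi),
    F.val_arc rimMap 0 Real.pi (3 * Real.pi / 2), F.val_arc rimMap 0 (Real.pi / 2) Real.pi, c1, c2, c3,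
    c4]
  have n1 : (-1 : ℝ) / 4 + 1 = 3 / 4 := by norm_num
  simp only [e3c, e3s, Real.cos_zero, Real.sin_zero, Real.cos_pi_div_two, Real.sin_pi_div_two,
    Real.cos_pi, Real.sin_pi, Real.cos_two_pi, Real.sin_two_pi, Int.cast_zero, Int.cast_one, zero_div,
    zero_add, add_zero, n1]

theorem band_subset : {v : ℝ × ℝ | v.2 ∈ Icc (1 / 4 : ℝ) (3 / 4)} ⊆ domain := fun v hv =>
  mem_domain_right (by
    have hv : v.2 ∈ Icc (1 / 4 : ℝ) (3 / 4) := hv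
    rw [norm_coe_of_mem ⟨by linarith [hv.1], by linarith [hv.2]⟩, le_sub_comm, abs_le]
    constructor <;> linarith [hv.1, hv.2])

theorem seg_vertical_subset (x : ℝ) {a b : ℝ} (ha : a ∈ Icc (1 / 4 : ℝ) (3 / 4))
    (hb : b ∈ Icc (1 / 4 : ℝ) (3 / 4)) : segment ℝ (x, a) (x, b) ⊆ domain :=
  (((convex_Icc (1 / 4 : ℝ) (3 / 4)).linear_preimage (LinearMap.snd ℝ ℝ ℝ)).segment_subset
    (x := (x, a)) (y := (x, b)) ha hb).trans band_subset

/-- The boundary circle is the commutator of the two loops. -/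
theorem val_rim : F.val (Circle.loop.map rimMap.continuous) =
    F.val loopA * F.val loopB * (F.val loopA)⁻¹ * (F.val loopB)⁻¹ := by
  obtain ⟨u, hu⟩ := exists_coboundary_square F
  rw [hu.val_rim]
  have hseg := @IsCoboundary.val_seg G _ F u hu
  have hseg0 {v w : ℝ × ℝ} (h : segment ℝ v w ⊆ domain) (hv : v ∈ Icc (0 : ℝ) 1 ×ˢ Icc (0 : ℝ) 1)
      (hw : w ∈ Icc (0 : ℝ) 1 ×ˢ Icc (0 : ℝ) 1) : F.val (seg h) = (u v)⁻¹ * u w :=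
    hseg h 0 0 (by simp) (by simp) hv hw
  have hmidc (y : ℝ) {a b : ℝ} (ha : a ∈ Icc (1 / 4 : ℝ) (3 / 4)) (hb : b ∈ Icc (1 / 4 : ℝ) (3 / 4)) :
      segment ℝ (a, y) (b, y) ⊆ domain := (convex_middle.segment_subset ha hb).trans middle_subset
  -- the jumps of the coboundary are constant
  have j1 : u (0, 3 / 4) * (u (1, 3 / 4))⁻¹ = u (0, 1 / 4) * (u (1, 1 / 4))⁻¹ := by
    have h1 := hseg0 (seg_vertical_subset 0 (a := 1 / 4) (b := 3 / 4) (by norm_num) (by norm_num)) (by norm_num) (by norm_num)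
    have h2 := hseg (seg_vertical_subset 0 (a := 1 / 4) (b := 3 / 4) (by norm_num) (by norm_num)) 1 0 (v' := (1, 1 / 4)) (w' := (1, 3 / 4)) (by simp) (by simp)
      (by norm_num) (by norm_num)
    rw [h1] at h2
    rw [mul_inv_eq_iff_eq_mul, mul_assoc, ← h2]
    group
  have j2 : u (0, 1 / 2) * (u (1, 1 / 2))⁻¹ = u (0, 1 / 4) * (u (1, 1 / 4))⁻¹ := by
    have h1 := hseg0 (seg_vertical_subset 0 (a := 1 / 4) (b := 1 / 2) (by norm_num) (by norm_num)) (by norm_num) (by norm_num)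
    have h2 := hseg (seg_vertical_subset 0 (a := 1 / 4) (b := 1 / 2) (by norm_num) (by norm_num)) 1 0 (v' := (1, 1 / 4)) (w' := (1, 1 / 2)) (by simp) (by simp)
      (by norm_num) (by norm_num)
    rw [h1] at h2
    rw [mul_inv_eq_iff_eq_mul, mul_assoc, ← h2]
    group
  have k1 : u (3 / 4, 0) * (u (3 / 4, 1))⁻¹ = u (1 / 4, 0) * (u (1 / 4, 1))⁻¹ := by
    have h := hmidc 0 (a := 1 / 4) (b := 3 / 4) (by norm_num) (by norm_num)
    have h1 := hseg0 h (by norm_num) (by norm_num)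
    have h2 := hseg h 0 1 (v' := (1 / 4, 1)) (w' := (3 / 4, 1)) (by simp) (by simp)
      (by norm_num) (by norm_num)
    rw [h1] at h2
    rw [mul_inv_eq_iff_eq_mul, mul_assoc, ← h2]
    group
  have k2 : u (1 / 2, 0) * (u (1 / 2, 1))⁻¹ = u (1 / 4, 0) * (u (1 / 4, 1))⁻¹ := by
    have h := hmidc 0 (a := 1 / 4) (b := 1 / 2) (by norm_num) (by norm_num)
    have h1 := hseg0 h (by norm_num) (by norm_num)
    have h2 := hseg h 0 1 (v' := (1 / 4, 1)) (w' := (1 / 2, 1)) (by simp) (by simp)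
      (by norm_num) (by norm_num)
    rw [h1] at h2
    rw [mul_inv_eq_iff_eq_mul, mul_assoc, ← h2]
    group
  have ht : F.val tail = (u (1 / 4, 0))⁻¹ * u (1 / 2, 1 / 2) :=
    (F.val_congr tail (seg seg_tail_subset) fun _ => rfl).trans
      (hseg0 seg_tail_subset (by norm_num) (by norm_num))
  have hrow : F.val rowLoop = (u (1 / 2, 1 / 2))⁻¹ * (u (0, 1 / 2) * (u (1, 1 / 2))⁻¹) *
      u (1 / 2, 1 / 2) := by
    rw [val_rowLoop_eq F 0 0, hseg0 (seg_row_subset (1 / 2) 0) (by norm_num) (by norm_num),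
      hseg0 (seg_row_subset 0 0) (by norm_num) (by norm_num),
      hseg (seg_row_subset 0 (-(1 / 2))) 1 0 (v' := (1, 1 / 2)) (w' := (1 / 2, 1 / 2)) (by simp)
        (by norm_num) (by norm_num) (by norm_num)]
    group
  have hcol : F.val colLoop = (u (1 / 2, 1 / 2))⁻¹ * (u (1 / 2, 0) * (u (1 / 2, 1))⁻¹) *
      u (1 / 2, 1 / 2) := by
    have hs := fun (x y : ℝ) (t : I) => swap_plane (seg_row_subset x y (lineMap_mem_segment _ _ t))
    have hc (x y : ℝ) : (F.comap swap).val (seg (seg_row_subset x y)) = F.val (seg (seg_col_subset x y)) := by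
      refine F.val_congr _ _ fun t => ?_
      change swap (seg _ t) = seg _ t
      rw [seg_apply, seg_apply, hs]
      simp [AffineMap.lineMap_apply]
    rw [← val_colLoop, val_rowLoop_eq _ 0 0, hc, hc, hc,
      hseg0 (seg_col_subset (1 / 2) 0) (by norm_num) (by norm_num),
      hseg0 (seg_col_subset 0 0) (by norm_num) (by norm_num),
      hseg (seg_col_subset 0 (-(1 / 2))) 0 1 (v' := (1 / 2, 1)) (w' := (1 / 2, 1 / 2)) (by simp)
        (by norm_num) (by norm_num) (by norm_num)]
    group
  rw [j2] at hrow
  rw [k2] at hcol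
  have hA : F.val loopA = (u (1 / 4, 0))⁻¹ * (u (0, 1 / 4) * (u (1, 1 / 4))⁻¹) * u (1 / 4, 0) := by
    rw [val_loopA, hrow, ht]; group
  have hB : F.val loopB = (u (1 / 4, 0))⁻¹ * (u (1 / 4, 0) * (u (1 / 4, 1))⁻¹) * u (1 / 4, 0) := by
    rw [val_loopB, hcol, ht]; group
  have j1' : u (1, 3 / 4) * (u (0, 3 / 4))⁻¹ = (u (0, 1 / 4) * (u (1, 1 / 4))⁻¹)⁻¹ := by
    rw [← j1]; group
  -- With `A` and `B` for the jumps across the vertical and the horizontal seam, the product over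
  -- the four corners is `A B A⁻¹ B⁻¹` conjugated by `u (1 / 4, 0)`; the last factor `B⁻¹` comes
  -- from `u (1 / 4, 1) = B⁻¹ * u (1 / 4, 0)`.
  calc _ = (u (1 / 4, 0))⁻¹ * (u (0, 1 / 4) * (u (1, 1 / 4))⁻¹) * (u (3 / 4, 0) * (u (3 / 4, 1))⁻¹) *
        (u (1, 3 / 4) * (u (0, 3 / 4))⁻¹) * u (1 / 4, 1) := by group
    _ = _ := by rw [j1', k1, hA, hB]; group

end CompactSurface.Handle

end

/-! ### Classification of the functors on the handle -/

section

open Set Topology Filter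
open scoped unitInterval

set_option linter.unusedSectionVars false

namespace Holonomy

variable {X G : Type*} [TopologicalSpace X] [Group G] {F F' : Holonomy X G}

/-- Conjugating the target functor by an element translates natural transformations. -/
theorem NatAlong.of_gauge {e : X → G} {g : G} {x y : X} {γ : Path x y}
    (h : F.NatAlong (F'.gauge fun _ => g) e γ) : F.NatAlong F' (fun z => e z * g) γ := by
  unfold NatAlong at *
  rw [gauge_val] at h
  dsimp only
  rw [← mul_assoc, ← h]
  group

end Holonomy

namespace CompactSurface.Handle

open AddCircle

variable {G : Type*} [Group G]

theorem coe_ne_zero_of_mem {x : ℝ} (hx : x ∈ Ioo (0 : ℝ) 1) : (x : AddCircle (1 : ℝ)) ≠ (0 : ℝ) :=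
  fun e => by
    have := coe_eq_coe_of_mem (a := 0) ⟨hx.1.le, by linarith [hx.2]⟩ (by norm_num) e
    exact hx.1.ne' this

theorem coe_ne_zero_of_abs {x : ℝ} (h0 : x ≠ 0) (hx : |x| < 1) : (x : AddCircle (1 : ℝ)) ≠ (0 : ℝ) := by
  rw [abs_lt] at hx
  rcases lt_or_gt_of_ne h0 with h | h
  · have e : (x : AddCircle (1 : ℝ)) = ((x + 1 : ℝ) : AddCircle (1 : ℝ)) := by
      rw [AddCircle.coe_add, AddCircle.coe_period, add_zero]
    rw [e]
    exact coe_ne_zero_of_mem ⟨by linarith, by linarith⟩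
  · exact coe_ne_zero_of_mem ⟨h, hx.2⟩

theorem coe_ne_neg_half {x : ℝ} (hx : |x| < 1 / 2) :
    (x : AddCircle (1 : ℝ)) ≠ ((-(1 / 2) : ℝ) : AddCircle (1 : ℝ)) := fun e => by
  rw [abs_lt] at hx
  have := coe_eq_coe_of_mem (a := -(1 / 2)) ⟨hx.1.le, by linarith [hx.2]⟩ (by norm_num) e
  exact hx.1.ne' this

theorem plane_mem_core {v : ℝ × ℝ} (hv : v ∈ domain) (h1 : v.1 ≠ 0) (h1' : |v.1| < 1)
    (h2 : v.2 ∈ Ioo (0 : ℝ) 1) : plane v ∈ core := by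
  rw [core, mem_ofPred_eq, val_plane hv]
  exact ⟨coe_ne_zero_of_abs h1 h1', coe_ne_zero_of_mem h2⟩

theorem plane_mem_band {v : ℝ × ℝ} (hv : v ∈ domain) (h1 : |v.1| < 1 / 2)
    (h2 : v.2 ∈ Ioo (0 : ℝ) 1) : plane v ∈ band := by
  rw [band, mem_ofPred_eq, val_plane hv]
  exact ⟨coe_ne_neg_half h1, coe_ne_zero_of_mem h2⟩

theorem swap_mem_core {p : Handle} : swap p ∈ core ↔ p ∈ core := and_comm

theorem seg_row_mem {x y : ℝ} (t : I) : ∃ z ∈ segment ℝ x y,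
    seg (seg_row_subset x y) t = plane (z, 1 / 2) := by
  refine ⟨AffineMap.lineMap x y (t : ℝ), ?_, ?_⟩
  · rw [segment_eq_image_lineMap]
    exact ⟨t, t.2, rfl⟩
  · rw [seg_apply]
    simp [AffineMap.lineMap_apply]

theorem seg_row_mem_core {x y : ℝ} (h : ∀ z ∈ segment ℝ x y, z ≠ 0 ∧ |z| < 1) (t : I) :
    seg (seg_row_subset x y) t ∈ core := by
  obtain ⟨z, hz, e⟩ := seg_row_mem (x := x) (y := y) t
  rw [e]
  exact plane_mem_core (row_subset rfl) (h z hz).1 (h z hz).2 (by norm_num)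

theorem seg_row_mem_band {x y : ℝ} (h : ∀ z ∈ segment ℝ x y, |z| < 1 / 2) (t : I) :
    seg (seg_row_subset x y) t ∈ band := by
  obtain ⟨z, hz, e⟩ := seg_row_mem (x := x) (y := y) t
  rw [e]
  exact plane_mem_band (row_subset rfl) (h z hz) (by norm_num)

theorem mem_core_right (t : I) : seg (seg_row_subset (1 / 2) (1 / 4)) t ∈ core := by
  refine seg_row_mem_core (fun z hz => ?_) t
  rw [segment_symm, segment_eq_Icc (by norm_num)] at hz
  exact ⟨by linarith [hz.1], abs_lt.2 ⟨by linarith [hz.1], by linarith [hz.2]⟩⟩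

theorem mem_core_left (t : I) : seg (seg_row_subset (-(1 / 4)) (-(1 / 2))) t ∈ core := by
  refine seg_row_mem_core (fun z hz => ?_) t
  rw [segment_symm, segment_eq_Icc (by norm_num)] at hz
  exact ⟨by linarith [hz.2], abs_lt.2 ⟨by linarith [hz.1], by linarith [hz.2]⟩⟩

theorem mem_band_middle (t : I) : seg (seg_row_subset (1 / 4) (-(1 / 4))) t ∈ band := by
  refine seg_row_mem_band (fun z hz => ?_) t
  rw [segment_symm, segment_eq_Icc (by norm_num)] at hz
  exact abs_lt.2 ⟨by linarith [hz.1], by linarith [hz.2]⟩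

section Existence

open Classical in
/-- The locally constant function that distinguishes the two halves of the square. -/
noncomputable def jump (a : G) (p : Handle) : G := if rep 0 p.val.1 < 1 / 2 then a⁻¹ else 1

/-- The function changes only where the first coordinate is `0` or `1 / 2`. The band omits the
circle at `1 / 2`, and the other two charts omit the circle at `0`, so it is locally constant on the
overlaps. -/
theorem eventually_jump (a : G) {p : Handle} (h0 : p.val.1 ≠ (0 : ℝ))
    (h1 : p.val.1 ≠ ((-(1 / 2) : ℝ) : AddCircle (1 : ℝ))) : ∀ᶠ q in 𝓝 p, jump a q = jump a p := by
  have hc : ContinuousAt (fun p : Handle => rep 0 p.val.1) p :=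
    ContinuousAt.comp (f := fun p : Handle => p.val.1) (continuousAt_rep h0)
      continuous_val.fst.continuousAt
  have hne : rep 0 p.val.1 ≠ 1 / 2 := fun e => h1 (by rw [coe_neg_half, ← e, coe_rep])
  unfold jump
  rcases lt_or_gt_of_ne hne with h | h
  · filter_upwards [hc.eventually_lt_const h] with q hq
    rw [if_pos hq, if_pos h]
  · filter_upwards [hc.eventually_const_lt h] with q hq
    rw [if_neg hq.not_gt, if_neg h.not_gt]

theorem jump_plane_pos (a : G) {x : ℝ} (h : x ∈ Ioo (0 : ℝ) (1 / 2)) :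
    jump a (plane (x, 1 / 2)) = a⁻¹ := by
  rw [jump, val_plane (row_subset rfl), if_pos]
  dsimp only
  rw [rep_coe ⟨h.1.le, by linarith [h.2]⟩]
  exact h.2

theorem jump_plane_neg (a : G) {x : ℝ} (h : x ∈ Ioo (-(1 / 2)) (0 : ℝ)) :
    jump a (plane (x, 1 / 2)) = 1 := by
  have e : (x : AddCircle (1 : ℝ)) = ((x + 1 : ℝ) : AddCircle (1 : ℝ)) := by
    rw [AddCircle.coe_add, AddCircle.coe_period, add_zero]
  rw [jump, val_plane (row_subset rfl), if_neg]
  dsimp only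
  rw [e, rep_coe ⟨by linarith [h.1], by linarith [h.2]⟩]
  linarith [h.1]

/-- The values on the two loops at the centre can be prescribed. -/
theorem exists_holonomy_centre (a b : G) :
    ∃ F : Holonomy Handle G, F.val rowLoop = a ∧ F.val colLoop = b := by
  let c : Fin 3 → Set Handle := ![core, band, swap ⁻¹' band]
  -- The functor is trivial on the open square. It picks up `a` when the first coordinate decreases
  -- through `0`, which happens only in the band, and `b` in the mirror image.
  let u : Fin 3 → Handle → G := ![fun _ => 1, jump a, fun p => jump b (swap p)]
  have hloc : ∀ i j, i ≠ j → ∀ x ∈ c i, x ∈ c j → ∀ᶠ y in 𝓝 x, u i y = u i x := by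
    intro i j hij x hi hj
    fin_cases i
    · exact Eventually.of_forall fun _ => rfl
    · have h0 : x.val.1 ≠ (0 : ℝ) := by
        fin_cases j
        · exact hj.1
        · exact absurd rfl hij
        · exact hj.2
      exact eventually_jump a h0 hi.1
    · have h0 : x.val.2 ≠ (0 : ℝ) := by
        fin_cases j
        · exact hj.2
        · exact hj.2
        · exact absurd rfl hij
      exact swap.continuous.continuousAt.eventually (eventually_jump (p := swap x) b h0 hi.1)
  obtain ⟨F, hF⟩ := Holonomy.exists_of_coboundaries (c := c)
    (by
      intro i
      fin_cases i
      exacts [isOpen_core, isOpen_band, isOpen_band.preimage swap.continuous])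
    (fun x => by
      rcases mem_cover x with h | h | h
      exacts [⟨0, h⟩, ⟨1, h⟩, ⟨2, h⟩]) u
    (fun i j x hx => by
      by_cases hij : i = j
      · subst hij
        simp
      · filter_upwards [hloc i j hij x hx.1 hx.2, hloc j i (Ne.symm hij) x hx.2 hx.1] with y h1 h2 _
        rw [h1, h2])
  refine ⟨F, ?_, ?_⟩
  · rw [val_rowLoop_eq F (1 / 4) (-(1 / 4)), hF 0 _ mem_core_right, hF 1 _ mem_band_middle,
      hF 0 _ mem_core_left]
    change (1 : G)⁻¹ * 1 * ((jump a _)⁻¹ * jump a _) * (1⁻¹ * 1) = a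
    rw [jump_plane_pos a (by norm_num), jump_plane_neg a (by norm_num)]
    group
  · have h0 : (F.comap swap).val (seg (seg_row_subset (1 / 2) (1 / 4))) = 1 := by
      rw [Holonomy.comap_val, hF 0 _ fun t => swap_mem_core.2 (mem_core_right t)]
      change (1 : G)⁻¹ * 1 = 1
      group
    have h1 : (F.comap swap).val (seg (seg_row_subset (-(1 / 4)) (-(1 / 2)))) = 1 := by
      rw [Holonomy.comap_val, hF 0 _ fun t => swap_mem_core.2 (mem_core_left t)]
      change (1 : G)⁻¹ * 1 = 1
      group
    have h2 : (F.comap swap).val (seg (seg_row_subset (1 / 4) (-(1 / 4)))) = b := by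
      rw [Holonomy.comap_val, hF 2 _ fun t => mem_band_middle t]
      change (jump b (plane (1 / 4, 1 / 2)))⁻¹ * jump b (plane (-(1 / 4), 1 / 2)) = b
      rw [jump_plane_pos b (by norm_num), jump_plane_neg b (by norm_num)]
      group
    rw [← val_colLoop, val_rowLoop_eq _ (1 / 4) (-(1 / 4)), h0, h1, h2]
    group

/-- The values on the two generators can be prescribed. -/
theorem exists_holonomy (a b : G) :
    ∃ F : Holonomy Handle G, F.val loopA = a ∧ F.val loopB = b := by
  obtain ⟨F, ha, hb⟩ := exists_holonomy_centre a b
  -- Conjugation by the value on `tail` moves the base point from the centre to the boundary.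
  refine ⟨F.gauge fun _ => (F.val tail)⁻¹, ?_, ?_⟩
  · rw [Holonomy.gauge_val, val_loopA, ha]; group
  · rw [Holonomy.gauge_val, val_loopB, hb]; group

end Existence

section Uniqueness

variable (F F' : Holonomy Handle G)

/-- The loop is natural because both functors agree on it and `e` is `1` at the centre. Its outer
thirds lie in the open square, so the remaining part, which crosses the seam, is natural too. -/
theorem natAlong_middle {e : Handle → G} (h : F.val rowLoop = F'.val rowLoop) (h1 : e centre = 1)
    (he : ∀ ⦃x y⦄ (γ : Path x y), (∀ t, γ t ∈ core) → F.NatAlong F' e γ) :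
    F.NatAlong F' e (seg (seg_row_subset (1 / 4) (-(1 / 4)))) := by
  have n1 := he _ mem_core_right
  have n3 := he _ mem_core_left
  rw [val_rowLoop_eq F (1 / 4) (-(1 / 4)), val_rowLoop_eq F' (1 / 4) (-(1 / 4))] at h
  unfold Holonomy.NatAlong at *
  have hl : e (plane (-(1 / 2), 1 / 2)) = 1 := by rw [plane_left, h1]
  have hr : e (plane (1 / 2, 1 / 2)) = 1 := h1
  rw [hl, mul_one] at n3
  rw [hr, one_mul] at n1
  rw [← n3, n1, mul_assoc, mul_assoc, mul_assoc, mul_right_inj, ← mul_assoc, ← mul_assoc,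
    mul_left_inj] at h
  exact h.symm

theorem vertical_subset {v : ℝ × ℝ} (hv : v ∈ domain) (h2 : v.2 ∈ Icc (0 : ℝ) 1) :
    segment ℝ v (v.1, 1 / 2) ⊆ domain := by
  rintro w ⟨a, b, ha, hb, hab, rfl⟩
  have e : a • v + b • (v.1, (1 / 2 : ℝ)) = (v.1, 1 / 2 + a * (v.2 - 1 / 2)) := by
    ext
    · simp only [Prod.fst_add, Prod.smul_fst, smul_eq_mul]
      linear_combination v.1 * hab
    · simp only [Prod.snd_add, Prod.smul_snd, smul_eq_mul]
      linear_combination (1 / 2) * hab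
  rw [e]
  exact mem_domain_of_le hv le_rfl (norm_le_norm_scale h2 ⟨ha, by linarith⟩).2

/-- The open square and the band overlap on two sides of the seam. A transformation on the band can
be normalized on one side, at `(1 / 4, 1 / 2)`; `hm` ensures that it fits on the other. -/
theorem exists_natAlong_band {e : Handle → G}
    (he : ∀ ⦃x y⦄ (γ : Path x y), (∀ t, γ t ∈ core) → F.NatAlong F' e γ)
    (hm : F.NatAlong F' e (seg (seg_row_subset (1 / 4) (-(1 / 4))))) :
    ∃ e' : Handle → G, (∀ ⦃x y⦄ (γ : Path x y), (∀ t, γ t ∈ band) → F.NatAlong F' e' γ) ∧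
      ∀ p ∈ core, p ∈ band → e' p = e p := by
  obtain ⟨e', h1, he'⟩ := Holonomy.exists_natAlong contractsTo_band F F' (plane (1 / 4, 1 / 2))
    (e (plane (1 / 4, 1 / 2)))
  have h2 : e' (plane (-(1 / 4), 1 / 2)) = e (plane (-(1 / 4), 1 / 2)) :=
    (he' _ mem_band_middle).eq_of_eq hm h1
  refine ⟨e', he', fun p hpc hpb => ?_⟩
  let v := pull (-(1 / 2)) 0 p
  have hp : plane v = p := plane_pull _ _ p
  have hv1 : v.1 ∈ Ioo (-(1 / 2) : ℝ) (1 / 2) := by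
    have := rep_mem (-(1 / 2)) p.val.1
    exact ⟨lt_rep hpb.1, this.2.trans_le (by norm_num)⟩
  have hv0 : v.1 ≠ 0 := fun e => hpc.1 (by rw [← coe_rep (-(1 / 2)) p.val.1]; exact congr_arg _ e)
  have hv2 : v.2 ∈ Ioo (0 : ℝ) 1 := by
    have := rep_mem 0 p.val.2
    exact ⟨lt_rep hpc.2, this.2.trans_le (by norm_num)⟩
  have step {w : ℝ × ℝ} (h : segment ℝ v w ⊆ domain) (hw : ∀ z ∈ segment ℝ v w,
      z.1 ≠ 0 ∧ |z.1| < 1 / 2 ∧ z.2 ∈ Ioo (0 : ℝ) 1) (hew : e' (plane w) = e (plane w)) :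
      e' p = e p := by
    rw [← hp]
    exact (he' (seg h) fun t => plane_mem_band (h (lineMap_mem_segment v w t))
      (hw _ (lineMap_mem_segment v w t)).2.1 (hw _ (lineMap_mem_segment v w t)).2.2).eq_of_eq_left
      (he (seg h) fun t => plane_mem_core (h (lineMap_mem_segment v w t))
      (hw _ (lineMap_mem_segment v w t)).1 ((hw _ (lineMap_mem_segment v w t)).2.1.trans (by norm_num))
      (hw _ (lineMap_mem_segment v w t)).2.2) hew
  have step' {x y : ℝ} (hw : ∀ z ∈ segment ℝ x y, z ≠ 0 ∧ |z| < 1 / 2)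
      (hew : e' (plane (y, 1 / 2)) = e (plane (y, 1 / 2))) :
      e' (plane (x, 1 / 2)) = e (plane (x, 1 / 2)) :=
    (he' (seg (seg_row_subset x y)) (seg_row_mem_band fun z hz => (hw z hz).2)).eq_of_eq_left
      (he _ (seg_row_mem_core fun z hz => ⟨(hw z hz).1, (hw z hz).2.trans (by norm_num)⟩)) hew
  -- A point of the overlap is moved vertically to the row `1 / 2`, away from the disk, and then
  -- along the row to `1 / 4` or `-1 / 4`, without crossing the seam.
  refine step (vertical_subset (pull_mem _ _ p) ⟨hv2.1.le, hv2.2.le⟩) (fun z hz => ?_) ?_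
  · have hz1 : z.1 = v.1 := by
      obtain ⟨a, b, -, -, hab, rfl⟩ := hz
      simp only [Prod.fst_add, Prod.smul_fst, smul_eq_mul]
      linear_combination v.1 * hab
    have hz2 : z.2 ∈ Ioo (0 : ℝ) 1 :=
      ((convex_Ioo (0 : ℝ) 1).linear_preimage (LinearMap.snd ℝ ℝ ℝ)).segment_subset
        (x := v) (y := (v.1, 1 / 2)) hv2 (by norm_num) hz
    rw [hz1]
    exact ⟨hv0, abs_lt.2 hv1, hz2⟩
  · rcases lt_or_gt_of_ne hv0 with h | h
    · refine step' (y := -(1 / 4)) (fun z hz => ?_) h2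
      have := (convex_Ioo (-(1 / 2) : ℝ) 0).segment_subset ⟨hv1.1, h⟩ (by norm_num) hz
      exact ⟨this.2.ne, abs_lt.2 ⟨this.1, by linarith [this.2]⟩⟩
    · refine step' (y := 1 / 4) (fun z hz => ?_) h1
      have := (convex_Ioo (0 : ℝ) (1 / 2)).segment_subset ⟨h, hv1.2⟩ (by norm_num) hz
      exact ⟨this.1.ne', abs_lt.2 ⟨by linarith [this.1], this.2⟩⟩

theorem exists_natAlong_centre (ha : F.val rowLoop = F'.val rowLoop)
    (hb : F.val colLoop = F'.val colLoop) :
    ∃ e : Handle → G, e centre = 1 ∧ ∀ ⦃x y⦄ (γ : Path x y), F.NatAlong F' e γ := by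
  classical
  obtain ⟨e, h1, he⟩ := Holonomy.exists_natAlong contractsTo_core F F' centre 1
  have hcs : swap centre = centre := by
    rw [centre, swap_plane (row_subset rfl)]
    rfl
  obtain ⟨e₁, he₁, h₁⟩ := exists_natAlong_band F F' he (natAlong_middle F F' ha h1 he)
  have hes : ∀ ⦃x y⦄ (γ : Path x y), (∀ t, γ t ∈ core) →
      (F.comap swap).NatAlong (F'.comap swap) (e ∘ swap) γ := fun x y γ hγ =>
    he (γ.map swap.continuous) fun t => swap_mem_core.2 (hγ t)
  obtain ⟨e₂, he₂, h₂⟩ := exists_natAlong_band (F.comap swap) (F'.comap swap) hes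
    (natAlong_middle _ _ (by rw [val_colLoop, val_colLoop, hb]) (by rw [Function.comp, hcs, h1]) hes)
  let f : Handle → G := fun p => if p ∈ core then e p else if p ∈ band then e₁ p else e₂ (swap p)
  have f0 : ∀ p ∈ core, e p = f p := fun p hp => (if_pos hp).symm
  have f1 : ∀ p ∈ band, e₁ p = f p := fun p hp => by
    by_cases hc : p ∈ core
    · rw [← f0 p hc]
      exact h₁ p hc hp
    · simp only [f]
      rw [if_neg hc, if_pos hp]
  have f2 : ∀ p, swap p ∈ band → e₂ (swap p) = f p := fun p hp => by
    by_cases hc : p ∈ core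
    · rw [← f0 p hc]
      exact h₂ _ (swap_mem_core.2 hc) hp
    -- The band and its mirror image meet only inside the open square, so no compatibility between
    -- `e₁` and `e₂` needs to be checked.
    · have hb : p ∉ band := fun hb => hc ⟨hp.2, hb.2⟩
      simp only [f]
      rw [if_neg hc, if_neg hb]
  refine ⟨f, ?_, fun x y γ => ?_⟩
  · have : centre ∈ core := by
      have := mem_core_right 0
      rwa [Path.source] at this
    rw [← f0 _ this, h1]
  · refine Holonomy.natAlong_of_openCover (c := ![core, band, swap ⁻¹' band])
      (by
        intro i
        fin_cases i
        exacts [isOpen_core, isOpen_band, isOpen_band.preimage swap.continuous])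
      (fun x => by
        rcases mem_cover x with h | h | h
        exacts [⟨0, h⟩, ⟨1, h⟩, ⟨2, h⟩]) (fun i x y γ hγ => ?_) γ
    have hx := hγ 0
    have hy := hγ 1
    rw [γ.source] at hx
    rw [γ.target] at hy
    fin_cases i
    · exact (he γ hγ).congr_left (f0 _ hx) (f0 _ hy)
    · exact (he₁ γ hγ).congr_left (f1 _ hx) (f1 _ hy)
    · have h := he₂ (γ.map swap.continuous) hγ
      have e1 (H : Holonomy Handle G) :
          H.val ((γ.map swap.continuous).map swap.continuous) = H.val γ :=
        H.val_congr _ _ fun t => rfl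
      unfold Holonomy.NatAlong
      rw [← f2 x hx, ← f2 y hy, ← e1 F, ← e1 F']
      exact h

/-- Functors that agree on the two generators are naturally isomorphic. -/
theorem exists_natAlong (ha : F.val loopA = F'.val loopA) (hb : F.val loopB = F'.val loopB) :
    ∃ e : Handle → G, e (rimMap 1) = 1 ∧ ∀ ⦃x y⦄ (γ : Path x y), F.NatAlong F' e γ := by
  -- Agreement on the loops at the boundary becomes agreement at the centre after conjugating `F'`
  -- by this element, which accounts for the different values on `tail`.
  set g := (F.val tail)⁻¹ * F'.val tail with hg
  rw [val_loopA, val_loopA] at ha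
  rw [val_loopB, val_loopB] at hb
  obtain ⟨e, h1, he⟩ := exists_natAlong_centre F (F'.gauge fun _ => g)
    (by
      rw [Holonomy.gauge_val, hg]
      calc F.val rowLoop = (F.val tail)⁻¹ * (F.val tail * F.val rowLoop * (F.val tail)⁻¹) * F.val tail := by group
        _ = _ := by rw [ha]; group)
    (by
      rw [Holonomy.gauge_val, hg]
      calc F.val colLoop = (F.val tail)⁻¹ * (F.val tail * F.val colLoop * (F.val tail)⁻¹) * F.val tail := by group
        _ = _ := by rw [hb]; group)
  refine ⟨fun p => e p * g, ?_, fun x y γ => (he γ).of_gauge⟩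
  have h := (he tail).of_gauge
  unfold Holonomy.NatAlong at h
  dsimp only at h ⊢
  rw [h1, one_mul, hg] at h
  rw [hg]
  have h' : e (rimMap 1) * ((F.val tail)⁻¹ * F'.val tail) * F'.val tail = 1 * F'.val tail := by
    rw [h]; group
  exact mul_right_cancel h'

end Uniqueness

end CompactSurface.Handle

end

/-! ### The collar of the boundary of the handle -/

section

open Set Topology Filter
open scoped unitInterval

set_option linter.unusedSectionVars false

theorem ContractsTo.joined {X : Type*} [TopologicalSpace X] {C : Set X} {p x : X}
    (hC : ContractsTo C p) (hx : x ∈ C) : Joined p x := by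
  obtain ⟨H, hH, hp⟩ := hC
  exact ⟨⟨⟨H x, hH.comp_continuous (f := fun t => (x, t)) (by fun_prop) fun t => ⟨hx, mem_univ _⟩⟩,
    (hp x hx).1, (hp x hx).2⟩⟩

namespace Circle

theorem exists_coe_eq {z : ℂ} (h : z ≠ 0) : ∃ w : Circle, (w : ℂ) = z / ‖z‖ :=
  ⟨⟨z / ‖z‖, by
    rw [Submonoid.unitSphere, ← SetLike.mem_coe]
    simp [h]⟩, rfl⟩

open Classical in
/-- The radial projection of the plane to the unit circle. -/
noncomputable def radial (z : ℂ) : Circle :=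
  if h : z = 0 then 1 else (exists_coe_eq h).choose

theorem coe_radial {z : ℂ} (h : z ≠ 0) : ((radial z : Circle) : ℂ) = z / ‖z‖ := by
  unfold radial
  rw [dif_neg h]
  exact (exists_coe_eq h).choose_spec

theorem continuousOn_radial : ContinuousOn radial {z : ℂ | z ≠ 0} := by
  refine IsInducing.subtypeVal.continuousOn_iff.2 ?_
  refine ContinuousOn.congr (f := fun z : ℂ => z / ‖z‖) ?_ fun z hz => coe_radial hz
  exact continuousOn_id.div (by fun_prop) fun z hz => by simpa using hz

theorem radial_smul (z : Circle) {r : ℝ} (hr : 0 < r) : radial (z * r) = z := by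
  have hz : ‖(z : ℂ)‖ = 1 := Circle.norm_coe z
  have h0 : (z : ℂ) * r ≠ 0 := mul_ne_zero (Circle.coe_ne_zero z) (by exact_mod_cast hr.ne')
  refine Subtype.ext ((coe_radial h0).trans ?_)
  have : (r : ℂ) ≠ 0 := by exact_mod_cast hr.ne'
  rw [norm_mul, hz, one_mul, Complex.norm_real, Real.norm_eq_abs, abs_of_pos hr, mul_div_assoc,
    div_self this, mul_one]

end Circle

namespace CompactSurface.Handle

open AddCircle

instance : T2Space Handle :=
  inferInstanceAs (T2Space
    {p : AddCircle (1 : ℝ) × AddCircle (1 : ℝ) // (1 / 4 : ℝ) ^ 2 ≤ ‖p.1‖ ^ 2 + ‖p.2‖ ^ 2})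

instance : PathConnectedSpace Handle := by
  have h0 : Joined centre (plane (0, 1 / 2)) := ⟨seg (seg_row_subset (1 / 2) 0)⟩
  have hc : Joined (swap centre) centre := by
    rw [centre, swap_plane (row_subset rfl)]
    exact Joined.refl _
  have h (p : Handle) : Joined centre p := by
    rcases mem_cover p with hp | hp | hp
    · exact contractsTo_core.joined hp
    · exact h0.trans (contractsTo_band.joined hp)
    · exact hc.symm.trans ((h0.trans (contractsTo_band.joined hp)).map swap.continuous)
  exact ⟨⟨centre⟩, fun x y => (h x).symm.trans (h y)⟩

/-- The chart around the boundary. -/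
noncomputable def polar (p : Handle) : ℂ :=
  ⟨(pull (-(1 / 2)) (-(1 / 2)) p).1, (pull (-(1 / 2)) (-(1 / 2)) p).2⟩

/-- A neighbourhood of the boundary. -/
def collarNbhd : Set Handle := {p | ‖p.val.1‖ ^ 2 + ‖p.val.2‖ ^ 2 < 1 / 4}

theorem norm_rep (p : AddCircle (1 : ℝ)) : |rep (-(1 / 2)) p| ≤ 1 / 2 ∧ ‖p‖ = |rep (-(1 / 2)) p| := by
  have h := rep_mem (-(1 / 2)) p
  have h1 : |rep (-(1 / 2)) p| ≤ 1 / 2 := abs_le.2 ⟨h.1, h.2.le.trans (by norm_num)⟩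
  refine ⟨h1, ?_⟩
  rw [← norm_coe_of_abs_le h1, coe_rep]

theorem sq_norm_polar (p : Handle) : ‖polar p‖ ^ 2 = ‖p.val.1‖ ^ 2 + ‖p.val.2‖ ^ 2 := by
  rw [Complex.sq_norm, Complex.normSq_apply, (norm_rep _).2, (norm_rep _).2, sq_abs, sq_abs, ← sq, ← sq]
  rfl

theorem quarter_le_norm_polar (p : Handle) : 1 / 4 ≤ ‖polar p‖ := by
  refine le_of_sq_le_sq ?_ (norm_nonneg _)
  rw [sq_norm_polar]
  exact p.2

theorem polar_ne_zero (p : Handle) : polar p ≠ 0 :=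
  norm_pos_iff.1 (lt_of_lt_of_le (by norm_num) (quarter_le_norm_polar p))

theorem ne_of_mem_collarNbhd {p : Handle} (hp : p ∈ collarNbhd) :
    p.val.1 ≠ ((-(1 / 2) : ℝ) : AddCircle (1 : ℝ)) ∧
      p.val.2 ≠ ((-(1 / 2) : ℝ) : AddCircle (1 : ℝ)) := by
  have hp : ‖p.val.1‖ ^ 2 + ‖p.val.2‖ ^ 2 < 1 / 4 := hp
  -- The collar has outer radius `1 / 2`, so neither coordinate reaches the cut at `-1 / 2` and the
  -- chart is continuous on it.
  constructor <;> intro e <;> rw [e, coe_neg_half, norm_coe_half] at hp <;> nlinarith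

theorem continuousOn_polar : ContinuousOn polar collarNbhd := by
  have h := continuousOn_pull (U := collarNbhd) fun p hp => ne_of_mem_collarNbhd hp
  have : Continuous fun v : ℝ × ℝ => Complex.equivRealProdCLM.symm v := by fun_prop
  exact this.comp_continuousOn h

/-- The radial deformation to the boundary. -/
noncomputable def shrink (p : Handle) (t : I) : Handle :=
  plane (((1 - t) / (4 * ‖polar p‖) + t) * (polar p).re, ((1 - t) / (4 * ‖polar p‖) + t) * (polar p).im)

/-- The scaled modulus is `(1 - t) / 4 + t * r`, which is at least `1 / 4` because `r` is. The
scaling factor is at most `1`, so the coordinates stay in the range where the norm on the circle is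
the absolute value. -/
theorem shrink_mem (p : Handle) (t : I) :
    (((1 - t) / (4 * ‖polar p‖) + t) * (polar p).re,
      ((1 - t) / (4 * ‖polar p‖) + t) * (polar p).im) ∈ domain := by
  have hr := quarter_le_norm_polar p
  set r := ‖polar p‖
  set s : ℝ := (1 - t) / (4 * r) + t
  have ht0 := t.2.1
  have ht1 := t.2.2
  have hr0 : 0 < r := by linarith
  have hsr : 1 / 4 ≤ s * r := by
    have : s * r = (1 - t) / 4 + t * r := by
      simp only [s]
      field_simp
    rw [this]
    nlinarith
  have hs0 : 0 ≤ s := add_nonneg (div_nonneg (by linarith) (by linarith)) ht0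
  have hs1 : s ≤ 1 := by
    have : (1 - (t : ℝ)) / (4 * r) ≤ 1 - t := div_le_self (by linarith) (by linarith)
    simp only [s]
    linarith
  have habs {x : ℝ} (hx : |x| ≤ 1 / 2) : |s * x| ≤ 1 / 2 := by
    rw [abs_mul, abs_of_nonneg hs0]
    nlinarith [abs_nonneg x]
  have h1 : |(polar p).re| ≤ 1 / 2 := (norm_rep _).1
  have h2 : |(polar p).im| ≤ 1 / 2 := (norm_rep _).1
  rw [domain, mem_ofPred_eq]
  dsimp only
  rw [norm_coe_of_abs_le (habs h1), norm_coe_of_abs_le (habs h2), sq_abs, sq_abs]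
  have hsq : r ^ 2 = (polar p).re ^ 2 + (polar p).im ^ 2 := by
    simp only [r]
    rw [Complex.sq_norm, Complex.normSq_apply, sq, sq]
  calc (1 / 4 : ℝ) ^ 2 ≤ (s * r) ^ 2 := pow_le_pow_left₀ (by norm_num) hsr 2
    _ = _ := by rw [mul_pow, hsq]; ring

theorem polar_rim (z : Circle) : polar (rim z) = z * ((1 / 4 : ℝ) : ℂ) := by
  have h := abs_re_div_le z
  have mem {x : ℝ} (hx : |x| ≤ 1 / 4) : x ∈ Ico (-(1 / 2) : ℝ) (-(1 / 2) + 1) := by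
    rw [abs_le] at hx
    constructor <;> linarith
  rw [rim_eq, polar, pull, val_plane (rim_mem_domain z)]
  dsimp only
  rw [rep_coe (mem h.1), rep_coe (mem h.2)]
  apply Complex.ext
  · rw [Complex.re_mul_ofReal]; ring
  · rw [Complex.im_mul_ofReal]; ring

/-- The collar of the boundary of the handle. -/
noncomputable def collar : Collar rimMap where
  nbhd := collarNbhd
  isOpen_nbhd := isOpen_lt (by have := continuous_val; fun_prop) continuous_const
  isClosed_range := (isCompact_range rimMap.continuous).isClosed
  mem_nbhd z := by
    change ‖(rimMap z).val.1‖ ^ 2 + ‖(rimMap z).val.2‖ ^ 2 < 1 / 4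
    rw [← sq_norm_polar, rimMap_apply, polar_rim, norm_mul, Circle.norm_coe]
    norm_num
  proj p := Circle.radial (polar p)
  continuousOn_proj := Circle.continuousOn_radial.comp continuousOn_polar fun p _ => polar_ne_zero p
  proj_apply z := by
    rw [rimMap_apply, polar_rim, Circle.radial_smul z (by norm_num)]
  homotopy := shrink
  continuousOn_homotopy := by
    refine continuousOn_plane.comp ?_ fun q _ => shrink_mem q.1 q.2
    have h : ContinuousOn (fun q : Handle × I => polar q.1) (collarNbhd ×ˢ univ) :=
      continuousOn_polar.comp continuous_fst.continuousOn fun q hq => hq.1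
    have ht : ContinuousOn (fun q : Handle × I => (q.2 : ℝ)) (collarNbhd ×ˢ univ) := by fun_prop
    have hs : ContinuousOn (fun q : Handle × I => (1 - (q.2 : ℝ)) / (4 * ‖polar q.1‖) + q.2)
        (collarNbhd ×ˢ univ) :=
      ((continuousOn_const.sub ht).div (continuousOn_const.mul h.norm) fun q _ => by
        simpa using polar_ne_zero q.1).add ht
    exact (hs.mul (Complex.continuous_re.comp_continuousOn h)).prodMk
      (hs.mul (Complex.continuous_im.comp_continuousOn h))
  homotopy_zero p _ := by
    rw [rimMap_apply, rim_eq, shrink, Circle.coe_radial (polar_ne_zero p), Complex.div_ofReal_re,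
      Complex.div_ofReal_im]
    have : ‖polar p‖ ≠ 0 := norm_ne_zero_iff.2 (polar_ne_zero p)
    congr 2 <;> · simp; field_simp
  homotopy_one p _ := by
    rw [shrink]
    simp only [Icc.coe_one, sub_self, zero_div, zero_add, one_mul]
    exact plane_pull _ _ p
  homotopy_apply z t := by
    rw [shrink, rimMap_apply, polar_rim, norm_mul, Circle.norm_coe, rim_eq, Complex.re_mul_ofReal,
      Complex.im_mul_ofReal]
    norm_num
    congr 2 <;> ring

end CompactSurface.Handle

end

/-! ### Functors on the circle, and deformation retracts -/

section

open Set Topology Filter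
open scoped unitInterval

set_option linter.unusedSectionVars false

theorem Topology.IsQuotientMap.continuousOn_prod {X Y T : Type*} [TopologicalSpace X]
    [TopologicalSpace Y] [TopologicalSpace T] {q : Y → X} (hq : IsQuotientMap q) {f : X × I → T}
    {U : Set X} (hU : IsOpen U)
    (hf : ContinuousOn (fun p : Y × I => f (q p.1, p.2)) ((q ⁻¹' U) ×ˢ univ)) :
    ContinuousOn f (U ×ˢ univ) := by
  have := (hq.restrictPreimage_isOpen hU).continuous_lift_prod_left (Y := I)
    (g := fun p => f (p.1.1, p.2))
    (hf.comp_continuous (f := fun p : (q ⁻¹' U) × I => (p.1.1, p.2)) (by fun_prop)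
      (fun p => ⟨p.1.2, mem_univ _⟩))
  rw [continuousOn_iff_continuous_domRestrict]
  exact this.comp (f := fun p : (U ×ˢ univ : Set (X × I)) => ((⟨p.1.1, p.2.1⟩ : U), p.1.2))
    (by fun_prop)

namespace Circle

/-- A function on an interval with equal values at the end points descends to the circle. -/
theorem exists_desc {Z : Type*} [TopologicalSpace Z] {f : ℝ → Z} (h0 : f 0 = f (2 * Real.pi))
    (hf : ContinuousOn f (Icc 0 (2 * Real.pi))) :
    ∃ φ : C(Circle, Z), ∀ θ ∈ Icc 0 (2 * Real.pi), φ (Circle.exp θ) = f θ := by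
  have : Fact (0 < 2 * Real.pi) := ⟨Real.two_pi_pos⟩
  have hc := AddCircle.liftIco_continuous (p := 2 * Real.pi) (a := 0) (f := f) (by rw [zero_add, h0])
    (by rwa [zero_add])
  refine ⟨⟨_, hc.comp AddCircle.homeomorphCircle'.symm.continuous⟩, fun θ hθ => ?_⟩
  have hsymm (x : ℝ) : AddCircle.homeomorphCircle'.symm (Circle.exp x) = (x : AddCircle (2 * Real.pi)) := by
    rw [← AddCircle.homeomorphCircle'_apply_mk, Homeomorph.symm_apply_apply]
  change AddCircle.liftIco (2 * Real.pi) 0 f (AddCircle.homeomorphCircle'.symm (Circle.exp θ)) = f θ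
  rcases hθ.2.lt_or_eq with h | h
  · rw [hsymm, AddCircle.liftIco_coe_apply ⟨hθ.1, by rwa [zero_add]⟩]
  · rw [h, Circle.exp_two_pi, ← Circle.exp_zero, hsymm, AddCircle.liftIco_coe_apply
      ⟨le_rfl, by rw [zero_add]; exact Real.two_pi_pos⟩, h0]

/-- The value on the loop can be prescribed. -/
theorem exists_holonomy {G : Type*} [Group G] (g : G) :
    ∃ F : Holonomy Circle G, F.val Circle.loop = g := by
  classical
  -- This function is locally constant except at `1` and `-1`, each of which is missing from one
  -- chart. It is used as primitive on the chart without `-1`, so that only the passage through `1`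
  -- counts.
  let v : Circle → G := fun z => if 0 ≤ (z : ℂ).im then g else 1
  let c : Bool → Set Circle := fun b => bif b then {z | z ≠ 1} else {z | z ≠ Circle.exp Real.pi}
  let u : Bool → Circle → G := fun b z => bif b then 1 else v z
  have him : ∀ z : Circle, z ≠ 1 → z ≠ Circle.exp Real.pi → (z : ℂ).im ≠ 0 := by
    intro z h1 h2 h0
    have hn := Circle.normSq_coe z
    rw [Complex.normSq_apply, h0] at hn
    have : ((z : ℂ).re - 1) * ((z : ℂ).re + 1) = 0 := by linear_combination hn
    rcases mul_eq_zero.1 this with h | h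
    · exact h1 (Subtype.ext (Complex.ext (by simp; linarith) (by simp [h0])))
    · refine h2 (Subtype.ext (Complex.ext ?_ ?_))
      · rw [Circle.coe_exp, Complex.exp_pi_mul_I]; simp; linarith
      · rw [Circle.coe_exp, Complex.exp_pi_mul_I]; simp [h0]
  have hloc : ∀ z : Circle, z ≠ 1 → z ≠ Circle.exp Real.pi → ∀ᶠ w in 𝓝 z, v w = v z := by
    intro z h1 h2
    have hc : ContinuousAt (fun z : Circle => (z : ℂ).im) z := by fun_prop
    rcases lt_or_gt_of_ne (him z h1 h2) with h | h
    · filter_upwards [hc.eventually_lt_const h] with w hw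
      simp only [v]
      rw [if_neg hw.not_ge, if_neg h.not_ge]
    · filter_upwards [hc.eventually_const_lt h] with w hw
      simp only [v]
      rw [if_pos hw.le, if_pos h.le]
  have hne : (1 : Circle) ≠ Circle.exp Real.pi := fun e => by
    have := congr_arg (fun z : Circle => (z : ℂ).re) e
    simp only [Circle.coe_exp, Complex.exp_pi_mul_I] at this
    norm_num at this
  obtain ⟨F, hF⟩ := Holonomy.exists_of_coboundaries (c := c)
    (by rintro (_ | _) <;> exact isOpen_ne)
    (fun x => by
      by_cases h : x = 1
      · exact ⟨false, h ▸ hne⟩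
      · exact ⟨true, h⟩) u
    (by
      rintro (_ | _) (_ | _) x hx
      · simp
      · filter_upwards [hloc x hx.2 hx.1] with y hy _
        simp [u, hy]
      · filter_upwards [hloc x hx.1 hx.2] with y hy _
        simp [u, hy]
      · simp)
  have hpi := Real.pi_pos
  have harc (a b : ℝ) (hab : a ≤ b) (t : I) : ∃ θ ∈ Icc a b, Circle.arc a b t = Circle.exp θ := by
    rw [Circle.arc_apply]
    exact ⟨_, ⟨by nlinarith [t.2.1], by nlinarith [t.2.2]⟩, rfl⟩
  have hcos : ∀ θ : ℝ, Circle.exp θ = 1 → Real.cos θ = 1 := fun θ h => by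
    have := congr_arg (fun z : Circle => (z : ℂ).re) h
    simp only [Circle.coe_exp, Complex.exp_ofReal_mul_I_re] at this
    simpa using this
  have hcos' : ∀ θ : ℝ, Circle.exp θ = Circle.exp Real.pi → Real.cos θ = -1 := fun θ h => by
    have := congr_arg (fun z : Circle => (z : ℂ).re) h
    simp only [Circle.coe_exp, Complex.exp_ofReal_mul_I_re, Real.cos_pi] at this
    exact this
  -- The loop is split into three arcs, each in one chart. The first two contribute `1`, and the
  -- last one leads from the lower half, where `v` is `1`, back to the point `1`, where it is `g`.
  have h1 : F.val (Circle.arc 0 (Real.pi / 2)) = (v (Circle.exp 0))⁻¹ * v (Circle.exp (Real.pi / 2)) :=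
    hF false _ fun t h => by
      obtain ⟨θ, hθ, e⟩ := harc 0 (Real.pi / 2) (by linarith) t
      have := hcos' θ (e.symm.trans h)
      have := Real.cos_nonneg_of_neg_pi_div_two_le_of_le (by linarith [hθ.1]) hθ.2
      linarith
  have h2 : F.val (Circle.arc (Real.pi / 2) (3 * Real.pi / 2)) = 1⁻¹ * 1 :=
    hF true _ fun t h => by
      obtain ⟨θ, hθ, e⟩ := harc (Real.pi / 2) (3 * Real.pi / 2) (by linarith) t
      have := hcos θ (e.symm.trans h)
      have := Real.cos_nonpos_of_pi_div_two_le_of_le (x := θ) (by linarith [hθ.1]) (by linarith [hθ.2])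
      linarith
  have h3 : F.val (Circle.arc (3 * Real.pi / 2) (2 * Real.pi)) =
      (v (Circle.exp (3 * Real.pi / 2)))⁻¹ * v (Circle.exp (2 * Real.pi)) :=
    hF false _ fun t h => by
      obtain ⟨θ, hθ, e⟩ := harc (3 * Real.pi / 2) (2 * Real.pi) (by linarith) t
      have := hcos' θ (e.symm.trans h)
      have := Real.cos_nonneg_of_neg_pi_div_two_le_of_le (x := θ - 2 * Real.pi)
        (by linarith [hθ.1]) (by linarith [hθ.2])
      rw [Real.cos_sub_two_pi] at this
      linarith
  have hv (θ : ℝ) : v (Circle.exp θ) = if 0 ≤ Real.sin θ then g else 1 := by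
    simp only [v, Circle.coe_exp, Complex.exp_ofReal_mul_I_im]
  have e3s : Real.sin (3 * Real.pi / 2) = -1 := by
    rw [show 3 * Real.pi / 2 = Real.pi / 2 + Real.pi by ring, Real.sin_add_pi, Real.sin_pi_div_two]
  refine ⟨F, ?_⟩
  have hloop : F.val Circle.loop = F.val ((Circle.arc 0 (2 * Real.pi)).map (ContinuousMap.id Circle).continuous) := by
    refine F.val_congr _ _ fun t => ?_
    change Circle.loop t = Circle.arc 0 (2 * Real.pi) t
    rw [Circle.loop_apply, Circle.arc_apply]
    congr 1
    ring
  have hid (a b : ℝ) : F.val ((Circle.arc a b).map (ContinuousMap.id Circle).continuous) = F.val (Circle.arc a b) :=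
    F.val_congr _ _ fun _ => rfl
  rw [hloop, F.val_arc _ 0 (3 * Real.pi / 2) (2 * Real.pi), F.val_arc _ 0 (Real.pi / 2) (3 * Real.pi / 2), hid,
    hid, hid, h1, h2, h3, hv, hv, hv, hv, e3s, Real.sin_zero, Real.sin_two_pi, Real.sin_pi_div_two]
  norm_num

end Circle

namespace Collar

variable {S B G : Type*} [TopologicalSpace S] [TopologicalSpace B] [Group G] {β : C(S, B)}

/-- Natural isomorphisms extend from a deformation retract. -/
theorem exists_natAlong (κ : Collar β) (hκ : κ.nbhd = univ) {F F' : Holonomy B G} {e : S → G}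
    (he : ∀ ⦃z w : S⦄ (γ : Path z w), (F.comap β).NatAlong (F'.comap β) e γ) :
    ∃ e' : B → G, (∀ z, e' (β z) = e z) ∧ ∀ ⦃x y : B⦄ (γ : Path x y), F.NatAlong F' e' γ := by
  have hproj : Continuous κ.proj := by
    rw [← continuousOn_univ, ← hκ]
    exact κ.continuousOn_proj
  have hH : Continuous fun p : B × I => κ.homotopy p.1 p.2 := by
    rw [← continuousOn_univ, ← univ_prod_univ, ← hκ]
    exact κ.continuousOn_homotopy
  have h0 (b : B) : κ.homotopy b 0 = β (κ.proj b) := κ.homotopy_zero b (hκ ▸ mem_univ b)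
  have h1 (b : B) : κ.homotopy b 1 = b := κ.homotopy_one b (hκ ▸ mem_univ b)
  let h (b : B) : Path (β (κ.proj b)) b := ⟨⟨fun t => κ.homotopy b t, by fun_prop⟩, h0 b, h1 b⟩
  have hβ (F : Holonomy B G) (z : S) : F.val (h (β z)) = 1 := by
    rw [← F.val_refl (β z)]
    exact F.val_congr _ _ fun t => κ.homotopy_apply z t
  -- The only extension that is natural along the lines of the deformation.
  let e' : B → G := fun b => (F.val (h b))⁻¹ * e (κ.proj b) * F'.val (h b)
  have heq (z : S) : e' (β z) = e z := by
    simp only [e']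
    rw [hβ, hβ, κ.proj_apply]
    group
  have hn (b : B) : F.NatAlong F' e' (h b) := by
    unfold Holonomy.NatAlong
    rw [heq]
    simp only [e']
    group
  refine ⟨e', heq, fun x y γ => ?_⟩
  have hb : F.NatAlong F' e' ((γ.map hproj).map β.continuous) := by
    have := he (γ.map hproj)
    unfold Holonomy.NatAlong at *
    rw [heq, heq]
    exact this
  exact Holonomy.NatAlong.square (K := fun p => κ.homotopy (γ p.1) p.2)
    (hH.comp (by fun_prop : Continuous fun p : I × I => (γ p.1, p.2))) _ γ (h x) (h y)
    (fun t => (h0 (γ t)).symm) (fun t => (h1 (γ t)).symm) (fun t => by simp [h]) (fun t => by simp [h])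
    hb (hn x) (hn y)

end Collar

end

/-! ### The Möbius band -/

section

open Set Topology Filter
open scoped unitInterval

set_option linter.unusedSectionVars false

namespace CompactSurface.MobiusBand

theorem isQuotientMap_mk : IsQuotientMap mk := isQuotientMap_quot_mk

theorem continuous_mk : Continuous mk := isQuotientMap_mk.continuous

theorem mk_zero (t : I) : mk (0, t) = mk (1, unitInterval.symm t) := Quot.sound (MobiusRel.glue t)

/-- The parametrization by the plane. -/
noncomputable def plane (v : ℝ × ℝ) : MobiusBand :=
  mk (projIcc 0 1 zero_le_one v.1, projIcc 0 1 zero_le_one v.2)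

theorem continuous_plane : Continuous plane :=
  continuous_mk.comp ((continuous_projIcc.comp continuous_fst).prodMk
    (continuous_projIcc.comp continuous_snd))

theorem plane_coe (x t : I) : plane (x, t) = mk (x, t) := by
  rw [plane, projIcc_val, projIcc_val]

theorem exists_plane_eq (p : MobiusBand) : ∃ x t : I, plane (x, t) = p := by
  obtain ⟨⟨x, t⟩, rfl⟩ := isQuotientMap_mk.surjective p
  exact ⟨x, t, plane_coe x t⟩

theorem plane_zero {t : ℝ} (ht : t ∈ I) : plane (0, t) = plane (1, 1 - t) := by
  have h := mk_zero ⟨t, ht⟩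
  rw [← plane_coe, ← plane_coe] at h
  exact h

/-- A function on the square that respects the identification. -/
def lift {Z : Type*} (φ : ℝ → ℝ → Z) (h : ∀ t ∈ I, φ 0 t = φ 1 (1 - t)) (p : MobiusBand) : Z :=
  Quot.lift (fun p : I × I => φ p.1 p.2) (by
    rintro _ _ ⟨t⟩
    exact h t t.2) p

theorem lift_mk {Z : Type*} (φ : ℝ → ℝ → Z) (h : ∀ t ∈ I, φ 0 t = φ 1 (1 - t)) (p : I × I) :
    lift φ h (mk p) = φ p.1 p.2 := rfl

/-- The distance from the core. -/
noncomputable def dev : MobiusBand → ℝ := lift (fun _ t => |t - 1 / 2|) fun t _ => by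
  rw [abs_sub_comm]; congr 1; ring

theorem dev_mk (p : I × I) : dev (mk p) = |(p.2 : ℝ) - 1 / 2| := rfl

theorem continuous_dev : Continuous dev := by
  refine isQuotientMap_mk.continuous_iff.2 ?_
  exact (by fun_prop : Continuous fun p : I × I => |(p.2 : ℝ) - 1 / 2|)

open Real in
theorem exists_rimMap : ∃ φ : C(Circle, MobiusBand),
    (∀ t : I, φ (Circle.exp (π * t)) = mk (t, 0)) ∧ ∀ t : I, φ (Circle.exp (π * (1 + t))) = mk (t, 1) := by
  have hpi := pi_pos
  -- The two arcs of the boundary fit together through the identification: `(1, 0)` is `(0, 1)` and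
  -- `(1, 1)` is `(0, 0)`.
  obtain ⟨φ, hφ⟩ := Circle.exists_desc
    (f := fun θ => if θ ≤ π then plane (θ / π, 0) else plane (θ / π - 1, 1)) (by
      rw [if_pos hpi.le, if_neg (by linarith), zero_div, plane_zero (by norm_num)]
      congr 2
      · field_simp; norm_num
      · norm_num)
    (by
      refine (Continuous.if_le (continuous_plane.comp (by fun_prop)) (continuous_plane.comp (by fun_prop))
        continuous_id continuous_const fun θ hθ => ?_).continuousOn
      have hθ : θ = π := hθ
      change plane (θ / π, 0) = plane (θ / π - 1, 1)
      rw [hθ, div_self hpi.ne', sub_self, plane_zero (by norm_num)]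
      norm_num)
  refine ⟨φ, fun t => ?_, fun t => ?_⟩
  · rw [hφ _ ⟨by nlinarith [t.2.1], by nlinarith [t.2.2]⟩, if_pos (by nlinarith [t.2.2]),
      mul_div_cancel_left₀ _ hpi.ne', ← plane_coe]
    rfl
  · rw [hφ _ ⟨by nlinarith [t.2.1], by nlinarith [t.2.2]⟩]
    have e : π * (1 + (t : ℝ)) / π = 1 + t := by field_simp
    rcases t.2.1.eq_or_lt with h | h
    · have ht : t = 0 := Subtype.ext h.symm
      subst ht
      rw [if_pos (by simp), e, ← plane_coe]
      have := plane_zero (t := 1) (by norm_num)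
      rw [sub_self] at this
      simpa using this.symm
    · rw [if_neg (by nlinarith), e, add_sub_cancel_left, ← plane_coe]
      rfl

/-- The boundary circle. -/
noncomputable def rimMap : C(Circle, MobiusBand) := exists_rimMap.choose

theorem rimMap_upper (t : I) : rimMap (Circle.exp (Real.pi * t)) = mk (t, 0) :=
  exists_rimMap.choose_spec.1 t

theorem rimMap_lower (t : I) : rimMap (Circle.exp (Real.pi * (1 + t))) = mk (t, 1) :=
  exists_rimMap.choose_spec.2 t

theorem exists_angle (z : Circle) : ∃ t : I, z = Circle.exp (Real.pi * t) ∨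
    z = Circle.exp (Real.pi * (1 + t)) := by
  have hpi := Real.pi_pos
  have h1 := Complex.neg_pi_lt_arg (z : ℂ)
  have h2 := Complex.arg_le_pi (z : ℂ)
  rcases le_total 0 (Complex.arg z) with h | h
  · refine ⟨⟨Complex.arg z / Real.pi, div_nonneg h hpi.le, (div_le_one hpi).2 h2⟩, Or.inl ?_⟩
    dsimp only
    rw [mul_div_cancel₀ _ hpi.ne', Circle.exp_arg]
  · refine ⟨⟨Complex.arg z / Real.pi + 1, ?_, ?_⟩, Or.inr ?_⟩
    · have : -1 ≤ Complex.arg z / Real.pi := by rw [le_div_iff₀ hpi]; linarith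
      linarith
    · have : Complex.arg z / Real.pi ≤ 0 := div_nonpos_of_nonpos_of_nonneg h hpi.le
      linarith
    · dsimp only
      have e : Real.pi * (1 + (Complex.arg z / Real.pi + 1)) = Complex.arg z + 2 * Real.pi := by
        field_simp; ring
      rw [e, Circle.exp_add, Circle.exp_two_pi, mul_one, Circle.exp_arg]

theorem range_rimMap : range rimMap = {p | dev p = 1 / 2} := by
  ext p
  constructor
  · rintro ⟨z, rfl⟩
    obtain ⟨t, rfl | rfl⟩ := exists_angle z
    · rw [rimMap_upper, mem_ofPred_eq, dev_mk]
      norm_num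
    · rw [rimMap_lower, mem_ofPred_eq, dev_mk]
      norm_num
  · obtain ⟨⟨x, t⟩, rfl⟩ := isQuotientMap_mk.surjective p
    intro h
    rw [mem_ofPred_eq, dev_mk, abs_eq (by norm_num)] at h
    rcases h with h | h
    · have : t = 1 := Subtype.ext (show (t : ℝ) = 1 by dsimp only at h; linarith)
      subst this
      exact ⟨_, rimMap_lower x⟩
    · have : t = 0 := Subtype.ext (show (t : ℝ) = 0 by dsimp only at h; linarith)
      subst this
      exact ⟨_, rimMap_upper x⟩

open Real in
open Classical in
/-- The projection of the collar. -/
noncomputable def collarProj : MobiusBand → Circle :=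
  -- The value on the core `t = 1 / 2` is arbitrary, as the core is outside the collar. It is a
  -- separate case because neither of the outer formulas respects the identification there.
  lift (fun x t => if t < 1 / 2 then Circle.exp (π * x) else if t = 1 / 2 then 1 else
    Circle.exp (π * (1 + x))) fun t _ => by
      rcases lt_trichotomy t (1 / 2) with h | h | h
      · rw [if_pos h, if_neg (by linarith), if_neg (by linarith), mul_zero, Circle.exp_zero,
          show π * (1 + 1) = 2 * π by ring, Circle.exp_two_pi]
      · subst h
        norm_num
      · rw [if_neg (by linarith), if_neg (by linarith), if_pos (by linarith), add_zero]

open Classical in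
/-- The deformation of the collar. -/
noncomputable def collarHomotopy (p : MobiusBand) (s : I) : MobiusBand :=
  lift (fun x t => if t < 1 / 2 then plane (x, s * t) else if t = 1 / 2 then plane (0, 0) else
    plane (x, 1 - s * (1 - t))) (fun t ht => by
      rcases lt_trichotomy t (1 / 2) with h | h | h
      · rw [if_pos h, if_neg (by linarith), if_neg (by linarith), plane_zero]
        · ring_nf
        · exact ⟨mul_nonneg s.2.1 ht.1, mul_le_one₀ s.2.2 ht.1 ht.2⟩
      · subst h
        norm_num
      · rw [if_neg (by linarith), if_neg (by linarith), if_pos (by linarith), plane_zero]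
        · ring_nf
        · have h1 : 0 ≤ (s : ℝ) * (1 - t) := mul_nonneg s.2.1 (by linarith [ht.2])
          have h2 : (s : ℝ) * (1 - t) ≤ 1 := mul_le_one₀ s.2.2 (by linarith [ht.2]) (by linarith [ht.1])
          exact ⟨by linarith, by linarith⟩) p

theorem mk_mem_nhbd {p : I × I} : mk p ∈ {p | dev p ≠ 0} ↔ (p.2 : ℝ) ≠ 1 / 2 := by
  rw [mem_ofPred_eq, dev_mk, ne_eq, abs_eq_zero, sub_eq_zero]

theorem continuousOn_trichotomy {Y Z : Type*} [TopologicalSpace Y] [TopologicalSpace Z] {h : Y → ℝ}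
    (hh : Continuous h) {c : ℝ} {f f' : Y → Z} {z : Z} (hf : Continuous f) (hf' : Continuous f') :
    ContinuousOn (fun y => if h y < c then f y else if h y = c then z else f' y) {y | h y ≠ c} := by
  intro y hy
  refine ContinuousAt.continuousWithinAt ?_
  rcases lt_or_gt_of_ne hy with hy | hy
  · refine hf.continuousAt.congr ?_
    filter_upwards [hh.continuousAt.eventually_lt_const hy] with w hw
    rw [if_pos hw]
  · refine hf'.continuousAt.congr ?_
    filter_upwards [hh.continuousAt.eventually_const_lt hy] with w hw
    rw [if_neg hw.not_gt, if_neg hw.ne']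

theorem isOpen_nhbd : IsOpen {p : MobiusBand | dev p ≠ 0} := isOpen_ne.preimage continuous_dev

/-- The collar of the boundary of the Möbius band. -/
noncomputable def collar : Collar rimMap where
  nbhd := {p | dev p ≠ 0}
  isOpen_nbhd := isOpen_nhbd
  isClosed_range := by
    rw [range_rimMap]
    exact isClosed_eq continuous_dev continuous_const
  mem_nbhd z := by
    have : rimMap z ∈ {p | dev p = 1 / 2} := range_rimMap ▸ mem_range_self z
    rw [mem_ofPred_eq] at this ⊢
    rw [this]
    norm_num
  proj := collarProj
  continuousOn_proj := by
    have h : ContinuousOn (fun q : MobiusBand × I => collarProj q.1) ({p | dev p ≠ 0} ×ˢ univ) := by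
      refine isQuotientMap_mk.continuousOn_prod isOpen_nhbd ?_
      have := continuousOn_trichotomy (Y := (I × I) × I) (h := fun q => (q.1.2 : ℝ)) (by fun_prop)
        (c := 1 / 2) (f := fun q => Circle.exp (Real.pi * q.1.1))
        (f' := fun q => Circle.exp (Real.pi * (1 + q.1.1))) (z := 1) (by fun_prop) (by fun_prop)
      exact this.mono fun q hq => mk_mem_nhbd.1 hq.1
    exact h.comp (f := fun p => (p, (0 : I))) (by fun_prop) fun p hp => ⟨hp, mem_univ _⟩
  proj_apply z := by
    obtain ⟨t, rfl | rfl⟩ := exists_angle z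
    · rw [rimMap_upper, collarProj, lift_mk, if_pos (by norm_num)]
    · rw [rimMap_lower, collarProj, lift_mk, if_neg (by norm_num), if_neg (by norm_num)]
  homotopy := collarHomotopy
  continuousOn_homotopy := by
    refine isQuotientMap_mk.continuousOn_prod isOpen_nhbd ?_
    have := continuousOn_trichotomy (Y := (I × I) × I) (h := fun q => (q.1.2 : ℝ)) (by fun_prop)
      (c := 1 / 2) (f := fun q => plane (q.1.1, q.2 * q.1.2))
      (f' := fun q => plane (q.1.1, 1 - q.2 * (1 - q.1.2))) (z := plane (0, 0))
      (continuous_plane.comp (by fun_prop)) (continuous_plane.comp (by fun_prop))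
    exact this.mono fun q hq => mk_mem_nhbd.1 hq.1
  homotopy_zero p hp := by
    obtain ⟨⟨x, t⟩, rfl⟩ := isQuotientMap_mk.surjective p
    have ht : (t : ℝ) ≠ 1 / 2 := mk_mem_nhbd.1 hp
    rw [collarHomotopy, collarProj, lift_mk, lift_mk]
    dsimp only
    rcases lt_or_gt_of_ne ht with h | h
    · rw [if_pos h, if_pos h, rimMap_upper, ← plane_coe]
      simp
    · rw [if_neg h.not_gt, if_neg h.ne', if_neg h.not_gt, if_neg h.ne', rimMap_lower, ← plane_coe]
      simp
  homotopy_one p hp := by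
    obtain ⟨⟨x, t⟩, rfl⟩ := isQuotientMap_mk.surjective p
    have ht : (t : ℝ) ≠ 1 / 2 := mk_mem_nhbd.1 hp
    rw [collarHomotopy, lift_mk]
    dsimp only
    rcases lt_or_gt_of_ne ht with h | h
    · rw [if_pos h, ← plane_coe]
      simp
    · rw [if_neg h.not_gt, if_neg h.ne', ← plane_coe]
      simp
  homotopy_apply z s := by
    obtain ⟨t, rfl | rfl⟩ := exists_angle z
    · rw [rimMap_upper, collarHomotopy, lift_mk, if_pos (by norm_num), ← plane_coe]
      simp
    · rw [rimMap_lower, collarHomotopy, lift_mk, if_neg (by norm_num), if_neg (by norm_num), ← plane_coe]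
      simp

open Real in
theorem exists_coreMap : ∃ φ : C(Circle, MobiusBand),
    ∀ x : I, φ (Circle.exp (2 * π * x)) = mk (x, ⟨1 / 2, by norm_num, by norm_num⟩) := by
  have hpi := pi_pos
  obtain ⟨φ, hφ⟩ := Circle.exists_desc (f := fun θ => plane (θ / (2 * π), 1 / 2)) (by
      rw [zero_div, div_self (by positivity), plane_zero (by norm_num)]
      norm_num)
    (continuous_plane.comp (by fun_prop)).continuousOn
  refine ⟨φ, fun x => ?_⟩
  rw [hφ _ ⟨by nlinarith [x.2.1], by nlinarith [x.2.2]⟩, mul_div_cancel_left₀ _ (by positivity), ← plane_coe]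

/-- The core circle. -/
noncomputable def coreMap : C(Circle, MobiusBand) := exists_coreMap.choose

theorem coreMap_exp (x : I) :
    coreMap (Circle.exp (2 * Real.pi * x)) = mk (x, ⟨1 / 2, by norm_num, by norm_num⟩) :=
  exists_coreMap.choose_spec x

theorem exists_core_angle (z : Circle) : ∃ x : I, z = Circle.exp (2 * Real.pi * x) := by
  obtain ⟨t, h | h⟩ := exists_angle z
  · refine ⟨⟨t / 2, by linarith [t.2.1], by linarith [t.2.2]⟩, ?_⟩
    rw [h]
    congr 1
    ring
  · refine ⟨⟨(1 + t) / 2, by linarith [t.2.1], by linarith [t.2.2]⟩, ?_⟩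
    rw [h]
    congr 1
    ring

/-- The projection to the core circle. -/
noncomputable def coreProj : MobiusBand → Circle :=
  lift (fun x _ => Circle.exp (2 * Real.pi * x)) fun t _ => by simp

theorem continuous_coreProj : Continuous coreProj := by
  refine isQuotientMap_mk.continuous_iff.2 ?_
  exact (by fun_prop : Continuous fun p : I × I => Circle.exp (2 * Real.pi * p.1))

/-- The deformation to the core circle. -/
noncomputable def coreHomotopy (p : MobiusBand) (s : I) : MobiusBand :=
  lift (fun x t => plane (x, 1 / 2 + s * (t - 1 / 2))) (fun t ht => by
    rw [plane_zero]
    · ring_nf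
    · have hs := s.2
      constructor <;> nlinarith [ht.1, ht.2, hs.1, hs.2]) p

/-- The deformation retraction to the core circle. -/
noncomputable def coreCollar : Collar coreMap where
  nbhd := univ
  isOpen_nbhd := isOpen_univ
  isClosed_range := by
    have : range coreMap = {p | dev p = 0} := by
      ext p
      constructor
      · rintro ⟨z, rfl⟩
        obtain ⟨x, rfl⟩ := exists_core_angle z
        rw [coreMap_exp, mem_ofPred_eq, dev_mk]
        norm_num
      · obtain ⟨⟨x, t⟩, rfl⟩ := isQuotientMap_mk.surjective p
        intro h
        rw [mem_ofPred_eq, dev_mk, abs_eq_zero, sub_eq_zero] at h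
        have : t = ⟨1 / 2, by norm_num, by norm_num⟩ := Subtype.ext h
        subst this
        exact ⟨_, coreMap_exp x⟩
    rw [this]
    exact isClosed_eq continuous_dev continuous_const
  mem_nbhd _ := mem_univ _
  proj := coreProj
  continuousOn_proj := continuous_coreProj.continuousOn
  proj_apply z := by
    obtain ⟨x, rfl⟩ := exists_core_angle z
    rw [coreMap_exp]
    rfl
  homotopy := coreHomotopy
  continuousOn_homotopy := by
    refine isQuotientMap_mk.continuousOn_prod isOpen_univ ?_
    exact (continuous_plane.comp (by fun_prop : Continuous fun q : (I × I) × I =>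
      ((q.1.1 : ℝ), 1 / 2 + (q.2 : ℝ) * ((q.1.2 : ℝ) - 1 / 2)))).continuousOn
  homotopy_zero p _ := by
    obtain ⟨⟨x, t⟩, rfl⟩ := isQuotientMap_mk.surjective p
    rw [coreHomotopy, coreProj, lift_mk, lift_mk, coreMap_exp, ← plane_coe]
    simp
  homotopy_one p _ := by
    obtain ⟨⟨x, t⟩, rfl⟩ := isQuotientMap_mk.surjective p
    rw [coreHomotopy, lift_mk, ← plane_coe]
    simp
  homotopy_apply z s := by
    obtain ⟨x, rfl⟩ := exists_core_angle z
    rw [coreMap_exp, coreHomotopy, lift_mk, ← plane_coe]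
    simp




/-- The image of a segment. -/
noncomputable def seg (v w : ℝ × ℝ) : Path (plane v) (plane w) :=
  (Path.segment v w).map continuous_plane

instance : PathConnectedSpace MobiusBand where
  nonempty := ⟨plane 0⟩
  joined p q := by
    obtain ⟨x, t, rfl⟩ := exists_plane_eq p
    obtain ⟨y, u, rfl⟩ := exists_plane_eq q
    exact ⟨seg _ _⟩

theorem rimMap_one : rimMap 1 = plane (0, 0) := by
  have h := rimMap_upper 0
  rw [← plane_coe] at h
  simpa using h

theorem coreMap_one : coreMap 1 = plane (0, 1 / 2) := by
  have h := coreMap_exp 0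
  rw [← plane_coe] at h
  simpa using h

/-- A path from the boundary to the core. -/
noncomputable def tail : Path (rimMap 1) (coreMap 1) := (seg (0, 0) (0, 1 / 2)).cast rimMap_one coreMap_one

/-- The generator. -/
noncomputable def loopA : Path (rimMap 1) (rimMap 1) :=
  (tail.trans (Circle.loop.map coreMap.continuous)).trans tail.symm

variable {G : Type*} [Group G] (F F' : Holonomy MobiusBand G)

theorem val_loopA : F.val loopA =
    F.val tail * F.val (Circle.loop.map coreMap.continuous) * (F.val tail)⁻¹ := by
  rw [loopA, F.val_trans, F.val_trans, F.val_symm]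

theorem seg_apply (v w : ℝ × ℝ) (t : I) : seg v w t = plane (v + (t : ℝ) • (w - v)) := by
  simp only [seg, Path.map_coe, Function.comp_apply, Path.segment_apply, AffineMap.lineMap_apply,
    vsub_eq_sub, vadd_eq_add]
  rw [add_comm]

/-- The boundary circle is the square of the generator. -/
theorem val_rim : F.val (Circle.loop.map rimMap.continuous) = F.val loopA ^ 2 := by
  -- Pulled back to the plane, the functor is the coboundary of some `u`; the identification of the
  -- vertical sides then constrains `u`.
  have hc : ContractsTo (univ : Set (ℝ × ℝ)) 0 := ⟨fun v t => (t : ℝ) • v, by fun_prop,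
    fun v _ => by simp⟩
  obtain ⟨u, hu⟩ := (F.comap ⟨plane, continuous_plane⟩).exists_coboundary hc
  have hseg (v w : ℝ × ℝ) : F.val (seg v w) = (u v)⁻¹ * u w := hu (Path.segment v w) fun _ => mem_univ _
  have hupper : F.val (Circle.upperPath.map rimMap.continuous) = (u (0, 0))⁻¹ * u (1, 0) := by
    rw [← hseg]
    refine F.val_congr _ _ fun t => ?_
    rw [seg_apply]
    refine (rimMap_upper t).trans ?_
    rw [← plane_coe]
    simp
  have hlower : F.val (Circle.lowerPath.map rimMap.continuous) = (u (0, 1))⁻¹ * u (1, 1) := by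
    rw [← hseg]
    refine F.val_congr _ _ fun t => ?_
    rw [seg_apply]
    refine (rimMap_lower t).trans ?_
    rw [← plane_coe]
    simp
  have hcore : F.val (Circle.loop.map coreMap.continuous) = (u (0, 1 / 2))⁻¹ * u (1, 1 / 2) := by
    rw [← hseg]
    refine F.val_congr _ _ fun t => ?_
    rw [seg_apply]
    change coreMap (Circle.loop t) = _
    rw [Circle.loop_apply, coreMap_exp, ← plane_coe]
    simp
  have htail : F.val tail = (u (0, 0))⁻¹ * u (0, 1 / 2) := by
    rw [← hseg]
    exact F.val_congr _ _ fun t => rfl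
  have hside (a b : ℝ) (ha : a ∈ I) (hb : b ∈ I) :
      (u (0, a))⁻¹ * u (0, b) = (u (1, 1 - a))⁻¹ * u (1, 1 - b) := by
    rw [← hseg, ← hseg]
    refine F.val_congr _ _ fun t => ?_
    rw [seg_apply, seg_apply]
    have : ((0 : ℝ), a) + (t : ℝ) • ((0, b) - (0, a)) = (0, a + t * (b - a)) := by simp
    rw [this, plane_zero ⟨by nlinarith [t.2.1, t.2.2, ha.1, ha.2, hb.1, hb.2],
      by nlinarith [t.2.1, t.2.2, ha.1, ha.2, hb.1, hb.2]⟩]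
    congr 1
    ext
    · simp
    · simp; ring
  have s1 := hside (1 / 2) 1 (by norm_num) (by norm_num)
  have s2 := hside (1 / 2) 0 (by norm_num) (by norm_num)
  norm_num at s1 s2
  -- Passing from the left to the right side multiplies `u` by the same element `m` at each pair of
  -- identified points. The boundary consists of two such passages and gives `m²`, conjugated by `u
  -- (0, 0)`; the core circle is a single passage.
  have e1 : u (1, 0) = u (1, 1 / 2) * (u (0, 1 / 2))⁻¹ * u (0, 1) := by
    rw [mul_assoc]; norm_num; rw [s1]; group
  have e2 : u (1, 1) = u (1, 1 / 2) * (u (0, 1 / 2))⁻¹ * u (0, 0) := by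
    rw [mul_assoc]; norm_num; rw [s2]; group
  rw [Circle.loop, Path.map_trans, F.val_trans, hupper, hlower, val_loopA, htail, hcore, e1, e2, sq]
  group

/-- The value on the generator can be prescribed. -/
theorem exists_holonomy (g : G) : ∃ F : Holonomy MobiusBand G, F.val loopA = g := by
  obtain ⟨F, hF⟩ := Circle.exists_holonomy g
  let r : C(MobiusBand, Circle) := ⟨coreProj, continuous_coreProj⟩
  -- Pull back from the core circle, then conjugate to move the base point to the boundary.
  refine ⟨(F.comap r).gauge fun _ => ((F.comap r).val tail)⁻¹, ?_⟩
  have h : (F.comap r).val (Circle.loop.map coreMap.continuous) = g := by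
    rw [← hF]
    exact F.val_congr _ _ fun t => coreCollar.proj_apply _
  rw [Holonomy.gauge_val, val_loopA, h]
  group

/-- Functors that agree on the generator are naturally isomorphic. -/
theorem exists_natAlong (h : F.val loopA = F'.val loopA) :
    ∃ e : MobiusBand → G, e (rimMap 1) = 1 ∧ ∀ ⦃x y⦄ (γ : Path x y), F.NatAlong F' e γ := by
  set g := (F.val tail)⁻¹ * F'.val tail with hg
  rw [val_loopA, val_loopA] at h
  obtain ⟨e₀, h0, he₀⟩ := Holonomy.exists_natAlong_circle (F.comap coreMap)
    ((F'.gauge fun _ => g).comap coreMap) (by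
      rw [Holonomy.comap_val, Holonomy.comap_val, Holonomy.gauge_val, hg]
      calc F.val (Circle.loop.map coreMap.continuous) = (F.val tail)⁻¹ * (F.val tail *
            F.val (Circle.loop.map coreMap.continuous) * (F.val tail)⁻¹) * F.val tail := by group
        _ = _ := by rw [h]; group)
  obtain ⟨e, h1, he⟩ := coreCollar.exists_natAlong rfl he₀
  rw [← h1] at h0
  refine ⟨fun p => e p * g, ?_, fun x y γ => (he γ).of_gauge⟩
  have h := (he tail).of_gauge
  unfold Holonomy.NatAlong at h
  dsimp only at h ⊢
  rw [h0, one_mul, hg] at h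
  rw [hg]
  have h' : e (rimMap 1) * ((F.val tail)⁻¹ * F'.val tail) * F'.val tail = 1 * F'.val tail := by
    rw [h]; group
  exact mul_right_cancel h'

end CompactSurface.MobiusBand

end

/-! ### From classified functors to a presentation; disjoint unions of pieces -/

section

open Set Topology Filter
open scoped unitInterval

set_option linter.unusedSectionVars false

section

variable {X : Type} [TopologicalSpace X]

/-- The functors on the fundamental groupoid of `X` with values in a group are classified by their
values on the loops `ℓ`, which are subject to the relation `r` only. -/
structure IsPresentedBy {x₀ : X} {ι : Type} (ℓ : ι → Path x₀ x₀) (r : FreeGroup ι) : Prop where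
  rel : ∀ {G : Type} [Group G] (F : Holonomy X G), FreeGroup.lift (fun i => F.val (ℓ i)) r = 1
  exists_holonomy : ∀ {G : Type} [Group G] (v : ι → G), FreeGroup.lift v r = 1 →
    ∃ F : Holonomy X G, ∀ i, F.val (ℓ i) = v i
  exists_natAlong : ∀ {G : Type} [Group G] (F F' : Holonomy X G),
    (∀ i, F.val (ℓ i) = F'.val (ℓ i)) →
      ∃ e : X → G, e x₀ = 1 ∧ ∀ ⦃x y⦄ (γ : Path x y), F.NatAlong F' e γ

theorem Holonomy.NatAlong.val_eq {G : Type*} [Group G] {F F' : Holonomy X G} {e : X → G} {x : X}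
    {γ : Path x x} (h : F.NatAlong F' e γ) (he : e x = 1) : F.val γ = F'.val γ := by
  unfold Holonomy.NatAlong at h
  rw [he, one_mul, mul_one] at h
  exact h.symm

/-- The functor to the (opposite) fundamental group given by a choice of paths from the base
point. -/
theorem Holonomy.exists_tautological [PathConnectedSpace X] (x₀ : X) :
    ∃ T : Holonomy X (FundamentalGroup X x₀)ᵐᵒᵖ, ∀ γ : Path x₀ x₀,
      T.val γ = MulOpposite.op (FundamentalGroup.fromPath (Path.Homotopic.Quotient.mk γ)) := by
  classical
  -- The chosen path to the base point is constant, so that a loop is sent to its own class and not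
  -- to a conjugate.
  let τ : ∀ x, Path x₀ x := fun x => if h : x = x₀ then (Path.refl x₀).cast rfl h else
    PathConnectedSpace.somePath x₀ x
  have hτ : τ x₀ = Path.refl x₀ := dif_pos rfl
  let q : ∀ ⦃x y : X⦄, Path x y → Path.Homotopic.Quotient x₀ x₀ := fun x y γ =>
    ((Path.Homotopic.Quotient.mk (τ x)).trans (Path.Homotopic.Quotient.mk γ)).trans
      (Path.Homotopic.Quotient.mk (τ y)).symm
  refine ⟨⟨fun x y γ => MulOpposite.op (FundamentalGroup.fromPath (q γ)), ⟨?_, ?_⟩⟩, ?_⟩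
  · intro x y z γ δ _ _
    -- The product in the fundamental group composes loops in the order opposite to `Path.trans`,
    -- which is why the target is the opposite group.
    rw [← MulOpposite.op_mul]
    congr 1
    change q (γ.trans δ) = (q γ).trans (q δ)
    simp only [q, Path.Homotopic.Quotient.mk_trans, Path.Homotopic.Quotient.trans_assoc]
    rw [← Path.Homotopic.Quotient.trans_assoc (Path.Homotopic.Quotient.mk (τ y)).symm,
      Path.Homotopic.Quotient.symm_trans, Path.Homotopic.Quotient.refl_trans]
  · intro x y γ δ H _
    have : Path.Homotopic.Quotient.mk γ = Path.Homotopic.Quotient.mk δ := Quotient.sound ⟨H⟩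
    simp only [q, this]
  · intro γ
    change MulOpposite.op (FundamentalGroup.fromPath (q γ)) = _
    simp only [q, hτ]
    congr 2
    have hs : (Path.Homotopic.Quotient.mk (Path.refl x₀)).symm = Path.Homotopic.Quotient.refl x₀ := by
      change Path.Homotopic.Quotient.mk (Path.refl x₀).symm = _
      rw [Path.refl_symm]
      rfl
    rw [hs, Path.Homotopic.Quotient.trans_refl]
    exact Path.Homotopic.Quotient.refl_trans _

/-- The argument of Yoneda. The tautological functor satisfies the relation, which defines `φ` on
the presented group; the functor `F` with the generators as values restricts to `ψ` in the other
direction. One composite is the identity on generators, and the other one is so because `φ ∘ F` and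
the tautological functor agree on the loops `ℓ`. -/
theorem IsPresentedBy.nonempty_mulEquiv [PathConnectedSpace X] {x₀ : X} {ι : Type}
    {ℓ : ι → Path x₀ x₀} {r : FreeGroup ι} (h : IsPresentedBy ℓ r) (x : X) :
    Nonempty (FundamentalGroup X x ≃* PresentedGroup {r}) := by
  obtain ⟨T, hT⟩ := Holonomy.exists_tautological x₀
  have hr : FreeGroup.lift (fun i => (PresentedGroup.of i : PresentedGroup {r})) r = 1 := by
    have e : FreeGroup.lift (fun i => (PresentedGroup.of i : PresentedGroup {r})) =
        PresentedGroup.mk {r} := FreeGroup.ext_hom _ _ fun i => by simp [PresentedGroup.of]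
    rw [e]
    exact PresentedGroup.one_of_mem (mem_singleton r)
  obtain ⟨F, hF⟩ := h.exists_holonomy _ hr
  have hrel : ∀ s ∈ ({r} : Set (FreeGroup ι)), FreeGroup.lift (fun i => T.val (ℓ i)) s = 1 := by
    rintro _ rfl
    exact h.rel T
  let φ : PresentedGroup {r} →* (FundamentalGroup X x₀)ᵐᵒᵖ :=
    PresentedGroup.toGroup hrel
  have hφ : ∀ i, φ (PresentedGroup.of i) = T.val (ℓ i) := fun i => PresentedGroup.toGroup.of hrel
  let ψ : (FundamentalGroup X x₀)ᵐᵒᵖ →* PresentedGroup {r} :=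
    { toFun := fun p => Quotient.lift (fun γ : Path x₀ x₀ => F.val γ)
        (fun _ _ hγ => F.val_homotopic hγ) (FundamentalGroup.toPath p.unop)
      map_one' := F.val_refl x₀
      map_mul' := fun p q => by
        induction p using MulOpposite.rec' with | _ p
        induction q using MulOpposite.rec' with | _ q
        obtain ⟨γ, rfl⟩ := Quotient.exists_rep p
        obtain ⟨δ, rfl⟩ := Quotient.exists_rep q
        exact F.val_trans γ δ }
  have h1 : ψ.comp φ = MonoidHom.id _ := PresentedGroup.ext fun i => by
    change ψ (φ (PresentedGroup.of i)) = PresentedGroup.of i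
    rw [hφ, hT]
    exact hF i
  have h2 : φ.comp ψ = MonoidHom.id _ := by
    obtain ⟨e, he, hn⟩ := h.exists_natAlong (F.mapHom φ) T fun i => by
      change φ (F.val (ℓ i)) = _
      rw [hF]
      exact hφ i
    ext p
    induction p using MulOpposite.rec' with | _ p
    obtain ⟨γ, rfl⟩ := Quotient.exists_rep p
    exact ((hn γ).val_eq he).trans (hT γ)
  -- Inversion identifies a group with its opposite, and path connectedness allows any base point.
  refine ⟨(FundamentalGroup.fundamentalGroupMulEquivOfPathConnected x x₀).trans
    ((MulEquiv.inv' _).trans (MonoidHom.toMulEquiv ψ φ h2 h1))⟩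

end

/-- Naturality on both parts implies naturality. -/
theorem IsGluing.natAlong' {X A B S G : Type*} [TopologicalSpace X] [TopologicalSpace A]
    [TopologicalSpace B] [TopologicalSpace S] [Group G] {ρ : C(S, A)} {β : C(S, B)} {iA : C(A, X)}
    {iB : C(B, X)} (h : IsGluing ρ β iA iB) (κ : Collar β) {F F' : Holonomy X G} {e : X → G}
    (hA : ∀ ⦃x y : A⦄ (γ : Path x y), F.NatAlong F' e (γ.map iA.continuous))
    (hB : ∀ ⦃x y : B⦄ (γ : Path x y), F.NatAlong F' e (γ.map iB.continuous))
    {x y : X} (γ : Path x y) : F.NatAlong F' e γ := by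
  rcases isEmpty_or_nonempty B with hE | hE
  · obtain ⟨R, hR, hRA, -⟩ := h.exists_retraction κ
    have hu : ∀ x, ∃ a, x = iA a := fun x => (h.cases x).resolve_right fun ⟨b, _⟩ => hE.elim b
    have hR' : Continuous R := by
      rw [← continuousOn_univ]
      refine hR.mono fun x _ => ?_
      obtain ⟨a, rfl⟩ := hu x
      exact Or.inl ⟨a, rfl⟩
    refine (hA (γ.map hR')).congr γ fun t => ?_
    obtain ⟨a, ha⟩ := hu (γ t)
    simp [ha, hRA]
  · exact h.natAlong κ hA hB γ

/-- The case of empty `B` occurs in genus `0`, where no pieces are attached and `X` is a copy of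
`A`. -/
theorem IsGluing.exists_holonomy' {X A B S G : Type*} [TopologicalSpace X] [TopologicalSpace A]
    [TopologicalSpace B] [TopologicalSpace S] [Group G] {ρ : C(S, A)} {β : C(S, B)} {iA : C(A, X)}
    {iB : C(B, X)} (h : IsGluing ρ β iA iB) (κ : Collar β) (FA : Holonomy A G) (FB : Holonomy B G)
    (hF : ∀ ⦃z w : S⦄ (γ : Path z w), FA.val (γ.map ρ.continuous) = FB.val (γ.map β.continuous)) :
    ∃ (F : Holonomy X G) (ε : B → G), (∀ z, ε (β z) = 1) ∧
      (∀ ⦃x y : A⦄ (γ : Path x y), F.val (γ.map iA.continuous) = FA.val γ) ∧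
      ∀ ⦃x y : B⦄ (γ : Path x y), (F.comap iB).NatAlong FB ε γ := by
  rcases isEmpty_or_nonempty B with hE | hE
  · obtain ⟨R, hR, hRA, -⟩ := h.exists_retraction κ
    have hR' : Continuous R := by
      rw [← continuousOn_univ]
      refine hR.mono fun x _ => ?_
      obtain ⟨a, rfl⟩ := (h.cases x).resolve_right fun ⟨b, _⟩ => hE.elim b
      exact Or.inl ⟨a, rfl⟩
    exact ⟨FA.comap ⟨R, hR'⟩, fun _ => 1, fun _ => rfl,
      fun x y γ => FA.val_congr _ _ fun t => hRA _, fun x => hE.elim x⟩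
  · exact h.exists_holonomy κ FA FB hF

section Family

variable {ι B S G : Type*} [TopologicalSpace ι] [DiscreteTopology ι] [TopologicalSpace B]
  [TopologicalSpace S] [Group G]

/-- The index set is discrete and the interval is connected, so a path stays in one copy. -/
theorem Path.fst_eq {p q : ι × B} (γ : Path p q) (t : I) : (γ t).1 = p.1 := by
  have h : IsLocallyConstant fun t => (γ t).1 := (IsLocallyConstant.iff_continuous _).2 (by fun_prop)
  have := h.apply_eq_of_preconnectedSpace t 0
  simpa using this

/-- The functor on the disjoint union of copies of a space that is given on each copy. -/
def Holonomy.family (F : ι → Holonomy B G) : Holonomy (ι × B) G where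
  val x _ γ := (F x.1).val (γ.map continuous_snd)
  isHolonomyOn := by
    refine ⟨fun x y z γ δ _ _ => ?_, fun x y γ δ H _ => ?_⟩
    · have h : y.1 = x.1 := by simpa using γ.fst_eq 1
      rw [Path.map_trans, Holonomy.val_trans, h]
    · exact (F x.1).val_homotopic ⟨H.map ⟨Prod.snd, continuous_snd⟩⟩

/-- The copy of index `j`. -/
def ContinuousMap.slice (B : Type*) [TopologicalSpace B] (j : ι) : C(B, ι × B) :=
  ⟨fun b => (j, b), by fun_prop⟩

theorem Holonomy.family_slice (F : ι → Holonomy B G) (j : ι) {x y : B} (γ : Path x y) :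
    (Holonomy.family F).val (γ.map (ContinuousMap.slice B j).continuous) = (F j).val γ :=
  (F j).val_congr _ _ fun _ => rfl

theorem Path.exists_slice {p q : ι × B} (γ : Path p q) :
    ∀ t, γ t = (γ.map continuous_snd).map (ContinuousMap.slice B p.1).continuous t := fun t =>
  Prod.ext (γ.fst_eq t) rfl

/-- The disjoint union of copies of a map. -/
def ContinuousMap.copies (ι : Type*) [TopologicalSpace ι] (β : C(S, B)) : C(ι × S, ι × B) :=
  ⟨fun p => (p.1, β p.2), by fun_prop⟩

/-- The disjoint union of copies of a collar. -/
def Collar.copies (ι : Type*) [TopologicalSpace ι] [DiscreteTopology ι] {β : C(S, B)}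
    (κ : Collar β) : Collar (ContinuousMap.copies ι β) where
  nbhd := univ ×ˢ κ.nbhd
  isOpen_nbhd := isOpen_univ.prod κ.isOpen_nbhd
  isClosed_range := by
    have : range (ContinuousMap.copies ι β) = univ ×ˢ range β := by
      ext ⟨i, b⟩
      simp [ContinuousMap.copies]
    rw [this]
    exact isClosed_univ.prod κ.isClosed_range
  mem_nbhd z := ⟨mem_univ _, κ.mem_nbhd _⟩
  proj b := (b.1, κ.proj b.2)
  continuousOn_proj := continuousOn_fst.prodMk
    (κ.continuousOn_proj.comp continuousOn_snd fun _ h => h.2)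
  proj_apply z := by simp [ContinuousMap.copies, κ.proj_apply]
  homotopy b t := (b.1, κ.homotopy b.2 t)
  continuousOn_homotopy := ContinuousOn.prodMk (by fun_prop)
    (κ.continuousOn_homotopy.comp (f := fun p : (ι × B) × I => (p.1.2, p.2)) (by fun_prop)
      fun _ h => ⟨h.1.2, mem_univ _⟩)
  homotopy_zero b hb := by simp [ContinuousMap.copies, κ.homotopy_zero b.2 hb.2]
  homotopy_one b hb := by simp [κ.homotopy_one b.2 hb.2]
  homotopy_apply z t := by simp [ContinuousMap.copies, κ.homotopy_apply]

end Family

theorem FreeGroup.lift_conj {ι G : Type*} [Group G] (g : G) (v : ι → G) (w : FreeGroup ι) :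
    FreeGroup.lift (fun i => g * v i * g⁻¹) w = g * FreeGroup.lift v w * g⁻¹ := by
  have : FreeGroup.lift (fun i => g * v i * g⁻¹) = (MulAut.conj g).toMonoidHom.comp (FreeGroup.lift v) :=
    FreeGroup.ext_hom _ _ fun i => by simp
  rw [this]
  simp

end

/-! ### Attaching plugs to the holes: presentations for the surfaces -/

section

open Set Topology Filter
open scoped unitInterval

set_option linter.unusedSectionVars false

namespace CompactSurface

/-- A space with a collared boundary circle, the functors on the fundamental groupoid of which are
classified by their values on loops at a point of the circle, without relations. -/
structure Plug (B ι : Type) [TopologicalSpace B] where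
  rim : C(Circle, B)
  collar : Collar rim
  loop : ι → Path (rim 1) (rim 1)
  word : FreeGroup ι
  val_rim : ∀ {G : Type} [Group G] (F : Holonomy B G),
    F.val (Circle.loop.map rim.continuous) = FreeGroup.lift (fun i => F.val (loop i)) word
  exists_holonomy : ∀ {G : Type} [Group G] (v : ι → G), ∃ F : Holonomy B G, ∀ i, F.val (loop i) = v i
  exists_natAlong : ∀ {G : Type} [Group G] (F F' : Holonomy B G),
    (∀ i, F.val (loop i) = F'.val (loop i)) →
      ∃ e : B → G, e (rim 1) = 1 ∧ ∀ ⦃x y⦄ (γ : Path x y), F.NatAlong F' e γ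

/-- The handle as a plug. -/
noncomputable def Handle.plug : Plug Handle Bool where
  rim := rimMap
  collar := collar
  loop b := bif b then loopA else loopB
  word := .of true * .of false * (.of true)⁻¹ * (.of false)⁻¹
  val_rim F := by
    rw [val_rim]
    simp
  exists_holonomy v := by
    obtain ⟨F, h1, h2⟩ := exists_holonomy (v true) (v false)
    exact ⟨F, by rintro (_ | _) <;> assumption⟩
  exists_natAlong F F' h := exists_natAlong F F' (h true) (h false)

/-- The Möbius band as a plug. -/
noncomputable def MobiusBand.plug : Plug MobiusBand Unit where
  rim := rimMap
  collar := collar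
  loop _ := loopA
  word := .of () ^ 2
  val_rim F := by
    rw [val_rim]
    simp
  exists_holonomy v := by
    obtain ⟨F, h⟩ := exists_holonomy (v ())
    exact ⟨F, fun _ => h⟩
  exists_natAlong F F' h := exists_natAlong F F' (h ())

/-- The boundary circles of the first `g` holes. -/
noncomputable def HoledSphere.firstRims (g k : ℕ) : C(Fin g × Circle, HoledSphere (g + k)) :=
  ⟨fun p => HoledSphere.rimMap (Fin.castAdd k p.1) p.2,
    continuous_prod_of_discrete_left.2 fun j => (HoledSphere.rimMap (Fin.castAdd k j)).continuous⟩

theorem HoledSphere.firstRims_injective (g k : ℕ) : Function.Injective (firstRims g k) := by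
  rintro ⟨i, z⟩ ⟨j, w⟩ h
  replace h : rimMap (Fin.castAdd k i) z = rimMap (Fin.castAdd k j) w := h
  have hij : i = j := by
    rw [rimMap_apply, rimMap_apply] at h
    exact Fin.castAdd_injective g k (rim_eq_rim h)
  subst hij
  rw [rimMap_apply, rimMap_apply] at h
  rw [rim_injective _ h]

namespace Plug

variable {B ι : Type} [TopologicalSpace B] (P : Plug B ι)

theorem rim_injective : Function.Injective P.rim := Function.LeftInverse.injective P.collar.proj_apply

theorem copies_injective (g : ℕ) : Function.Injective (ContinuousMap.copies (Fin g) P.rim) := by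
  rintro ⟨i, z⟩ ⟨j, w⟩ h
  have h1 := congr_arg Prod.fst h
  have h2 := congr_arg Prod.snd h
  exact Prod.ext h1 (P.rim_injective h2)

/-- The relation satisfied by the loops of the plugs and of the remaining holes. -/
def relator (g k : ℕ) : FreeGroup (Fin g × ι ⊕ Fin k) :=
  (List.ofFn fun j : Fin g => FreeGroup.lift (fun i => FreeGroup.of (Sum.inl (j, i))) P.word).prod *
    (List.ofFn fun j : Fin k => FreeGroup.of (Sum.inr j)).prod

theorem lift_relator {g k : ℕ} {G : Type*} [Group G] (v : Fin g × ι ⊕ Fin k → G) :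
    FreeGroup.lift v (P.relator g k) =
      (List.ofFn fun j : Fin g => FreeGroup.lift (fun i => v (Sum.inl (j, i))) P.word).prod *
        (List.ofFn fun j : Fin k => v (Sum.inr j)).prod := by
  have (j : Fin g) : FreeGroup.lift v (FreeGroup.lift (fun i => FreeGroup.of (Sum.inl (j, i))) P.word) =
      FreeGroup.lift (fun i => v (Sum.inl (j, i))) P.word := by
    rw [← MonoidHom.comp_apply]
    congr 1
    exact FreeGroup.ext_hom _ _ fun i => by simp
  rw [relator, map_mul, map_list_prod, map_list_prod, List.map_ofFn, List.map_ofFn]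
  congr 3
  · funext j
    exact this j
  · funext j
    exact FreeGroup.lift_apply_of

variable {X : Type} [TopologicalSpace X] {g k : ℕ} {iA : C(HoledSphere (g + k), X)}
  {iB : C(Fin g × B, X)}
  (h : IsGluing (HoledSphere.firstRims g k) (ContinuousMap.copies (Fin g) P.rim) iA iB)

/-- The inclusion of the plug of index `j`. -/
def incl (_ : IsGluing (HoledSphere.firstRims g k) (ContinuousMap.copies (Fin g) P.rim) iA iB)
    (j : Fin g) : C(B, X) := iB.comp (ContinuousMap.slice B j)

theorem incl_rim (j : Fin g) (z : Circle) :
    iA (HoledSphere.rimMap (Fin.castAdd k j) z) = P.incl h j (P.rim z) := h.comm (j, z)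

/-- The loops of the plugs and of the remaining holes, at the base point. -/
noncomputable def loops : Fin g × ι ⊕ Fin k → Path (iA HoledSphere.infty) (iA HoledSphere.infty)
  | Sum.inl (j, i) =>
    (((HoledSphere.tail (Fin.castAdd k j)).map iA.continuous).trans
      (((P.loop i).map (P.incl h j).continuous).cast (P.incl_rim h j 1) (P.incl_rim h j 1))).trans
        ((HoledSphere.tail (Fin.castAdd k j)).map iA.continuous).symm
  | Sum.inr j => (HoledSphere.holeLoop (Fin.natAdd g j)).map iA.continuous

section

variable {G : Type} [Group G] (F F' : Holonomy X G)

theorem val_loops_inl (j : Fin g) (i : ι) : F.val (P.loops h (Sum.inl (j, i))) =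
    (F.comap iA).val (HoledSphere.tail (Fin.castAdd k j)) * (F.comap (P.incl h j)).val (P.loop i) *
      ((F.comap iA).val (HoledSphere.tail (Fin.castAdd k j)))⁻¹ := by
  rw [loops, F.val_trans, F.val_trans, F.val_symm]
  congr 2
  exact F.val_congr _ _ fun _ => rfl

/-- After gluing, the boundary of the hole is the boundary of the plug, which is the word in the
plug's own loops. Both sides are conjugated by the same path to the base point, and conjugation
commutes with evaluating a word. -/
theorem val_holeLoop_castAdd (j : Fin g) :
    (F.comap iA).val (HoledSphere.holeLoop (Fin.castAdd k j)) =
      FreeGroup.lift (fun i => F.val (P.loops h (Sum.inl (j, i)))) P.word := by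
  simp only [val_loops_inl, FreeGroup.lift_conj]
  rw [HoledSphere.holeLoop, Holonomy.val_trans, Holonomy.val_trans, Holonomy.val_symm, ← P.val_rim]
  congr 2
  exact F.val_congr _ _ fun t => h.comm (j, Circle.loop t)

/-- This is the relation between the loops around all `g + k` holes, with the first `g` of them
expressed by the loops of the plugs. -/
theorem rel : FreeGroup.lift (fun i => F.val (P.loops h i)) (P.relator g k) = 1 := by
  rw [lift_relator, ← HoledSphere.prod_holeLoop (F.comap iA), List.ofFn_add, List.prod_append]
  congr 3
  funext j
  exact (P.val_holeLoop_castAdd h F j).symm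

theorem exists_holonomy_loops (v : Fin g × ι ⊕ Fin k → G)
    (hv : FreeGroup.lift v (P.relator g k) = 1) :
    ∃ F : Holonomy X G, ∀ i, F.val (P.loops h i) = v i := by
  -- The values that the hole loops must have. Their product is the relator evaluated at `v`, so the
  -- functor on the sphere exists.
  let c : Fin (g + k) → G :=
    Fin.append (fun j => FreeGroup.lift (fun i => v (Sum.inl (j, i))) P.word) (fun j => v (Sum.inr j))
  obtain ⟨FA, hFA⟩ := HoledSphere.exists_holonomy c (by
    rw [lift_relator] at hv
    rw [List.ofFn_add, List.prod_append, ← hv]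
    simp [c])
  let t : Fin g → G := fun j => FA.val (HoledSphere.tail (Fin.castAdd k j))
  -- The conjugation by `t j` undoes the transport from the boundary of the hole to infinity. Gluing
  -- requires equality on the whole boundary circle, whereas agreement on the standard loop gives
  -- only an isomorphism there; a gauge transformation of the plug absorbs it.
  have hplug (j : Fin g) : ∃ F : Holonomy B G, (∀ i, F.val (P.loop i) = (t j)⁻¹ * v (Sum.inl (j, i)) * t j) ∧
      ∀ ⦃z w : Circle⦄ (γ : Path z w), FA.val (γ.map (HoledSphere.rimMap (Fin.castAdd k j)).continuous) =
        F.val (γ.map P.rim.continuous) := by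
    obtain ⟨F, hF⟩ := P.exists_holonomy fun i => (t j)⁻¹ * v (Sum.inl (j, i)) * t j
    obtain ⟨e, h1, he⟩ := Holonomy.exists_natAlong_circle
      (FA.comap (HoledSphere.rimMap (Fin.castAdd k j))) (F.comap P.rim) (by
        have h1 := hFA (Fin.castAdd k j)
        simp only [c, Fin.append_left] at h1
        rw [HoledSphere.holeLoop, Holonomy.val_trans, Holonomy.val_trans, Holonomy.val_symm,
          mul_inv_eq_iff_eq_mul, ← eq_inv_mul_iff_mul_eq] at h1
        rw [Holonomy.comap_val, Holonomy.comap_val, P.val_rim, h1]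
        simp only [hF]
        have := FreeGroup.lift_conj (t j)⁻¹ (fun i => v (Sum.inl (j, i))) P.word
        rw [inv_inv] at this
        rw [this, mul_assoc])
    have hr : ∀ z, P.collar.proj (P.rim z) = z := P.collar.proj_apply
    -- The collar projection extends `e` from the circle to all of `B`. Continuity plays no role in
    -- a gauge transformation, and `e 1 = 1` leaves the values on the loops unchanged.
    refine ⟨F.gauge fun b => e (P.collar.proj b), fun i => ?_, fun z w γ => ?_⟩
    · rw [Holonomy.gauge_val, hr, h1, hF]
      group
    · rw [Holonomy.gauge_val, hr, hr]
      have := he γ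
      unfold Holonomy.NatAlong at this
      rw [Holonomy.comap_val, Holonomy.comap_val] at this
      rw [this]
      group
  choose FB hFB hFAB using hplug
  obtain ⟨F, ε, hε, h1, h2⟩ := h.exists_holonomy' (P.collar.copies (Fin g)) FA (Holonomy.family FB)
    (fun z w γ => by
      rw [Holonomy.val_congr FA (γ.map _) ((γ.map continuous_snd).map
          (HoledSphere.rimMap (Fin.castAdd k z.1)).continuous) (fun t => ?_), hFAB]
      · rfl
      · change HoledSphere.rimMap (Fin.castAdd k (γ t).1) _ = _
        rw [γ.fst_eq]
        rfl)
  refine ⟨F, ?_⟩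
  have hA : F.comap iA = FA := by
    cases FA
    simp only [Holonomy.comap, Holonomy.mk.injEq]
    funext x y γ
    exact h1 γ
  rintro (⟨j, i⟩ | j)
  · have hB : (F.comap (P.incl h j)).val (P.loop i) = (FB j).val (P.loop i) := by
      rw [← Holonomy.family_slice FB j (P.loop i)]
      exact (h2 ((P.loop i).map (ContinuousMap.slice B j).continuous)).val_eq (hε (j, 1))
    rw [val_loops_inl, hA, hB, hFB]
    change t j * _ * (t j)⁻¹ = _
    group
  · have := hFA (Fin.natAdd g j)
    simp only [c, Fin.append_right] at this
    rw [← this]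
    exact h1 _

theorem exists_natAlong_loops (hF : ∀ i, F.val (P.loops h i) = F'.val (P.loops h i)) :
    ∃ e : X → G, e (iA HoledSphere.infty) = 1 ∧ ∀ ⦃x y⦄ (γ : Path x y), F.NatAlong F' e γ := by
  obtain ⟨eA, hA1, hA⟩ := HoledSphere.exists_natAlong (F.comap iA) (F'.comap iA) (fun j => by
    induction j using Fin.addCases with
    | left j =>
      rw [P.val_holeLoop_castAdd h, P.val_holeLoop_castAdd h]
      simp only [hF]
    | right j => exact hF (Sum.inr j))
  -- The value that the transformation on the sphere takes at the base point of the `j`-th rim,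
  -- forced by naturality along the path from infinity. The transformation on the plug has to start
  -- from it.
  let s : Fin g → G := fun j => ((F.comap iA).val (HoledSphere.tail (Fin.castAdd k j)))⁻¹ *
    (F'.comap iA).val (HoledSphere.tail (Fin.castAdd k j))
  have hs (j : Fin g) : eA (HoledSphere.rimMap (Fin.castAdd k j) 1) = s j := by
    have := hA (HoledSphere.tail (Fin.castAdd k j))
    unfold Holonomy.NatAlong at this
    rw [hA1, one_mul] at this
    simp only [s, this, inv_mul_cancel_left]
  have hplug (j : Fin g) : ∃ e : B → G, e (P.rim 1) = s j ∧
      ∀ ⦃x y⦄ (γ : Path x y), (F.comap (P.incl h j)).NatAlong (F'.comap (P.incl h j)) e γ := by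
    obtain ⟨e, h1, he⟩ := P.exists_natAlong (F.comap (P.incl h j))
      ((F'.comap (P.incl h j)).gauge fun _ => s j) (fun i => by
        have := hF (Sum.inl (j, i))
        rw [val_loops_inl, val_loops_inl, mul_inv_eq_iff_eq_mul, ← eq_inv_mul_iff_mul_eq] at this
        rw [this, Holonomy.gauge_val]
        simp only [s]
        group)
    exact ⟨fun b => e b * s j, by simp only [h1, one_mul], fun x y γ => (he γ).of_gauge⟩
  choose eB hB1 hB using hplug
  -- The two transformations agree at the base point of the rim and both are natural along it, so
  -- they agree on the entire rim.
  obtain ⟨e, heA, heB⟩ := h.exists_desc eA (fun p => eB p.1 p.2) (by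
    rintro ⟨j, z⟩
    let γ : Path 1 z := PathConnectedSpace.somePath 1 z
    have n1 := hA (γ.map (HoledSphere.rimMap (Fin.castAdd k j)).continuous)
    have n2 := hB j (γ.map P.rim.continuous)
    have e1 (F : Holonomy X G) : (F.comap iA).val (γ.map (HoledSphere.rimMap (Fin.castAdd k j)).continuous) =
        (F.comap (P.incl h j)).val (γ.map P.rim.continuous) :=
      F.val_congr _ _ fun t => h.comm (j, γ t)
    unfold Holonomy.NatAlong at n1 n2
    rw [e1, e1, hs] at n1
    rw [hB1, n1] at n2
    exact mul_left_cancel n2)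
  refine ⟨e, (heA _).trans hA1, fun x y γ => h.natAlong' (P.collar.copies (Fin g)) ?_ ?_ γ⟩
  · intro x y γ
    have := hA γ
    unfold Holonomy.NatAlong at this ⊢
    rw [heA, heA]
    exact this
  · intro x y γ
    have := hB x.1 (γ.map continuous_snd)
    have hy : y.1 = x.1 := by simpa using γ.fst_eq 1
    have e1 (F : Holonomy X G) : F.val (γ.map iB.continuous) =
        (F.comap (P.incl h x.1)).val (γ.map continuous_snd) :=
      F.val_congr _ _ fun t => congr_arg iB (γ.exists_slice t)
    unfold Holonomy.NatAlong at this ⊢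
    rw [heB, heB, e1, e1, hy]
    exact this

end

theorem isPresentedBy : IsPresentedBy (P.loops h) (P.relator g k) :=
  ⟨P.rel h, P.exists_holonomy_loops h, P.exists_natAlong_loops h⟩

include h in
theorem pathConnectedSpace [PathConnectedSpace B] : PathConnectedSpace X := by
  have h0 (x : X) : Joined (iA HoledSphere.infty) x := by
    have hA (a) : Joined (iA HoledSphere.infty) (iA a) :=
      (PathConnectedSpace.joined HoledSphere.infty a).map iA.continuous
    rcases h.cases x with ⟨a, rfl⟩ | ⟨⟨j, b⟩, rfl⟩
    · exact hA a
    · have := (PathConnectedSpace.joined (P.rim 1) b).map (P.incl h j).continuous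
      refine (hA (HoledSphere.rimMap (Fin.castAdd k j) 1)).trans ?_
      have e : iA (HoledSphere.rimMap (Fin.castAdd k j) 1) = iB (j, P.rim 1) := h.comm (j, 1)
      rw [e]
      exact this
  exact ⟨⟨iA HoledSphere.infty⟩, fun x y => (h0 x).symm.trans (h0 y)⟩

end Plug

/-! ### Fundamental groups -/

section

variable (g k : ℕ)

/-- The inclusion of the sphere with holes. -/
def OrientableSurface.ofSphere : C(HoledSphere (g + k), OrientableSurface g k) :=
  ⟨fun a => Quot.mk _ (Sum.inl a), continuous_quot_mk.comp continuous_inl⟩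

/-- The inclusion of the attached pieces. -/
def OrientableSurface.ofPlugs : C(Fin g × Handle, OrientableSurface g k) :=
  ⟨fun b => Quot.mk _ (Sum.inr b), continuous_quot_mk.comp continuous_inr⟩

theorem OrientableSurface.isGluing : IsGluing (HoledSphere.firstRims g k)
    (ContinuousMap.copies (Fin g) Handle.plug.rim) (ofSphere g k) (ofPlugs g k) := by
  refine isGluing_quot (HoledSphere.firstRims_injective g k) (Handle.plug.copies_injective g)
    fun p q => ⟨?_, ?_⟩
  · rintro ⟨j, z⟩
    refine ⟨(j, z), congr_arg Sum.inl (HoledSphere.rimMap_apply _ _).symm, ?_⟩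
    exact congr_arg (fun b => Sum.inr (j, b)) (Handle.rimMap_apply z).symm
  · rintro ⟨⟨j, z⟩, rfl, rfl⟩
    have := HandleRel.glue (k := k) j z
    rw [← HoledSphere.rimMap_apply, ← Handle.rimMap_apply] at this
    exact this

/-- The inclusion of the sphere with holes. -/
def NonorientableSurface.ofSphere : C(HoledSphere (g + k), NonorientableSurface g k) :=
  ⟨fun a => Quot.mk _ (Sum.inl a), continuous_quot_mk.comp continuous_inl⟩

/-- The inclusion of the attached pieces. -/
def NonorientableSurface.ofPlugs : C(Fin g × MobiusBand, NonorientableSurface g k) :=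
  ⟨fun b => Quot.mk _ (Sum.inr b), continuous_quot_mk.comp continuous_inr⟩

theorem NonorientableSurface.isGluing : IsGluing (HoledSphere.firstRims g k)
    (ContinuousMap.copies (Fin g) MobiusBand.plug.rim) (ofSphere g k) (ofPlugs g k) := by
  refine isGluing_quot (HoledSphere.firstRims_injective g k) (MobiusBand.plug.copies_injective g)
    fun p q => ⟨?_, ?_⟩
  · rintro (⟨j, t⟩ | ⟨j, t⟩)
    · refine ⟨(j, _), congr_arg Sum.inl (HoledSphere.rimMap_apply _ _).symm, ?_⟩
      exact congr_arg (fun b => Sum.inr (j, b)) (MobiusBand.rimMap_upper t).symm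
    · refine ⟨(j, _), congr_arg Sum.inl (HoledSphere.rimMap_apply _ _).symm, ?_⟩
      exact congr_arg (fun b => Sum.inr (j, b)) (MobiusBand.rimMap_lower t).symm
  · rintro ⟨⟨j, z⟩, rfl, rfl⟩
    obtain ⟨t, rfl | rfl⟩ := MobiusBand.exists_angle z
    · have := CrossCapRel.upper (k := k) j t
      rw [← HoledSphere.rimMap_apply, ← MobiusBand.rimMap_upper] at this
      exact this
    · have := CrossCapRel.lower (k := k) j t
      rw [← HoledSphere.rimMap_apply, ← MobiusBand.rimMap_lower] at this
      exact this

instance : PathConnectedSpace (OrientableSurface g k) :=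
  Handle.plug.pathConnectedSpace (OrientableSurface.isGluing g k)

instance : PathConnectedSpace (NonorientableSurface g k) :=
  MobiusBand.plug.pathConnectedSpace (NonorientableSurface.isGluing g k)

/-- The generators of the fundamental group of the orientable surface. -/
def OrientableGen.toSum : OrientableGen g k → Fin g × Bool ⊕ Fin k
  | .a i => Sum.inl (i, true)
  | .b i => Sum.inl (i, false)
  | .c j => Sum.inr j

/-- The generators of the fundamental group of the nonorientable surface. -/
def NonorientableGen.toSum : NonorientableGen g k → Fin g × Unit ⊕ Fin k
  | .a i => Sum.inl (i, ())
  | .c j => Sum.inr j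

end

end CompactSurface

/-- Translates from the generic generators of the plugs to the named generators. The relators need
only have the same values in every group. -/
theorem IsPresentedBy.reindex {X : Type} [TopologicalSpace X] {x₀ : X} {ι κ : Type}
    {ℓ : ι → Path x₀ x₀} {r : FreeGroup ι} (h : IsPresentedBy ℓ r) (f : κ → ι)
    (hf : Function.Bijective f) {s : FreeGroup κ}
    (hs : ∀ {G : Type} [Group G] (v : ι → G), FreeGroup.lift v r = FreeGroup.lift (v ∘ f) s) :
    IsPresentedBy (ℓ ∘ f) s := by
  obtain ⟨f, rfl⟩ : ∃ f' : κ ≃ ι, f = f' := ⟨Equiv.ofBijective f hf, rfl⟩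
  refine ⟨fun F => (hs _).symm.trans (h.rel F), fun v hv => ?_, fun F F' hF => ?_⟩
  · obtain ⟨F, hF⟩ := h.exists_holonomy (v ∘ f.symm) (by
      rw [hs, Function.comp_assoc, Equiv.symm_comp_self]
      exact hv)
    exact ⟨F, fun i => by simp [hF]⟩
  · exact h.exists_natAlong F F' fun i => by simpa using hF (f.symm i)

namespace CompactSurface

theorem OrientableSurface.isPresentedBy (g k : ℕ) :
    IsPresentedBy (Handle.plug.loops (OrientableSurface.isGluing g k) ∘ OrientableGen.toSum g k)
      (orientableRelator g k) := by
  refine (Handle.plug.isPresentedBy (OrientableSurface.isGluing g k)).reindex _ ?_ ?_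
  · constructor
    · rintro (i | i | i) (j | j | j) h <;> simp_all [OrientableGen.toSum]
    · rintro (⟨i, _ | _⟩ | j)
      exacts [⟨.b i, rfl⟩, ⟨.a i, rfl⟩, ⟨.c j, rfl⟩]
  · intro G _ v
    rw [Plug.lift_relator, orientableRelator]
    simp [map_list_prod, List.map_ofFn, Handle.plug, Function.comp_def, OrientableGen.toSum]

theorem NonorientableSurface.isPresentedBy (g k : ℕ) :
    IsPresentedBy (MobiusBand.plug.loops (NonorientableSurface.isGluing g k) ∘ NonorientableGen.toSum g k)
      (nonorientableRelator g k) := by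
  refine (MobiusBand.plug.isPresentedBy (NonorientableSurface.isGluing g k)).reindex _ ?_ ?_
  · constructor
    · rintro (i | i) (j | j) h <;> simp_all [NonorientableGen.toSum]
    · rintro (⟨i, _ | _⟩ | j)
      exacts [⟨.a i, rfl⟩, ⟨.c j, rfl⟩]
  · intro G _ v
    rw [Plug.lift_relator, nonorientableRelator]
    simp [map_list_prod, List.map_ofFn, MobiusBand.plug, Function.comp_def, NonorientableGen.toSum]

end CompactSurface

end

/-! ### Singular chains in low degrees -/

section

open Set Topology Filter
open scoped unitInterval

set_option linter.unusedSectionVars false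

namespace SingularChains

open CategoryTheory Simplicial

/-- The singular chain complex with integer coefficients. -/
noncomputable abbrev complex (X : Type) [TopologicalSpace X] : ChainComplex (ModuleCat.{0} ℤ) ℕ :=
  (TopCat.toSSet.obj (TopCat.of X)).chainComplex (ModuleCat.of ℤ ℤ)

/-- The singular chains. -/
abbrev Chains (X : Type) [TopologicalSpace X] (n : ℕ) : Type := (complex X).X n

variable {X : Type} [TopologicalSpace X] {n : ℕ}

/-- A singular simplex as a chain. -/
noncomputable def simplex (f : C(stdSimplex ℝ (Fin (n + 1)), X)) : Chains X n :=
  (SSet.ιChainComplex (C := ModuleCat.{0} ℤ) (R := ModuleCat.of ℤ ℤ) (TopCat.toSSet.obj (TopCat.of X))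
    (((TopCat.of X).toSSetObjEquiv (.op ⦋n⦌)).symm f)).hom (1 : ℤ)

/-- The inclusion of a face of the standard simplex. -/
noncomputable def face (i : Fin (n + 2)) :
    C(stdSimplex ℝ (Fin (n + 1)), stdSimplex ℝ (Fin (n + 2))) :=
  ⟨stdSimplex.map i.succAbove, stdSimplex.continuous_map _⟩

/-- The boundary map. -/
noncomputable def boundary (X : Type) [TopologicalSpace X] (n : ℕ) :
    Chains X (n + 1) →+ Chains X n := ((complex X).d (n + 1) n).hom.toAddMonoidHom

theorem δ_symm (f : C(stdSimplex ℝ (Fin (n + 2)), X)) (i : Fin (n + 2)) :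
    (TopCat.toSSet.obj (TopCat.of X)).δ i (((TopCat.of X).toSSetObjEquiv (.op ⦋n + 1⦌)).symm f) =
      ((TopCat.of X).toSSetObjEquiv (.op ⦋n⦌)).symm (f.comp (face i)) := by
  rfl

theorem boundary_simplex (f : C(stdSimplex ℝ (Fin (n + 2)), X)) :
    boundary X n (simplex f) = ∑ i : Fin (n + 2), (-1 : ℤ) ^ (i : ℕ) • simplex (f.comp (face i)) := by
  have h := SSet.ιChainComplex_d (C := ModuleCat.{0} ℤ) (R := ModuleCat.of ℤ ℤ)
    (X := TopCat.toSSet.obj (TopCat.of X)) (((TopCat.of X).toSSetObjEquiv (.op ⦋n + 1⦌)).symm f)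
  have h1 := LinearMap.congr_fun (congr_arg ModuleCat.Hom.hom h) (1 : ℤ)
  refine Eq.trans h1 ?_
  rw [ModuleCat.hom_sum, LinearMap.sum_apply]
  refine Finset.sum_congr rfl fun i _ => ?_
  rw [δ_symm]
  rfl

/-- With `exists_hom` this says that the chains are free on the singular simplices, which is all
that is used about how they are constructed. -/
theorem hom_ext {N : Type} [AddCommGroup N] {L L' : Chains X n →+ N}
    (h : ∀ f, L (simplex f) = L' (simplex f)) : L = L' := by
  let lin (L : Chains X n →+ N) : Chains X n →ₗ[ℤ] N :=
    { L with map_smul' := fun m z => by simpa using map_intCast_smul L ℤ ℤ m z }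
  have : (ModuleCat.ofHom (lin L) : (complex X).X n ⟶ ModuleCat.of ℤ N) = ModuleCat.ofHom (lin L') := by
    refine SSet.chainComplex_hom_ext fun x => ?_
    obtain ⟨f, rfl⟩ := ((TopCat.of X).toSSetObjEquiv (.op ⦋n⦌)).symm.surjective x
    refine ModuleCat.hom_ext (LinearMap.ext_ring ?_)
    exact h f
  ext z
  exact LinearMap.congr_fun (congr_arg ModuleCat.Hom.hom this) z

theorem exists_hom {N : Type} [AddCommGroup N] (v : C(stdSimplex ℝ (Fin (n + 1)), X) → N) :
    ∃ L : Chains X n →+ N, ∀ f, L (simplex f) = v f := by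
  let e := (TopCat.of X).toSSetObjEquiv (.op ⦋n⦌)
  let c := Limits.Cofan.IsColimit.desc
    (SSet.isColimitChainComplexXCofan (TopCat.toSSet.obj (TopCat.of X)) (ModuleCat.of ℤ ℤ) n)
    (A := ModuleCat.of ℤ N) fun x => ModuleCat.ofHom (LinearMap.toSpanSingleton ℤ N (v (e x)))
  refine ⟨c.hom.toAddMonoidHom, fun f => ?_⟩
  have h := Limits.Cofan.IsColimit.fac
    (SSet.isColimitChainComplexXCofan (TopCat.toSSet.obj (TopCat.of X)) (ModuleCat.of ℤ ℤ) n)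
    (fun x => ModuleCat.ofHom (LinearMap.toSpanSingleton ℤ N (v (e x)))) (e.symm f)
  have h1 := LinearMap.congr_fun (congr_arg ModuleCat.Hom.hom h) (1 : ℤ)
  refine Eq.trans h1 ?_
  change (1 : ℤ) • v (e (e.symm f)) = v f
  rw [one_smul, e.apply_symm_apply]

theorem boundary_boundary (z : Chains X (n + 2)) : boundary X n (boundary X (n + 1) z) = 0 := by
  have h := (complex X).d_comp_d (n + 2) (n + 1) n
  exact LinearMap.congr_fun (congr_arg ModuleCat.Hom.hom h) z

theorem surjective_π {R : Type*} [Ring R] (S : ShortComplex (ModuleCat R)) :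
    Function.Surjective S.moduleCatLeftHomologyData.π.hom := Submodule.mkQ_surjective _

theorem π_eq_zero_iff {R : Type*} [Ring R] (S : ShortComplex (ModuleCat R)) (z : LinearMap.ker S.g.hom) :
    S.moduleCatLeftHomologyData.π.hom z = 0 ↔ ∃ w, S.f.hom w = z := by
  refine (Submodule.Quotient.mk_eq_zero _).trans ⟨?_, ?_⟩
  · rintro ⟨w, hw⟩
    exact ⟨w, congr_arg Subtype.val hw⟩
  · rintro ⟨w, hw⟩
    exact ⟨w, Subtype.ext hw⟩

/-- The first homology group. -/
theorem exists_class (X : Type) [TopologicalSpace X] :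
    ∃ c : (boundary X 0).ker →+ CompactSurface.H1 X, Function.Surjective c ∧
      ∀ z, c z = 0 ↔ ∃ w, boundary X 1 w = z := by
  let e := (complex X).homologyIsoSc' 2 1 0 (by simp) (by simp) ≪≫
    ((complex X).sc' 2 1 0).moduleCatHomologyIso
  let E := e.toLinearEquiv.toAddEquiv
  let q := ((complex X).sc' 2 1 0).moduleCatLeftHomologyData.π.hom.toAddMonoidHom
  refine ⟨E.symm.toAddMonoidHom.comp q, E.symm.surjective.comp (surjective_π _), fun z => ?_⟩
  change E.symm (q z) = 0 ↔ _
  rw [EmbeddingLike.map_eq_zero_iff]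
  exact π_eq_zero_iff ((complex X).sc' 2 1 0) z

end SingularChains

end

/-! ### The first homology group as target of the universal abelian functor -/

section

open Set Topology Filter
open scoped unitInterval

set_option linter.unusedSectionVars false

namespace SingularChains

variable {X : Type} [TopologicalSpace X] {n : ℕ}

theorem map_apply {m : ℕ} (f : Fin m → Fin n) (s : stdSimplex ℝ (Fin m)) (j : Fin n) :
    stdSimplex.map f s j = ∑ i, if f i = j then s i else 0 := by
  rw [stdSimplex.map_coe, FunOnFinite.linearMap_apply_apply, Finset.sum_filter]

section Affine

variable {E : Type*} [AddCommGroup E] [Module ℝ E] [TopologicalSpace E] [IsTopologicalAddGroup E]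
  [ContinuousSMul ℝ E]

/-- The composition of an affine simplex with a continuous map. -/
noncomputable def affine (Φ : C(E, X)) (p : Fin (n + 1) → E) : C(stdSimplex ℝ (Fin (n + 1)), X) :=
  ⟨fun x => Φ (∑ i, x i • p i), Φ.continuous.comp (continuous_finsetSum _ fun i _ =>
    (Continuous.smul ((continuous_apply i).comp continuous_subtype_val) continuous_const))⟩

theorem affine_face (Φ : C(E, X)) (p : Fin (n + 2) → E) (i : Fin (n + 2)) :
    (affine Φ p).comp (face i) = affine Φ (p ∘ i.succAbove) := by
  ext x
  change Φ _ = Φ _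
  congr 1
  change ∑ j, stdSimplex.map i.succAbove x j • p j = _
  simp only [map_apply, Finset.sum_smul]
  rw [Finset.sum_comm]
  simp

/-- The class of the image of a segment. -/
noncomputable def segment (Φ : C(E, X)) (p q : E) : Chains X 1 := simplex (affine Φ ![p, q])

theorem boundary_affine (Φ : C(E, X)) (p q r : E) :
    boundary X 1 (simplex (affine Φ ![p, q, r])) = segment Φ q r - segment Φ p r + segment Φ p q := by
  rw [boundary_simplex, Fin.sum_univ_three]
  simp only [affine_face]
  have h0 : (![p, q, r] : Fin 3 → E) ∘ Fin.succAbove 0 = ![q, r] := by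
    funext i; fin_cases i <;> rfl
  have h1 : (![p, q, r] : Fin 3 → E) ∘ Fin.succAbove 1 = ![p, r] := by
    funext i; fin_cases i <;> rfl
  have h2 : (![p, q, r] : Fin 3 → E) ∘ Fin.succAbove 2 = ![p, q] := by
    funext i; fin_cases i <;> rfl
  rw [h0, h1, h2]
  simp only [segment]
  simp
  abel

end Affine

/-- A point as a chain. -/
noncomputable def point (x : X) : Chains X 0 := simplex (.const _ x)

/-- A path as a chain. -/
noncomputable def path {x y : X} (γ : Path x y) : Chains X 1 :=
  simplex ⟨fun s => γ ⟨s 1, stdSimplex.zero_le s 1, stdSimplex.le_one s 1⟩, by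
    refine γ.continuous.comp (Continuous.subtype_mk ?_ _)
    exact (continuous_apply (1 : Fin 2)).comp continuous_subtype_val⟩

/-- The path given by a singular edge. -/
noncomputable def edgePath (f : C(stdSimplex ℝ (Fin 2), X)) :
    Path (f (stdSimplex.vertex 0)) (f (stdSimplex.vertex 1)) where
  toFun t := f ((stdSimplexHomeomorphUnitInterval.symm t))
  source' := by
    congr 1
    rw [Homeomorph.symm_apply_eq]
    simp
  target' := by
    congr 1
    rw [Homeomorph.symm_apply_eq]
    simp

theorem edgePath_apply (f : C(stdSimplex ℝ (Fin 2), X)) (s : stdSimplex ℝ (Fin 2)) :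
    edgePath f ⟨s 1, stdSimplex.zero_le s 1, stdSimplex.le_one s 1⟩ = f s := by
  change f _ = f _
  congr 1
  rw [Homeomorph.symm_apply_eq]
  ext
  rfl

theorem path_edgePath (f : C(stdSimplex ℝ (Fin 2), X)) : path (edgePath f) = simplex f := by
  unfold path
  congr 1
  ext s
  exact edgePath_apply f s

theorem exists_path_eq (f : C(stdSimplex ℝ (Fin 2), X)) : ∃ (x y : X) (γ : Path x y),
    simplex f = path γ := ⟨_, _, edgePath f, (path_edgePath f).symm⟩

theorem simplex_zero (f : C(stdSimplex ℝ (Fin 1), X)) (v : stdSimplex ℝ (Fin 1)) :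
    simplex f = point (f v) := by
  unfold point
  congr 1
  ext s
  rw [Subsingleton.elim s v]
  rfl

theorem boundary_path {x y : X} (γ : Path x y) : boundary X 0 (path γ) = point y - point x := by
  rw [path, boundary_simplex, Fin.sum_univ_two, simplex_zero _ (stdSimplex.vertex 0),
    simplex_zero _ (stdSimplex.vertex 0)]
  have h0 : face (n := 0) 0 (stdSimplex.vertex 0) = stdSimplex.vertex 1 := stdSimplex.map_vertex _ _
  have h1 : face (n := 0) 1 (stdSimplex.vertex 0) = stdSimplex.vertex 0 := stdSimplex.map_vertex _ _
  simp only [ContinuousMap.comp_apply, h0, h1]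
  simp [sub_eq_add_neg]

theorem segment_eq_path {E : Type*} [AddCommGroup E] [Module ℝ E] [TopologicalSpace E]
    [IsTopologicalAddGroup E] [ContinuousSMul ℝ E] (Φ : C(E, X)) (p q : E) {x y : X} (γ : Path x y)
    (h : ∀ t : I, Φ ((1 - (t : ℝ)) • p + (t : ℝ) • q) = γ t) : segment Φ p q = path γ := by
  unfold segment path
  congr 1
  ext s
  refine Eq.trans ?_ (h ⟨s 1, stdSimplex.zero_le s 1, stdSimplex.le_one s 1⟩)
  change Φ (∑ i, s i • ![p, q] i) = _
  have := stdSimplex.add_eq_one s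
  rw [Fin.sum_univ_two, show s 0 = 1 - s 1 by linarith]
  rfl

/-- A functor to an abelian group as a cocycle. -/
theorem exists_cocycle {A : Type} [AddCommGroup A] (F : Holonomy X (Multiplicative A)) :
    ∃ L : Chains X 1 →+ A, (∀ ⦃x y⦄ (γ : Path x y), L (path γ) = (F.val γ).toAdd) ∧
      ∀ w, L (boundary X 1 w) = 0 := by
  obtain ⟨L, hL⟩ := exists_hom fun f => (F.val (edgePath f)).toAdd
  have hp ⦃x y⦄ (γ : Path x y) : L (path γ) = (F.val γ).toAdd := by
    rw [path, hL]
    congr 1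
    refine F.val_congr _ _ fun t => ?_
    change γ _ = γ _
    congr 1
  refine ⟨L, hp, fun w => ?_⟩
  have : L.comp (boundary X 1) = 0 := hom_ext fun f => ?_
  · exact DFunLike.congr_fun this w
  -- A functor pulled back to the contractible triangle is a coboundary, and the alternating sum of
  -- its values on the three edges cancels.
  have hc : ContractsTo (univ : Set (stdSimplex ℝ (Fin 3))) (stdSimplex.vertex 0) := by
    refine ⟨fun v t => ⟨(1 - (t : ℝ)) • (stdSimplex.vertex 0 : stdSimplex ℝ (Fin 3)).1 + (t : ℝ) • v.1,
      convex_stdSimplex ℝ _ (stdSimplex.vertex 0 : stdSimplex ℝ (Fin 3)).2 v.2 (by linarith [t.2.2]) t.2.1 (by ring)⟩, ?_, fun v _ => ⟨?_, ?_⟩⟩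
    · exact (Continuous.subtype_mk (by fun_prop) _).continuousOn
    · ext j
      change (1 - ((0 : I) : ℝ)) * (stdSimplex.vertex 0 : stdSimplex ℝ (Fin 3)) j + ((0 : I) : ℝ) * v j = _
      simp
    · ext j
      change (1 - ((1 : I) : ℝ)) * (stdSimplex.vertex 0 : stdSimplex ℝ (Fin 3)) j + ((1 : I) : ℝ) * v j = _
      simp
  obtain ⟨u, hu⟩ := (F.comap f).exists_coboundary hc
  have key (i : Fin 3) : F.val (edgePath (f.comp (face i))) =
      (u (stdSimplex.vertex (i.succAbove 0)))⁻¹ * u (stdSimplex.vertex (i.succAbove 1)) := by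
    have h := hu (edgePath (face i)) fun _ => mem_univ _
    have h0 (j : Fin 2) : face i (stdSimplex.vertex j) = stdSimplex.vertex (i.succAbove j) :=
      stdSimplex.map_vertex _ _
    rw [← h0, ← h0, ← h]
    exact F.val_congr _ _ fun t => rfl
  rw [AddMonoidHom.comp_apply, boundary_simplex, Fin.sum_univ_three, map_add, map_add, map_zsmul,
    map_zsmul, map_zsmul, hL, hL, hL, key, key, key]
  have e0 : (0 : Fin 3).succAbove 0 = 1 := rfl
  have e1 : (0 : Fin 3).succAbove 1 = 2 := rfl
  have e2 : (1 : Fin 3).succAbove 0 = 0 := rfl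
  have e3 : (1 : Fin 3).succAbove 1 = 2 := rfl
  have e4 : (2 : Fin 3).succAbove 0 = 0 := rfl
  have e5 : (2 : Fin 3).succAbove 1 = 1 := rfl
  rw [e0, e1, e2, e3, e4, e5]
  simp
  abel

/-- The boundary of a constant triangle has an odd number of edges, with signs adding up to one. -/
theorem path_refl_mem (x : X) : path (Path.refl x) ∈ (boundary X 1).range := by
  let Φ : C(ℝ, X) := .const _ x
  have h (p q : ℝ) : segment Φ p q = path (Path.refl x) := segment_eq_path _ _ _ _ fun _ => rfl
  refine ⟨_, (boundary_affine Φ 0 0 0).trans ?_⟩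
  rw [h]
  abel

/-- The degenerate triangle with vertices `0`, `1 / 2`, `1` on the line, mapped by the composite
path, has the three paths as its edges. -/
theorem path_trans_mem {x y z : X} (γ : Path x y) (δ : Path y z) :
    path γ + path δ - path (γ.trans δ) ∈ (boundary X 1).range := by
  let Φ : C(ℝ, X) := (γ.trans δ).extend
  have hΦ (t : I) : Φ t = γ.trans δ t := Path.extend_apply _ t.2
  refine ⟨_, (boundary_affine Φ 0 (1 / 2) 1).trans ?_⟩
  rw [segment_eq_path Φ 0 1 (γ.trans δ) fun t => ?_, segment_eq_path Φ 0 (1 / 2) γ fun t => ?_,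
    segment_eq_path Φ (1 / 2) 1 δ fun t => ?_]
  · abel
  · have h := hΦ ⟨(1 + t) / 2, by linarith [t.2.1], by linarith [t.2.2]⟩
    have e : (1 - (t : ℝ)) • (1 / 2 : ℝ) + (t : ℝ) • (1 : ℝ) = (1 + t) / 2 := by
      simp only [smul_eq_mul]; ring
    rw [e, h, Path.trans_apply]
    split_ifs with ht
    · have : t = 0 := Subtype.ext (show (t : ℝ) = 0 by dsimp only at ht; linarith [t.2.1])
      subst this
      rw [δ.source]
      convert γ.target
      norm_num
    · congr 1
      ext
      change 2 * ((1 + (t : ℝ)) / 2) - 1 = t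
      ring
  · have h := hΦ ⟨t / 2, by linarith [t.2.1], by linarith [t.2.2]⟩
    have e : (1 - (t : ℝ)) • (0 : ℝ) + (t : ℝ) • (1 / 2 : ℝ) = t / 2 := by
      simp only [smul_eq_mul]; ring
    rw [e, h, Path.trans_apply, dif_pos (by dsimp only; linarith [t.2.2])]
    congr 1
    ext
    change 2 * ((t : ℝ) / 2) = t
    ring
  · have e : (1 - (t : ℝ)) • (0 : ℝ) + (t : ℝ) • (1 : ℝ) = t := by simp
    rw [e, hΦ]

/-- The square of the homotopy is cut along its diagonal into two triangles. In the difference of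
their boundaries the diagonal cancels, and the constant sides are boundaries themselves. -/
theorem path_homotopy_mem {x y : X} {γ δ : Path x y} (H : γ.Homotopy δ) :
    path γ - path δ ∈ (boundary X 1).range := by
  let Φ : C(ℝ × ℝ, X) := ⟨fun v => H (projIcc 0 1 zero_le_one v.1, projIcc 0 1 zero_le_one v.2),
    H.continuous.comp ((continuous_projIcc.comp continuous_fst).prodMk
      (continuous_projIcc.comp continuous_snd))⟩
  have hΦ (s t : I) : Φ ((s : ℝ), (t : ℝ)) = H (s, t) := by
    change H _ = _
    rw [projIcc_val, projIcc_val]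
  have h00 : ((0 : I) : ℝ) = 0 := rfl
  have h11 : ((1 : I) : ℝ) = 1 := rfl
  have e1 : segment Φ (0, 0) (0, 1) = path γ := segment_eq_path _ _ _ _ fun t => by
    have := hΦ 0 t
    rw [H.apply_zero, h00] at this
    simpa using this
  have e2 : segment Φ (1, 0) (1, 1) = path δ := segment_eq_path _ _ _ _ fun t => by
    have := hΦ 1 t
    rw [H.apply_one, h11] at this
    simpa using this
  have e3 : segment Φ (0, 0) (1, 0) = path (Path.refl x) := segment_eq_path _ _ _ _ fun t => by
    have := hΦ t 0
    rw [H.source, h00] at this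
    simpa using this
  have e4 : segment Φ (0, 1) (1, 1) = path (Path.refl y) := segment_eq_path _ _ _ _ fun t => by
    have := hΦ t 1
    rw [H.target, h11] at this
    simpa using this
  have m1 : path δ - segment Φ (0, 0) (1, 1) + path (Path.refl x) ∈ (boundary X 1).range :=
    ⟨_, (boundary_affine Φ (0, 0) (1, 0) (1, 1)).trans (by rw [e2, e3])⟩
  have m2 : path (Path.refl y) - segment Φ (0, 0) (1, 1) + path γ ∈ (boundary X 1).range :=
    ⟨_, (boundary_affine Φ (0, 0) (0, 1) (1, 1)).trans (by rw [e1, e4])⟩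
  have m := add_mem (sub_mem m2 m1) (sub_mem (path_refl_mem x) (path_refl_mem y))
  convert m using 1
  abel

/-- The universal functor from the fundamental groupoid to an abelian group. -/
theorem exists_hurewicz [PathConnectedSpace X] (x₀ : X) :
    ∃ (T : Holonomy X (Multiplicative (CompactSurface.H1 X))) (τ : ∀ x, Path x₀ x),
      (∀ x y, T.val (τ x) = T.val (τ y)) ∧
      (∀ {N : Type} [AddCommGroup N] (f f' : CompactSurface.H1 X →+ N),
        (∀ ⦃x y⦄ (γ : Path x y), f (T.val γ).toAdd = f' (T.val γ).toAdd) → f = f') ∧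
      ∀ {A : Type} [AddCommGroup A] (F : Holonomy X (Multiplicative A)),
        ∃ f : CompactSurface.H1 X →+ A, ∀ ⦃x y⦄ (γ : Path x y),
          f (T.val γ).toAdd = (F.val γ * F.val (τ x) * (F.val (τ y))⁻¹).toAdd := by
  obtain ⟨c, hc, hc0⟩ := exists_class X
  let τ : ∀ x, Path x₀ x := fun x => PathConnectedSpace.somePath x₀ x
  -- Joining points to the base point gives a projection `z ↦ z - h ∂z` of the 1-chains onto the
  -- cycles. The functor sends a path to the class of its projection, that is, of the path closed up
  -- through the base point.
  obtain ⟨h, hh⟩ := exists_hom (X := X) (n := 0) fun f => path (τ (f (stdSimplex.vertex 0)))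
  have hp (x : X) : h (point x) = path (τ x) := hh _
  have hd (z : Chains X 1) : boundary X 0 (z - h (boundary X 0 z)) = 0 := by
    have : ((boundary X 0).comp h).comp (boundary X 0) = boundary X 0 := hom_ext fun f => by
      obtain ⟨x, y, γ, e⟩ := exists_path_eq f
      rw [e, AddMonoidHom.comp_apply, AddMonoidHom.comp_apply, boundary_path, map_sub, map_sub, hp,
        hp, boundary_path, boundary_path]
      abel
    rw [map_sub, sub_eq_zero]
    exact (DFunLike.congr_fun this z).symm
  let P : Chains X 1 →+ (boundary X 0).ker :=
    (AddMonoidHom.id _ - h.comp (boundary X 0)).codRestrict _ hd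
  have hP (z : (boundary X 0).ker) : P z = z := by
    ext
    change (z : Chains X 1) - h (boundary X 0 z) = z
    rw [show boundary X 0 z = 0 from z.2, map_zero, sub_zero]
  have hB (z) (hz : z ∈ (boundary X 1).range) : c (P z) = 0 := by
    obtain ⟨w, rfl⟩ := hz
    rw [hc0]
    refine ⟨w, ?_⟩
    exact (congr_arg Subtype.val (hP ⟨_, boundary_boundary w⟩)).symm
  refine ⟨⟨fun x y γ => Multiplicative.ofAdd (c (P (path γ))), ⟨?_, ?_⟩⟩, τ, ?_, ?_, ?_⟩
  · intro x y z γ δ _ _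
    have := hB _ (path_trans_mem γ δ)
    rw [map_sub, map_sub, sub_eq_zero, map_add, map_add] at this
    rw [← this]
    rfl
  · intro x y γ δ H _
    have := hB _ (path_homotopy_mem H)
    rw [map_sub, map_sub, sub_eq_zero] at this
    rw [this]
  -- Closing up `τ x` removes it again and leaves `τ x₀`, whatever `x` is.
  · have hτ (x : X) : P (path (τ x)) = P (path (τ x₀)) := by
      ext
      change path (τ x) - h (boundary X 0 (path (τ x))) = path (τ x₀) - h (boundary X 0 (path (τ x₀)))
      rw [boundary_path, boundary_path, map_sub, map_sub, hp, hp]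
      abel
    intro x y
    change Multiplicative.ofAdd (c (P (path (τ x)))) = Multiplicative.ofAdd (c (P (path (τ y))))
    rw [hτ x, hτ y]
  · intro N _ f f' hf
    have : (f.comp c).comp P = (f'.comp c).comp P := hom_ext fun g => by
      obtain ⟨x, y, γ, e⟩ := exists_path_eq g
      rw [e]
      exact hf γ
    ext z
    obtain ⟨z, rfl⟩ := hc z
    rw [← hP z]
    exact DFunLike.congr_fun this _
  · intro A _ F
    obtain ⟨L, hL, hL0⟩ := exists_cocycle F
    -- The cocycle of `F`, restricted to cycles, vanishes on boundaries and thus descends to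
    -- homology. On the closed-up path it gives the value of `F` corrected by the values along `τ`.
    let g : { g : (boundary X 0).ker →+ A // c.ker ≤ g.ker } :=
      ⟨L.comp (boundary X 0).ker.subtype, fun z hz => by
        obtain ⟨w, hw⟩ := (hc0 z).1 hz
        exact (congr_arg L hw.symm).trans (hL0 w)⟩
    refine ⟨c.liftOfSurjective hc g, fun x y γ => ?_⟩
    refine (c.liftOfRightInverse_comp_apply _ (Function.rightInverse_surjInv hc) g _).trans ?_
    change L (path γ - h (boundary X 0 (path γ))) = _
    rw [boundary_path, map_sub, map_sub, hp, hp, map_sub, hL, hL, hL, toAdd_mul, toAdd_mul, toAdd_inv]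
    abel

end SingularChains

end

/-! ### First homology of the closed surfaces and their distinction -/

section

open Set Topology Filter
open scoped unitInterval

set_option linter.unusedSectionVars false

/-- The first homology group of a space is the abelian group with the generators and relations of
its fundamental group. -/
theorem IsPresentedBy.nonempty_H1_equiv {X : Type} [TopologicalSpace X] [PathConnectedSpace X]
    {x₀ : X} {ι : Type} {ℓ : ι → Path x₀ x₀} {r : FreeGroup ι} (h : IsPresentedBy ℓ r) {M : Type}
    [AddCommGroup M] (m : ι → M) (hm : FreeGroup.lift (fun i => Multiplicative.ofAdd (m i)) r = 1)
    (hdesc : ∀ {N : Type} [AddCommGroup N] (n : ι → N),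
      FreeGroup.lift (fun i => Multiplicative.ofAdd (n i)) r = 1 → ∃ f : M →+ N, ∀ i, f (m i) = n i)
    (hext : ∀ f : M →+ M, (∀ i, f (m i) = m i) → f = AddMonoidHom.id M) :
    Nonempty (CompactSurface.H1 X ≃+ M) := by
  obtain ⟨T, τ, hτ, hT, hF⟩ := SingularChains.exists_hurewicz x₀
  obtain ⟨F, hFm⟩ := h.exists_holonomy _ hm
  obtain ⟨f, hf⟩ := hF F
  obtain ⟨f', hf'⟩ := hdesc (fun i => (T.val (ℓ i)).toAdd) (h.rel T)
  have h1 : f.comp f' = AddMonoidHom.id M := hext _ fun i => by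
    rw [AddMonoidHom.comp_apply, hf', hf, hFm, mul_inv_cancel_right]
    rfl
  -- By uniqueness, the image of `F` under `f'` is isomorphic to `T` by some `e`. As `T` is constant
  -- on the paths `τ`, and the correction terms in `f` run along these paths, `e` cancels in an
  -- abelian group.
  have h2 : f'.comp f = AddMonoidHom.id _ := hT _ _ fun x y γ => by
    let F' := F.mapHom (AddMonoidHom.toMultiplicative f')
    obtain ⟨e, he, hn⟩ := h.exists_natAlong F' T fun i => by
      change AddMonoidHom.toMultiplicative f' (F.val (ℓ i)) = _
      rw [hFm]
      exact congr_arg Multiplicative.ofAdd (hf' i)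
    rw [AddMonoidHom.comp_apply, hf]
    have e0 : F'.val γ * F'.val (τ x) * (F'.val (τ y))⁻¹ =
        AddMonoidHom.toMultiplicative f' (F.val γ * F.val (τ x) * (F.val (τ y))⁻¹) := by
      rw [map_mul, map_mul, map_inv]
      rfl
    refine congr_arg Multiplicative.toAdd (e0.symm.trans ?_)
    have nγ := hn γ
    have nx := hn (τ x)
    have ny := hn (τ y)
    unfold Holonomy.NatAlong at nγ nx ny
    rw [he, one_mul] at nx ny
    have e1 : F'.val γ = e x * T.val γ * (e y)⁻¹ := by rw [nγ, mul_inv_cancel_right]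
    have e2 : F'.val (τ x) = T.val (τ x) * (e x)⁻¹ := by rw [nx, mul_inv_cancel_right]
    have e3 : F'.val (τ y) = T.val (τ x) * (e y)⁻¹ := by rw [hτ x y, ny, mul_inv_cancel_right]
    rw [e1, e2, e3]
    have comm (a b c d : CompactSurface.H1 X) : a + b + -c + (d + -a) + -(d + -c) = b := by abel
    exact congr_arg Multiplicative.ofAdd (comm _ _ _ _)
  exact ⟨AddMonoidHom.toAddEquiv f f' h2 h1⟩

section Free

variable {J N : Type} [Fintype J] [DecidableEq J] [AddCommGroup N]

theorem exists_addMonoidHom_pi (n : J → N) :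
    ∃ f : (J → ℤ) →+ N, ∀ j, f (Pi.single j 1) = n j := by
  refine ⟨((Pi.basisFun ℤ J).constr ℤ n).toAddMonoidHom, fun j => ?_⟩
  have := (Pi.basisFun ℤ J).constr_basis ℤ n j
  rwa [Pi.basisFun_apply] at this

theorem addMonoidHom_pi_ext {f f' : (J → ℤ) →+ N} (h : ∀ j, f (Pi.single j 1) = f' (Pi.single j 1)) :
    f = f' := by
  have : f.toIntLinearMap = f'.toIntLinearMap := (Pi.basisFun ℤ J).ext fun j => by
    rw [Pi.basisFun_apply]
    exact h j
  exact AddMonoidHom.ext fun v => LinearMap.congr_fun this v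

end Free

namespace CompactSurface

/-- The relator is a product of commutators, so in an abelian group it imposes nothing and the `2g`
generators are free. -/
theorem nonempty_H1_orientableSurface (g : ℕ) :
    Nonempty (H1 (OrientableSurface g 0) ≃+ (Fin (2 * g) → ℤ)) := by
  have key : Nonempty (H1 (OrientableSurface g 0) ≃+ (Fin g ⊕ Fin g → ℤ)) := by
    let m : OrientableGen g 0 → (Fin g ⊕ Fin g → ℤ)
      | .a i => Pi.single (Sum.inl i) 1
      | .b i => Pi.single (Sum.inr i) 1
      | .c j => j.elim0
    refine (OrientableSurface.isPresentedBy g 0).nonempty_H1_equiv m ?_ (fun n _ => ?_) fun f hf => ?_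
    · rw [orientableRelator, map_mul, map_list_prod, map_list_prod, List.map_ofFn, List.map_ofFn,
        List.prod_ofFn_one fun i => ?_, List.prod_ofFn_one fun i => i.elim0, mul_one]
      simp only [Function.comp_apply, map_mul, map_inv, FreeGroup.lift_apply_of]
      rw [mul_comm (Multiplicative.ofAdd (m (.a i)))]
      simp
    · obtain ⟨f, hf⟩ := exists_addMonoidHom_pi (Sum.elim (fun i => n (.a i)) fun i => n (.b i))
      refine ⟨f, ?_⟩
      rintro (i | i | i)
      exacts [hf (Sum.inl i), hf (Sum.inr i), i.elim0]
    · refine addMonoidHom_pi_ext ?_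
      rintro (i | i)
      exacts [hf (.a i), hf (.b i)]
  obtain ⟨e⟩ := key
  let s : Fin g ⊕ Fin g ≃ Fin (2 * g) := finSumFinEquiv.trans (finCongr (two_mul g).symm)
  exact ⟨e.trans (LinearEquiv.funCongrLeft ℤ ℤ s.symm).toAddEquiv⟩

/-- In an abelian group the relation is `2 (a₁ + ⋯ + a_g) = 0`. Replacing the first generator by the
sum of all of them gives one generator of order two and `g - 1` free ones. -/
theorem nonempty_H1_nonorientableSurface (g : ℕ) (hg : 1 ≤ g) :
    Nonempty (H1 (NonorientableSurface g 0) ≃+ ZMod 2 × (Fin (g - 1) → ℤ)) := by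
  obtain ⟨g, rfl⟩ := Nat.exists_eq_add_of_le' hg
  rw [Nat.add_sub_cancel]
  have hr {N : Type} [AddCommGroup N] (n : NonorientableGen (g + 1) 0 → N) :
      FreeGroup.lift (fun i => Multiplicative.ofAdd (n i)) (nonorientableRelator (g + 1) 0) =
        Multiplicative.ofAdd (2 • (n (.a 0) + ∑ i : Fin g, n (.a i.succ))) := by
    rw [nonorientableRelator, map_mul, map_list_prod, map_list_prod, List.map_ofFn, List.map_ofFn,
      List.prod_ofFn_one (n := 0) fun i => i.elim0, mul_one, List.prod_ofFn]
    simp only [Function.comp_apply, map_pow, FreeGroup.lift_apply_of]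
    rw [Finset.prod_pow, Fin.prod_univ_succ, ofAdd_nsmul, ofAdd_add, ofAdd_sum]
  -- The first generator is the torsion element minus all the others, so that the generators add up
  -- to `(1, 0)`.
  let m : NonorientableGen (g + 1) 0 → ZMod 2 × (Fin g → ℤ)
    | .a i => Fin.cases (1, fun _ => -1) (fun i => (0, Pi.single i 1)) i
    | .c j => j.elim0
  have hm0 : m (.a 0) = (1, fun _ => -1) := rfl
  have hms (i : Fin g) : m (.a i.succ) = (0, Pi.single i 1) := rfl
  have hsum : m (.a 0) + ∑ i : Fin g, m (.a i.succ) = (1, 0) := by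
    rw [hm0]
    simp only [hms]
    refine Prod.ext ?_ ?_
    · simp [Prod.fst_sum]
    · rw [Prod.snd_add, Prod.snd_sum]
      funext j
      simp [Finset.sum_apply, Pi.single_apply]
  refine (NonorientableSurface.isPresentedBy (g + 1) 0).nonempty_H1_equiv m ?_ (fun n hn => ?_)
    fun f hf => ?_
  · rw [hr, hsum]
    have : (2 : ℕ) • ((1, 0) : ZMod 2 × (Fin g → ℤ)) = 0 := by
      refine Prod.ext ?_ ?_
      · rfl
      · simp
    rw [this]
    rfl
  · rw [hr] at hn
    obtain ⟨f, hf⟩ := exists_addMonoidHom_pi fun i : Fin g => n (.a i.succ)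
    -- This is the relation, and it is what permits sending the generator of `ZMod 2` to the sum of
    -- all `n (.a i)`.
    have hs : zmultiplesHom _ (n (.a 0) + ∑ i : Fin g, n (.a i.succ)) ((2 : ℕ) : ℤ) = 0 :=
      (natCast_zsmul _ 2).trans (congr_arg Multiplicative.toAdd hn)
    let q := ZMod.lift 2 ⟨_, hs⟩
    have hq : q 1 = n (.a 0) + ∑ i : Fin g, n (.a i.succ) := by
      have := ZMod.lift_coe 2 ⟨_, hs⟩ 1
      rw [Int.cast_one] at this
      exact this.trans (one_zsmul _)
    have hone : f (fun _ => -1) = - ∑ i : Fin g, n (.a i.succ) := by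
      have : (fun _ => -1 : Fin g → ℤ) = - ∑ i : Fin g, Pi.single i 1 := by
        funext j
        simp [Finset.sum_apply, Pi.single_apply]
      rw [this, map_neg, map_sum]
      simp only [hf]
    refine ⟨q.coprod f, ?_⟩
    rintro (i | i)
    · induction i using Fin.cases with
      | zero =>
        rw [hm0, AddMonoidHom.coprod_apply, hq, hone]
        abel
      | succ i => rw [hms, AddMonoidHom.coprod_apply, map_zero, zero_add, hf]
    · exact i.elim0
  · have h2 : f.comp (AddMonoidHom.inr _ _) = AddMonoidHom.inr (ZMod 2) (Fin g → ℤ) :=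
      addMonoidHom_pi_ext fun i => hf (.a i.succ)
    have hfs : ∑ i : Fin g, f (m (.a i.succ)) = ∑ i : Fin g, m (.a i.succ) :=
      Finset.sum_congr rfl fun i _ => hf (.a i.succ)
    have h1 : f (1, 0) = (1, 0) := by
      rw [← hsum, map_add, map_sum]
      erw [hf (.a 0), hfs]
    ext1 ⟨z, v⟩
    have hz : ((z, v) : ZMod 2 × (Fin g → ℤ)) = z.val • ((1, 0) : ZMod 2 × (Fin g → ℤ)) +
        AddMonoidHom.inr (ZMod 2) (Fin g → ℤ) v := by
      refine Prod.ext ?_ ?_ <;> simp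
    rw [hz, map_add, map_nsmul, h1]
    congr 1
    exact DFunLike.congr_fun h2 v

/-! ### Distinguishing the groups -/

theorem pi_rank_eq {m n : ℕ} (e : (Fin m → ℤ) ≃+ (Fin n → ℤ)) : m = n := by
  have := e.toIntLinearEquiv.finrank_eq
  simpa using this

/-- The map induced between the free parts is injective: if the free component of an image vanishes,
twice the image is zero, so twice the vector is zero. -/
theorem zmod_prod_pi_rank_le {m n : ℕ} (e : ZMod 2 × (Fin m → ℤ) ≃+ ZMod 2 × (Fin n → ℤ)) :
    m ≤ n := by
  let f : (Fin m → ℤ) →+ (Fin n → ℤ) :=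
    (AddMonoidHom.snd _ _).comp (e.toAddMonoidHom.comp (AddMonoidHom.inr _ _))
  have hf : Function.Injective f.toIntLinearMap := by
    rw [injective_iff_map_eq_zero]
    intro v hv
    have h0 : (2 : ℕ) • e (0, v) = 0 := by
      refine Prod.ext ?_ ?_
      · rw [Prod.smul_fst, nsmul_eq_mul]
        change ((2 : ℕ) : ZMod 2) * _ = 0
        rw [ZMod.natCast_self, zero_mul]
      · rw [Prod.smul_snd]
        change 2 • f v = 0
        rw [show f v = 0 from hv, smul_zero]
    rw [← map_nsmul, EmbeddingLike.map_eq_zero_iff] at h0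
    have h1 : (2 : ℕ) • v = 0 := congr_arg Prod.snd h0
    exact (smul_eq_zero.1 h1).resolve_left two_ne_zero
  have := LinearMap.finrank_le_finrank_of_injective hf
  simpa using this

/-- The element `(1, 0)` has order two, whereas the other group has no torsion. -/
theorem isEmpty_pi_equiv_zmod_prod_pi {m n : ℕ} : IsEmpty ((Fin m → ℤ) ≃+ ZMod 2 × (Fin n → ℤ)) := by
  refine ⟨fun e => ?_⟩
  have h0 : (2 : ℕ) • e.symm (1, 0) = 0 := by
    rw [← map_nsmul, EmbeddingLike.map_eq_zero_iff]
    refine Prod.ext ?_ ?_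
    · rfl
    · simp
  have h1 := (smul_eq_zero.1 h0).resolve_left two_ne_zero
  rw [EmbeddingLike.map_eq_zero_iff] at h1
  exact one_ne_zero (congr_arg Prod.fst h1)

theorem nonempty_H1_equiv_of_homeomorph {X Y : Type} [TopologicalSpace X] [TopologicalSpace Y]
    (f : X ≃ₜ Y) : Nonempty (H1 X ≃+ H1 Y) :=
  ⟨(((AlgebraicTopology.singularHomologyFunctor (ModuleCat.{0} ℤ) 1).obj (ModuleCat.of ℤ ℤ)).mapIso
    (TopCat.isoOfHomeo (X := TopCat.of X) (Y := TopCat.of Y) f)).toLinearEquiv.toAddEquiv⟩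

theorem eq_of_H1_orientableSurface {g h : ℕ}
    (e : Nonempty (H1 (OrientableSurface g 0) ≃+ H1 (OrientableSurface h 0))) : g = h := by
  obtain ⟨e⟩ := e
  obtain ⟨e₁⟩ := nonempty_H1_orientableSurface g
  obtain ⟨e₂⟩ := nonempty_H1_orientableSurface h
  have := pi_rank_eq (e₁.symm.trans (e.trans e₂))
  omega

theorem eq_of_H1_nonorientableSurface {g h : ℕ} (hg : 1 ≤ g) (hh : 1 ≤ h)
    (e : Nonempty (H1 (NonorientableSurface g 0) ≃+ H1 (NonorientableSurface h 0))) : g = h := by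
  obtain ⟨e⟩ := e
  obtain ⟨e₁⟩ := nonempty_H1_nonorientableSurface g hg
  obtain ⟨e₂⟩ := nonempty_H1_nonorientableSurface h hh
  have h1 := zmod_prod_pi_rank_le (e₁.symm.trans (e.trans e₂))
  have h2 := zmod_prod_pi_rank_le (e₂.symm.trans (e.symm.trans e₁))
  omega

theorem isEmpty_H1_equiv (g h : ℕ) (hh : 1 ≤ h) :
    IsEmpty (H1 (OrientableSurface g 0) ≃+ H1 (NonorientableSurface h 0)) := by
  refine ⟨fun e => ?_⟩
  obtain ⟨e₁⟩ := nonempty_H1_orientableSurface g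
  obtain ⟨e₂⟩ := nonempty_H1_nonorientableSurface h hh
  exact isEmpty_pi_equiv_zmod_prod_pi.false (e₁.symm.trans (e.trans e₂))

end CompactSurface

end

theorem mainTheorem6 :
    -- the fundamental groups, at every base point
    (∀ (g k : ℕ) (x : CompactSurface.OrientableSurface g k),
      Nonempty (FundamentalGroup (CompactSurface.OrientableSurface g k) x ≃*
        PresentedGroup {CompactSurface.orientableRelator g k})) ∧
    (∀ (g k : ℕ), 1 ≤ g → ∀ x : CompactSurface.NonorientableSurface g k,
      Nonempty (FundamentalGroup (CompactSurface.NonorientableSurface g k) x ≃*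
        PresentedGroup {CompactSurface.nonorientableRelator g k})) ∧
    -- the first homology groups of the closed surfaces
    (∀ g : ℕ, Nonempty
      (CompactSurface.H1 (CompactSurface.OrientableSurface g 0) ≃+ (Fin (2 * g) → ℤ))) ∧
    (∀ g : ℕ, 1 ≤ g → Nonempty
      (CompactSurface.H1 (CompactSurface.NonorientableSurface g 0) ≃+
        ZMod 2 × (Fin (g - 1) → ℤ))) ∧
    -- the first homology group tells the closed surfaces apart
    (∀ g h : ℕ, Nonempty (CompactSurface.H1 (CompactSurface.OrientableSurface g 0) ≃+
        CompactSurface.H1 (CompactSurface.OrientableSurface h 0)) → g = h) ∧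
    (∀ g h : ℕ, 1 ≤ g → 1 ≤ h →
      Nonempty (CompactSurface.H1 (CompactSurface.NonorientableSurface g 0) ≃+
        CompactSurface.H1 (CompactSurface.NonorientableSurface h 0)) → g = h) ∧
    (∀ g h : ℕ, 1 ≤ h →
      IsEmpty (CompactSurface.H1 (CompactSurface.OrientableSurface g 0) ≃+
        CompactSurface.H1 (CompactSurface.NonorientableSurface h 0))) ∧
    -- hence no two of the closed surfaces are homeomorphic
    (∀ g h : ℕ, Nonempty (CompactSurface.OrientableSurface g 0 ≃ₜ
        CompactSurface.OrientableSurface h 0) → g = h) ∧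
    (∀ g h : ℕ, 1 ≤ g → 1 ≤ h →
      Nonempty (CompactSurface.NonorientableSurface g 0 ≃ₜ
        CompactSurface.NonorientableSurface h 0) → g = h) ∧
    (∀ g h : ℕ, 1 ≤ h →
      IsEmpty (CompactSurface.OrientableSurface g 0 ≃ₜ
        CompactSurface.NonorientableSurface h 0)) := by
  open CompactSurface in
  exact ⟨fun g k => (OrientableSurface.isPresentedBy g k).nonempty_mulEquiv,
    fun g k _ => (NonorientableSurface.isPresentedBy g k).nonempty_mulEquiv,
    nonempty_H1_orientableSurface, nonempty_H1_nonorientableSurface,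
    fun _ _ => eq_of_H1_orientableSurface, fun _ _ => eq_of_H1_nonorientableSurface,
    isEmpty_H1_equiv,
    fun _ _ ⟨f⟩ => eq_of_H1_orientableSurface (nonempty_H1_equiv_of_homeomorph f),
    fun _ _ hg hh ⟨f⟩ => eq_of_H1_nonorientableSurface hg hh (nonempty_H1_equiv_of_homeomorph f),
    fun g h hh => ⟨fun f =>
      (nonempty_H1_equiv_of_homeomorph f).elim (isEmpty_H1_equiv g h hh).false⟩⟩
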